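/- All links are oriented, ordered, piecewise linear links in $\mathbb{R}^3$, considered up to ambient isotopy. The \emph{doubled-delta move} is the delta move (inside a ball, three strands that cross pairwise in one point each of a projection, in such a way that each passes over one of the other two and under the remaining one, are replaced by moving one of them to the other side of the crossing of the other two, with the over/under information of every pair unchanged) in which each of the three strands is replaced by a pair of parallel, oppositely oriented strands; the six strands may belong to any components. A \emph{Seifert surface} of a link $L$ is a connected, oriented, compact embedded surface $\Sigma$ with $\partial\Sigma=L$; given a basis $(b_i)$ of $H_1(\Sigma;\mathbb{Z})$, the matrix with entries $lk(b_i,b_j^+)$, where $b_j^+$ is the pushoff of $b_j$ in the positive normal direction, is a \emph{Seifert matrix} of $L$. Two square integral matrices are \emph{S-equivalent} if they are related by a finite sequence of congruences $M\leftrightarrow A^tMA$ ($A$ integral, $\det A=\pm1$) and enlargements or reductions $$M\;\leftrightarrow\;\begin{pmatrix}M&y^t&0\\x&z&0\\0&1&0\end{pmatrix},\qquad M\;\leftrightarrow\;\begin{pmatrix}M&y^t&0\\x&z&1\\0&0&0\end{pmatrix};$$ two links are \emph{S-equivalent} if they have S-equivalent Seifert matrices. \textbf{Proposition.} S-equivalence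 is not a sufficient condition for two links to be related by a sequence of doubled-delta moves. More precisely: (1) If two $m$-component links $L,L'$ are related by a finite sequence of doubled-delta moves, then $lk(L_i,L_j)=lk(L'_i,L'_j)$ for all $i\neq j$. (2) There are 3-component links $L_0$ and $L_1$ such that $L_0$ has the Seifert matrix $M_0=\begin{pmatrix}-1&-1\\-1&-1\end{pmatrix}$ and $L_1$ has the Seifert matrix $M_1=\begin{pmatrix}-1&0\\0&0\end{pmatrix}$, where $A^tM_1A=M_0$ for $A=\begin{pmatrix}1&1\\0&1\end{pmatrix}$, so that $L_0$ and $L_1$ are S-equivalent; the linking numbers of the pairs of components $(1,2),(1,3),(2,3)$ are $-1,2,2$ for $L_0$ and $1,0,0$ for $L_1$; and $L_0$ and $L_1$ are not related by any finite sequence of doubled-delta moves. -/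

import Mathlib

open scoped Matrix

noncomputable section

/-- Euclidean 3-space; only its affine structure, its topology and its orientation are used. -/
abbrev E3 : Type := Fin 3 → ℝ

/-- The determinant of three vectors. -/
def det3 (u v w : E3) : ℝ := Matrix.det (Matrix.of ![u, v, w])

/-! ## Linking numbers of polygonal 1-cycles -/

/-- Formal integral sums of oriented straight segments `(a, b)` (from `a` to `b`). -/
abbrev SegChain : Type := (E3 × E3) →₀ ℤ

/-- The sign with which the oriented segment `e` passes over the oriented segment `f` when one
looks along `v` (with `v` pointing upwards), and `0` if it does not pass over `f`. -/
def overSign (v : E3) (e f : E3 × E3) : ℤ :=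
  open Classical in
  if ∃ s ∈ Set.Ioo (0 : ℝ) 1, ∃ t ∈ Set.Ioo (0 : ℝ) 1, ∃ r : ℝ, 0 < r ∧
      AffineMap.lineMap e.1 e.2 s = AffineMap.lineMap f.1 f.2 t + r • v
  then (SignType.sign (det3 (e.2 - e.1) (f.2 - f.1) v) : ℤ) else 0

/-- The point `a` and the segment `f` have disjoint shadows under projection along `v`. -/
def ShadowAvoids (v a : E3) (f : E3 × E3) : Prop :=
  ∀ r : ℝ, a + r • v ∉ segment ℝ f.1 f.2

/-- The projection along `v` is generic for the pair `Z`, `W`: no endpoint of a segment of one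
chain projects into the projection of a segment of the other one. -/
def IsGenericDirection (Z W : SegChain) (v : E3) : Prop :=
  v ≠ 0 ∧ ∀ e ∈ Z.support, ∀ f ∈ W.support,
    ShadowAvoids v e.1 f ∧ ShadowAvoids v e.2 f ∧ ShadowAvoids v f.1 e ∧ ShadowAvoids v f.2 e

/-- The signed number of crossings, in the projection along `v`, at which `Z` is over `W`. -/
def overCount (v : E3) (Z W : SegChain) : ℤ :=
  Z.sum fun e c => W.sum fun f d => c * d * overSign v e f

/-- The linking number of two polygonal 1-cycles with disjoint supports: the signed number of
crossings of the first over the second in a generic projection (a generic direction exists, and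
the number does not depend on it). -/
def linkingNumber (Z W : SegChain) : ℤ :=
  open Classical in
  if h : ∃ v, IsGenericDirection Z W v then overCount h.choose Z W else 0

/-! ## Links -/

/-- An oriented, ordered, piecewise linear link with `m` components in 3-space. Its vertices are
indexed by `Fin n`, the oriented edges run from `pos v` to `pos (next v)`, and the cycles of the
permutation `next` are the components, labelled by `Fin m`. -/
structure PLLink (m : ℕ) where
  n : ℕ
  next : Equiv.Perm (Fin n)
  comp : Fin n → Fin m
  comp_surjective : Function.Surjective comp
  comp_eq_iff : ∀ v w, comp v = comp w ↔ next.SameCycle v w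
  pos : Fin n → E3
  /-- The edges, each taken without its final point, are embedded and pairwise disjoint: the
  components are disjoint simple closed curves. -/
  embedded : ∀ v w : Fin n, ∀ s ∈ Set.Ico (0 : ℝ) 1, ∀ t ∈ Set.Ico (0 : ℝ) 1,
    AffineMap.lineMap (pos v) (pos (next v)) s =
      (AffineMap.lineMap (pos w) (pos (next w)) t : E3) → v = w ∧ s = t

namespace PLLink

variable {m : ℕ}

/-- The underlying subset of 3-space. -/
def carrier (L : PLLink m) : Set E3 := ⋃ v, segment ℝ (L.pos v) (L.pos (L.next v))

/-- The `i`-th component as a 1-cycle. -/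
def component (L : PLLink m) (i : Fin m) : SegChain :=
  ∑ v : Fin L.n with L.comp v = i, Finsupp.single (L.pos v, L.pos (L.next v)) 1

/-- The linking number of the components `i` and `j`. -/
def lk (L : PLLink m) (i j : Fin m) : ℤ := linkingNumber (L.component i) (L.component j)

/-- The (periodic) parametrization over the real line, in the direction of the orientation, of
the component through `v`: it is at `v` at time `0` and uses one unit of time per edge. -/
def curve (L : PLLink m) (v : Fin L.n) (x : ℝ) : E3 :=
  AffineMap.lineMap (L.pos ((L.next ^ ⌊x⌋) v)) (L.pos ((L.next ^ (⌊x⌋ + 1)) v)) (Int.fract x)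

/-- Ambient isotopy of oriented, ordered links. -/
def AmbientIsotopic (L L' : PLLink m) : Prop :=
  ∃ H : unitInterval → E3 ≃ₜ E3,
    Continuous (fun p : unitInterval × E3 => H p.1 p.2) ∧
    H 0 = Homeomorph.refl E3 ∧
    ∀ i : Fin m, ∃ v v', L.comp v = i ∧ L'.comp v' = i ∧
      ∃ φ : ℝ ≃o ℝ, ∀ x, H 1 (L.curve v x) = L'.curve v' (φ x)

end PLLink

/-! ## The doubled-delta move -/

/-- The open box in which the move takes place. -/
def ddBox : Set E3 :=
  {p | -10 < p 0 ∧ p 0 < 11 ∧ -10 < p 1 ∧ p 1 < 10 ∧ -5 < p 2 ∧ p 2 < 5}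

/-- The vertices of the strands of the doubled-delta move: `i` is the number of the band, `j`
says which of the two parallel strands of the band is meant, `k` runs through the vertices of the
strand, and `after` distinguishes the tangles before and after the move. Look at the projection
to the first two coordinates, with the third coordinate as height, and let `s = 1`. The strands
of band `0` lie on the lines `y = 0, 1`, at height `1`, those of band `1` on the lines `x = 0, 1`,
at height `0`; so band `0` passes over band `1`. Band `2` passes under band `1` and over band `0`;
before the move it does so on one side of the crossing of bands `0` and `1` (first under the half
`y > 1` of band `1`, then over the half `x > 1` of band `0`), after the move on the opposite side
(first over the half `x < 0` of band `0`, then under the half `y < 0` of band `1`). For `s = -1`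
one gets the mirror image. -/
def ddStrand (s : ℝ) (after : Bool) (i : Fin 3) (j : Fin 2) (k : Fin 4) : E3 :=
  let d : ℝ := ((j : ℕ) : ℝ)
  ![ ![![-10, -5, 5, 11] k, d, s],
     ![d, ![-10, -5, 5, 10] k, 0],
     if after then ![![-10, -5, -4, 10] k + d, ![10, -4, -5, -10] k, s * ![0, 4, -3, 0] k]
     else ![![-10, 4, 5, 10] k + d, ![10, 5, 4, -10] k, s * ![0, -3, 4, 0] k] ] i

namespace PLLink

variable {m : ℕ}

/-- `L'` arises from `L` by a doubled-delta move in the box `ddBox`. The vertices `w i j k` of `L`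
are those of the six strands; `o i` is the strand of the `i`-th band that is traversed forwards,
the other strand of that band is traversed backwards. -/
def DoubledDeltaMove (L L' : PLLink m) : Prop :=
  ∃ (s : ℝ) (e : Fin L.n ≃ Fin L'.n) (w : Fin 3 → Fin 2 → Fin 4 → Fin L.n) (o : Fin 3 → Fin 2),
    (s = 1 ∨ s = -1) ∧
    -- `L` runs through the six strands, oppositely oriented in each pair
    (∀ i j k, L.pos (w i j k) = ddStrand s false i j k) ∧
    (∀ (i : Fin 3) (j : Fin 2) (k : Fin 3),
      if j = o i then L.next (w i j k.castSucc) = w i j k.succ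
      else L.next (w i j k.succ) = w i j k.castSucc) ∧
    -- and has no other points in the box
    L.carrier ∩ ddBox ⊆
      (⋃ (i : Fin 3) (j : Fin 2) (k : Fin 3),
        segment ℝ (ddStrand s false i j k.castSucc) (ddStrand s false i j k.succ)) ∧
    -- `L'` has the same oriented edges and components, and differs only in the six strands
    (∀ v, e (L.next v) = L'.next (e v)) ∧
    (∀ v, L'.comp (e v) = L.comp v) ∧
    (∀ i j k, L'.pos (e (w i j k)) = ddStrand s true i j k) ∧
    (∀ v, (∀ i j k, v ≠ w i j k) → L'.pos (e v) = L.pos v)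

/-- The two links (considered up to ambient isotopy) are related by a finite sequence of
doubled-delta moves. -/
def DoubledDeltaRelated : PLLink m → PLLink m → Prop :=
  Relation.EqvGen fun L L' => AmbientIsotopic L L' ∨ DoubledDeltaMove L L'

end PLLink

/-! ## Seifert surfaces and Seifert matrices -/

/-- A connected, oriented, compact, triangulated surface embedded in 3-space. The triangle `τ` has
the vertices `tri τ 0`, `tri τ 1`, `tri τ 2`, in the order given by the orientation. -/
structure PLSurface where
  n : ℕ
  numTri : ℕ
  pos : Fin n → E3
  tri : Fin numTri → Fin 3 → Fin n
  /-- The triangles are nondegenerate. -/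
  nondegenerate : ∀ τ, AffineIndependent ℝ fun k => pos (tri τ k)
  /-- Different triangles have different vertex sets and meet only in their common face. -/
  tri_inj : ∀ τ τ', Set.range (tri τ) = Set.range (tri τ') → τ = τ'
  inter : ∀ τ τ', convexHull ℝ (pos '' Set.range (tri τ)) ∩ convexHull ℝ (pos '' Set.range (tri τ'))
    ⊆ convexHull ℝ (pos '' (Set.range (tri τ) ∩ Set.range (tri τ')))
  vertex_mem : ∀ x, ∃ τ k, tri τ k = x
  /-- Every oriented edge belongs to at most one triangle; so an edge lies in at most two
  triangles, and they induce opposite orientations on it. -/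
  edge_inj : ∀ τ τ' k k', tri τ k = tri τ' k' → tri τ (k + 1) = tri τ' (k' + 1) → τ = τ' ∧ k = k'
  /-- The link of every vertex is connected (hence an arc or a circle). -/
  link_connected : ∀ x τ k τ' k', tri τ k = x → tri τ' k' = x →
    Relation.EqvGen (fun y z => ∃ σ l, tri σ l = x ∧ tri σ (l + 1) = y ∧ tri σ (l + 2) = z)
      (tri τ (k + 1)) (tri τ' (k' + 1))
  connected : ∀ x y, Relation.EqvGen (fun x y => ∃ τ k, tri τ k = x ∧ tri τ (k + 1) = y) x y

namespace PLSurface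

/-- `(x, y)` is an edge of a triangle, with the orientation induced by the triangle. -/
def DirEdge (F : PLSurface) (x y : Fin F.n) : Prop := ∃ τ k, F.tri τ k = x ∧ F.tri τ (k + 1) = y

/-- The oriented boundary edges. -/
def boundary (F : PLSurface) : Set (E3 × E3) :=
  {p | ∃ x y, F.DirEdge x y ∧ ¬ F.DirEdge y x ∧ p = (F.pos x, F.pos y)}

/-- The union of the triangles, with the vertices placed at `p`. -/
def realization (F : PLSurface) (p : Fin F.n → E3) : Set E3 :=
  ⋃ τ, convexHull ℝ (Set.range fun k => p (F.tri τ k))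

/-- The simplicial 1-cycles with integral coefficients: `c x y` is the coefficient of the edge
from `x` to `y`, and `c y x = - c x y`. -/
def cycles (F : PLSurface) : Submodule ℤ (Fin F.n → Fin F.n → ℤ) where
  carrier := {c | (∀ x y, c y x = - c x y) ∧ (∀ x y, c x y ≠ 0 → F.DirEdge x y ∨ F.DirEdge y x) ∧
    ∀ y, ∑ x, c x y = 0}
  zero_mem' := by simp
  add_mem' := by
    rintro a b ⟨ha, ha', ha''⟩ ⟨hb, hb', hb''⟩
    refine ⟨fun x y => ?_, fun x y h => ?_, fun y => ?_⟩
    · simp only [Pi.add_apply, ha x y, hb x y]; ring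
    · by_cases h0 : a x y = 0
      · exact hb' x y (by simpa [h0] using h)
      · exact ha' x y h0
    · simp [Finset.sum_add_distrib, ha'', hb'']
  smul_mem' := by
    rintro r a ⟨ha, ha', ha''⟩
    refine ⟨fun x y => ?_, fun x y h => ha' x y ?_, fun y => ?_⟩
    · simp [ha x y]
    · intro h0
      simp [h0] at h
    · simp [← Finset.mul_sum, ha'']

/-- The boundary of the triangle `τ`, as a 1-chain. -/
def triBoundary (F : PLSurface) (τ : Fin F.numTri) : Fin F.n → Fin F.n → ℤ := fun x y =>
  ∑ k, ((if F.tri τ k = x ∧ F.tri τ (k + 1) = y then 1 else 0) -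
    (if F.tri τ k = y ∧ F.tri τ (k + 1) = x then 1 else 0))

/-- The group of 1-boundaries. -/
def boundaries (F : PLSurface) : Submodule ℤ (Fin F.n → Fin F.n → ℤ) :=
  Submodule.span ℤ (Set.range F.triBoundary)

/-- The first simplicial homology group, with integral coefficients. -/
abbrev H1 (F : PLSurface) : Type := F.cycles ⧸ F.boundaries.submoduleOf F.cycles

/-- The polygonal cycle in 3-space given by the 1-cycle `c` when the vertices are placed at `p`. -/
def toSegChain (F : PLSurface) (p : Fin F.n → E3) (c : Fin F.n → Fin F.n → ℤ) : SegChain :=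
  ∑ x, ∑ y ∈ Finset.Ioi x, Finsupp.single (p x, p y) (c x y)

/-- Moving each vertex `x` by the vector `ν x`, and the triangles along affinely, pushes the
surface off itself in the positive normal direction: at every corner `ν` is on the positive side
of the triangle, and for all `0 < t ≤ 1` the surface moved by `t ν` is disjoint from the original
one. -/
def IsPositivePushoff (F : PLSurface) (ν : Fin F.n → E3) : Prop :=
  (∀ τ k, 0 < det3 (F.pos (F.tri τ 1) - F.pos (F.tri τ 0)) (F.pos (F.tri τ 2) - F.pos (F.tri τ 0))
    (ν (F.tri τ k))) ∧
  ∀ t ∈ Set.Ioc (0 : ℝ) 1, Disjoint (F.realization F.pos) (F.realization (F.pos + t • ν))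

end PLSurface

namespace PLLink

variable {m : ℕ}

/-- `F` is a Seifert surface of `L`: its oriented boundary is `L`. -/
def IsSeifertSurface (L : PLLink m) (F : PLSurface) : Prop :=
  F.boundary = Set.range fun v => (L.pos v, L.pos (L.next v))

/-- `M` is a Seifert matrix of `L`: for some Seifert surface and some basis of its first homology
group, represented by the cycles `z i`, the entry `M i j` is the linking number of `z i` with the
pushoff of `z j` in the positive normal direction. -/
def IsSeifertMatrix (L : PLLink m) {r : ℕ} (M : Matrix (Fin r) (Fin r) ℤ) : Prop :=
  ∃ (F : PLSurface) (ν : Fin F.n → E3) (b : Module.Basis (Fin r) ℤ F.H1) (z : Fin r → F.cycles),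
    L.IsSeifertSurface F ∧ F.IsPositivePushoff ν ∧ (∀ i, Submodule.Quotient.mk (z i) = b i) ∧
    ∀ i j, M i j =
      linkingNumber (F.toSegChain F.pos (z i)) (F.toSegChain (F.pos + ν) (z j))

end PLLink

/-! ## S-equivalence -/

/-- The enlargement of `M` by the row `x`, the column `y`, the entry `z`, and the entries `p`, `q`
(which are `0`, `1` or `1`, `0`). -/
def enlargement {n : ℕ} (M : Matrix (Fin n) (Fin n) ℤ) (x y : Fin n → ℤ) (z p q : ℤ) :
    Matrix (Fin (n + 2)) (Fin (n + 2)) ℤ :=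
  Matrix.reindex finSumFinEquiv finSumFinEquiv
    (Matrix.fromBlocks M (Matrix.of fun i => ![y i, 0]) (Matrix.of ![x, 0]) !![z, p; q, 0])

/-- The elementary steps of S-equivalence between square integral matrices of arbitrary size. -/
inductive SStep : (Σ n, Matrix (Fin n) (Fin n) ℤ) → (Σ n, Matrix (Fin n) (Fin n) ℤ) → Prop
  | congruence {n : ℕ} (N A : Matrix (Fin n) (Fin n) ℤ) (hA : A.det = 1 ∨ A.det = -1) :
      SStep ⟨n, Aᵀ * N * A⟩ ⟨n, N⟩
  | enlarge₁ {n : ℕ} (M : Matrix (Fin n) (Fin n) ℤ) (x y : Fin n → ℤ) (z : ℤ) :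
      SStep ⟨n, M⟩ ⟨n + 2, enlargement M x y z 0 1⟩
  | enlarge₂ {n : ℕ} (M : Matrix (Fin n) (Fin n) ℤ) (x y : Fin n → ℤ) (z : ℤ) :
      SStep ⟨n, M⟩ ⟨n + 2, enlargement M x y z 1 0⟩

/-- S-equivalence of square integral matrices. -/
def SEquivalentMatrices {n k : ℕ} (M : Matrix (Fin n) (Fin n) ℤ) (N : Matrix (Fin k) (Fin k) ℤ) :
    Prop :=
  Relation.EqvGen SStep ⟨n, M⟩ ⟨k, N⟩

/-- Two links are S-equivalent if they have S-equivalent Seifert matrices. -/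
def PLLink.SEquivalent {m m' : ℕ} (L : PLLink m) (L' : PLLink m') : Prop :=
  ∃ (n k : ℕ) (M : Matrix (Fin n) (Fin n) ℤ) (N : Matrix (Fin k) (Fin k) ℤ),
    L.IsSeifertMatrix M ∧ L'.IsSeifertMatrix N ∧ SEquivalentMatrices M N

end

/-! Linking numbers of distinct components are invariant under ambient isotopy and under the
doubled-delta move, and two explicit S-equivalent links differ in them.

The linking number is the signed count of overcrossings along a generic direction, where generic
means avoiding a null set of directions. Everything rests on one count, `sum_sign_crossesFace`: a
segment crosses the boundary of an intersection of half-spaces with total sign (end inside) minus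
(start inside). For the prism below a triangle this shows that the boundary of a triangle disjoint
from a cycle has crossing number zero with it (`ae_overCountHom_triangle`). For the wedge below a
segment between two directions it shows that the count does not depend on the direction
(`linkingNumber_eq_overCount`).

For an isotopy, fine polygons inscribed in the two components are carried along. Their linking
number is locally constant in time, hence constant, and it agrees with that of the components at
both ends (`PLLink.AmbientIsotopic.lk_eq`). For a doubled-delta move, the two strands of the third
band are moved one after the other. Each step changes one component by a closed curve `moveChain` in
a small convex set. Another component is the sum of its strands, closed up outside the box, and of a
cycle that misses this convex set. The latter does not link `moveChain`, and the former do not by a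
finite computation. This holds for each strand separately, so the antiparallel doubling plays no
role.

Both examples bound a sphere with three holes, and two boundary components form a basis of its
homology. Off the diagonal the Seifert matrix contains their linking number. A diagonal entry is
minus the sum of the linking numbers with the other two components, because the whole boundary
bounds a surface that misses the pushoff. This dictates the linking numbers `-1, 2, 2` for the first
matrix and `1, 0, 0` for the second. With integral vertices, embeddedness, homology and crossings
become sign conditions on integers, which are decided directly. -/

open scoped Matrix
open Set Filter MeasureTheory

noncomputable section

/-! ## Affine functions on an interval -/

section Crossing

variable {ι : Type*} [Fintype ι]

/-- The affine function with index `i` is the only one to vanish at some time in `(p, q)` at which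
all the others are positive. -/
def CrossesFace (α β : ι → ℝ) (p q : ℝ) (i : ι) : Prop :=
  ∃ t ∈ Ioo p q, α i + β i * t = 0 ∧ ∀ j, j ≠ i → 0 < α j + β j * t

-- The region where all functions are positive is convex, so a path starting in it leaves at most
-- once. It leaves at the smallest root of the functions that are negative at `q`, and `h` ensures
-- that only one function vanishes there.
open Classical in
theorem sum_crossesFace_of_pos (α β : ι → ℝ) (p q : ℝ) (hpq : p ≤ q)
    (hp : ∀ i, 0 < α i + β i * p)
    (hq : (∀ i, 0 ≤ α i + β i * q) → ∀ i, 0 < α i + β i * q)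
    (h : ∀ t ∈ Ioo p q, (∀ k, 0 ≤ α k + β k * t) →
      ∀ i j, α i + β i * t = 0 → α j + β j * t = 0 → i = j) :
    ∑ i, (if CrossesFace α β p q i then (1 : ℤ) else 0) =
      1 - if ∀ i, 0 < α i + β i * q then (1 : ℤ) else 0 := by
  have hroot : ∀ i t, t ∈ Ioo p q → α i + β i * t = 0 → β i < 0 := by
    intro i t ht h0
    have := hp i
    by_contra hb
    push Not at hb
    nlinarith [mul_nonneg hb (sub_nonneg.2 ht.1.le)]
  by_cases hin : ∀ i, 0 < α i + β i * q
  · rw [if_pos hin, sub_self]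
    refine Finset.sum_eq_zero fun i _ => if_neg ?_
    rintro ⟨t, ht, h0, -⟩
    have := hroot i t ht h0
    nlinarith [hin i, mul_neg_of_neg_of_pos this (sub_pos.2 ht.2)]
  · rw [if_neg hin, sub_zero]
    have hN : ∃ i, α i + β i * q < 0 := by
      by_contra hc
      push Not at hc
      exact hin (hq hc)
    have hne : (Finset.univ.filter fun i => α i + β i * q < 0).Nonempty := by
      obtain ⟨i, hi⟩ := hN
      exact ⟨i, by simpa using hi⟩
    -- The exit time is the first root of a function that ends up negative.
    obtain ⟨i₀, hi₀, hmin⟩ := Finset.exists_min_image _ (fun i => -α i / β i) hne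
    simp only [Finset.mem_filter, Finset.mem_univ, true_and] at hi₀ hmin
    have hb : ∀ i, α i + β i * q < 0 → β i < 0 := by
      intro i hi
      by_contra hb
      push Not at hb
      nlinarith [hp i, mul_nonneg hb (sub_nonneg.2 hpq)]
    set r := -α i₀ / β i₀ with hr
    have hb0 := hb i₀ hi₀
    have hr0 : α i₀ + β i₀ * r = 0 := by
      rw [hr]; have := hb0.ne; field_simp; ring
    have hrp : p < r := by
      by_contra hc
      push Not at hc
      nlinarith [hp i₀, mul_nonneg_of_nonpos_of_nonpos hb0.le (sub_nonpos.2 hc)]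
    have hrq : r < q := by
      by_contra hc
      push Not at hc
      nlinarith [mul_nonneg_of_nonpos_of_nonpos hb0.le (sub_nonpos.2 hc)]
    have hnn : ∀ j, 0 ≤ α j + β j * r := by
      intro j
      by_cases hj : α j + β j * q < 0
      · have h1 := hmin j hj
        have h2 := hb j hj
        rw [le_div_iff_of_neg h2] at h1
        linarith
      · push Not at hj
        have h1 := hp j
        have h2 : α j + β j * r = ((q - r) * (α j + β j * p) + (r - p) * (α j + β j * q)) / (q - p) := by
          have : q - p ≠ 0 := by linarith
          field_simp
          ring
        rw [h2]
        refine div_nonneg (add_nonneg (mul_nonneg ?_ h1.le) (mul_nonneg ?_ hj)) ?_ <;> linarith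
    rw [Finset.sum_eq_single i₀, if_pos]
    · refine ⟨r, ⟨hrp, hrq⟩, hr0, fun j hj => lt_of_le_of_ne (hnn j) fun h0 => ?_⟩
      exact hj (h r ⟨hrp, hrq⟩ hnn j i₀ h0.symm hr0)
    · intro i _ hi
      refine if_neg ?_
      rintro ⟨t, ht, h0, hj⟩
      have h1 := hj i₀ (Ne.symm hi)
      have h2 := hroot i t ht h0
      have h3 : α i + β i * q < 0 := by nlinarith [mul_neg_of_neg_of_pos h2 (sub_pos.2 ht.2)]
      have h4 := hmin i h3
      rw [le_div_iff_of_neg h2] at h4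
      have h5 : (β i) * (t - r) ≤ 0 := by linarith
      have h6 : β i₀ * (t - r) > 0 := by linarith
      have h7 : t - r < 0 := by
        by_contra hc
        push Not at hc
        nlinarith [mul_nonpos_of_nonpos_of_nonneg hb0.le hc]
      nlinarith [mul_pos_of_neg_of_neg h2 h7]
    · simp

open Classical in
/-- A segment crosses the boundary of a region bounded by finitely many planes with the signed
count given by the positions of its endpoints. -/
theorem sum_sign_crossesFace (α β : ι → ℝ)
    (h0 : (∀ i, 0 ≤ α i) → ∀ i, 0 < α i)
    (h1 : (∀ i, 0 ≤ α i + β i) → ∀ i, 0 < α i + β i)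
    (h : ∀ t ∈ Ioo (0 : ℝ) 1, (∀ k, 0 ≤ α k + β k * t) →
      ∀ i j, α i + β i * t = 0 → α j + β j * t = 0 → i = j) :
    ∑ i, (if CrossesFace α β 0 1 i then (SignType.sign (β i) : ℤ) else 0) =
      (if ∀ i, 0 < α i + β i then (1 : ℤ) else 0) - if ∀ i, 0 < α i then (1 : ℤ) else 0 := by
  -- From a time `s` inside the region the path is followed forwards and backwards. Forward exits
  -- have `β i < 0`; backward exits are entrances of the original path and have `0 < β i`.
  by_cases hS : ∃ t ∈ Icc (0 : ℝ) 1, ∀ i, 0 < α i + β i * t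
  · obtain ⟨s, hs, hpos⟩ := hS
    have hE := sum_crossesFace_of_pos α β s 1 hs.2 hpos (by simpa using h1)
      (fun t ht => h t ⟨hs.1.trans_lt ht.1, ht.2⟩)
    have hB := sum_crossesFace_of_pos α (fun i => -β i) (-s) 0 (by linarith [hs.1])
      (fun i => by simpa using hpos i) (by simpa using h0)
      (fun t ht => by
        have := h (-t) ⟨by linarith [ht.2], by linarith [ht.1, hs.2]⟩
        simpa using this)
    have key : ∀ i, (if CrossesFace α β 0 1 i then (SignType.sign (β i) : ℤ) else 0) =
        (if CrossesFace α (fun i => -β i) (-s) 0 i then (1 : ℤ) else 0) -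
          if CrossesFace α β s 1 i then (1 : ℤ) else 0 := by
      intro i
      have hl : CrossesFace α β 0 1 i ↔
          CrossesFace α (fun i => -β i) (-s) 0 i ∨ CrossesFace α β s 1 i := by
        constructor
        · rintro ⟨t, ht, hz, hj⟩
          rcases lt_trichotomy t s with hts | hts | hts
          · exact Or.inl ⟨-t, ⟨by linarith, by linarith [ht.1]⟩, by simpa using hz,
              fun j hji => by simpa using hj j hji⟩
          · rw [hts] at hz
            exact absurd hz (hpos i).ne'
          · exact Or.inr ⟨t, ⟨hts, ht.2⟩, hz, hj⟩
        · rintro (⟨t, ht, hz, hj⟩ | ⟨t, ht, hz, hj⟩)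
          · exact ⟨-t, ⟨by linarith [ht.2], by linarith [ht.1, hs.2]⟩, by simpa using hz,
              fun j hji => by simpa using hj j hji⟩
          · exact ⟨t, ⟨hs.1.trans_lt ht.1, ht.2⟩, hz, hj⟩
      have hA : CrossesFace α (fun i => -β i) (-s) 0 i → 0 < β i := by
        rintro ⟨t, ht, hz, -⟩
        by_contra hc
        push Not at hc
        nlinarith [hpos i, mul_nonneg_of_nonpos_of_nonpos hc (show -t - s ≤ 0 by linarith [ht.1])]
      have hC : CrossesFace α β s 1 i → β i < 0 := by
        rintro ⟨t, ht, hz, -⟩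
        by_contra hc
        push Not at hc
        nlinarith [hpos i, mul_nonneg hc (sub_nonneg.2 ht.1.le)]
      by_cases c1 : CrossesFace α (fun i => -β i) (-s) 0 i
      · have c2 : ¬ CrossesFace α β s 1 i := fun c2 => lt_asymm (hA c1) (hC c2)
        rw [if_pos (hl.2 (Or.inl c1)), if_pos c1, if_neg c2, sign_pos (hA c1)]
        simp
      · by_cases c2 : CrossesFace α β s 1 i
        · rw [if_pos (hl.2 (Or.inr c2)), if_neg c1, if_pos c2, sign_neg (hC c2)]
          simp
        · rw [if_neg (fun hh => (hl.1 hh).elim c1 c2), if_neg c1, if_neg c2]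
          simp
    rw [Finset.sum_congr rfl fun i _ => key i, Finset.sum_sub_distrib, hE, hB]
    simp
  -- A path that never meets the open region can touch a face only with `β i = 0`, which counts
  -- zero: otherwise a small change of time would lead inside.
  · have h0' : ¬ ∀ i, 0 < α i := fun hh => hS ⟨0, by simp, by simpa using hh⟩
    have h1' : ¬ ∀ i, 0 < α i + β i := fun hh => hS ⟨1, by simp, by simpa using hh⟩
    rw [if_neg h0', if_neg h1', sub_self]
    refine Finset.sum_eq_zero fun i _ => ?_
    split_ifs with hc
    · obtain ⟨t, ht, hz, hj⟩ := hc
      by_contra hne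
      have hb : β i ≠ 0 := fun hb => hne (by simp [hb])
      have hev : ∀ᶠ s in nhds t, s ∈ Ioo (0 : ℝ) 1 ∧ ∀ j, j ≠ i → 0 < α j + β j * s := by
        refine Filter.Eventually.and (Ioo_mem_nhds ht.1 ht.2) (Filter.eventually_all.2 fun j => ?_)
        by_cases hji : j = i
        · simp [hji]
        · have hcont : Continuous fun s : ℝ => α j + β j * s := by fun_prop
          filter_upwards [(hcont.tendsto t).eventually_const_lt (hj j hji)] with s hs _ using hs
      obtain ⟨ε, hε, hball⟩ := Metric.eventually_nhds_iff.1 hev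
      have hsg : ∃ δ : ℝ, |δ| < ε ∧ 0 < β i * δ := by
        rcases lt_or_gt_of_ne hb with hb | hb
        · exact ⟨-(ε / 2), by rw [abs_neg, abs_of_pos] <;> linarith, by nlinarith⟩
        · exact ⟨ε / 2, by rw [abs_of_pos] <;> linarith, by positivity⟩
      obtain ⟨δ, hδ, hpos⟩ := hsg
      have := hball (y := t + δ) (by simpa [Real.dist_eq] using hδ)
      refine hS ⟨t + δ, ⟨this.1.1.le, this.1.2.le⟩, fun j => ?_⟩
      by_cases hji : j = i
      · rw [hji]; linarith
      · exact this.2 j hji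
    · rfl

end Crossing

/-! ## Determinants and generic directions -/

theorem det3_eq (u v w : E3) : det3 u v w =
    u 0 * v 1 * w 2 - u 0 * v 2 * w 1 - u 1 * v 0 * w 2 + u 1 * v 2 * w 0 +
      u 2 * v 0 * w 1 - u 2 * v 1 * w 0 := by
  simp [det3, Matrix.det_fin_three]

/-- Cramer's rule: each coordinate is a determinant with one basis vector replaced by `x`, divided
by `det3 u v w`. -/
theorem exists_coordinates {u v w : E3} (h : det3 u v w ≠ 0) :
    ∃ f g k : E3 →ₗ[ℝ] ℝ, ∀ x, x = f x • u + g x • v + k x • w := by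
  refine ⟨IsLinearMap.mk' (fun x => det3 x v w / det3 u v w) ⟨?_, ?_⟩,
    IsLinearMap.mk' (fun x => det3 u x w / det3 u v w) ⟨?_, ?_⟩,
    IsLinearMap.mk' (fun x => det3 u v x / det3 u v w) ⟨?_, ?_⟩, fun x => ?_⟩
  · intro x y; rw [← add_div]; congr 1; simp only [det3_eq, Pi.add_apply]; ring
  · intro c x; simp only [det3_eq, Pi.smul_apply, smul_eq_mul]; ring
  · intro x y; rw [← add_div]; congr 1; simp only [det3_eq, Pi.add_apply]; ring
  · intro c x; simp only [det3_eq, Pi.smul_apply, smul_eq_mul]; ring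
  · intro x y; rw [← add_div]; congr 1; simp only [det3_eq, Pi.add_apply]; ring
  · intro c x; simp only [det3_eq, Pi.smul_apply, smul_eq_mul]; ring
  · simp only [IsLinearMap.mk'_apply]
    have key : det3 u v w • x = det3 x v w • u + det3 u x w • v + det3 u v x • w := by
      ext i
      fin_cases i <;> simp only [det3_eq, Pi.smul_apply, Pi.add_apply, smul_eq_mul, Fin.zero_eta,
        Fin.mk_one, Fin.reduceFinMk] <;> ring
    rw [div_eq_inv_mul, div_eq_inv_mul, div_eq_inv_mul, mul_smul, mul_smul, mul_smul, ← smul_add,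
      ← smul_add, ← key, inv_smul_smul₀ h]

theorem coordinates_unique {u v w : E3} (h : det3 u v w ≠ 0) {a b c a' b' c' : ℝ}
    (hx : a • u + b • v + c • w = a' • u + b' • v + c' • w) : a = a' ∧ b = b' ∧ c = c' := by
  have e : ∀ i, a * u i + b * v i + c * w i = a' * u i + b' * v i + c' * w i := fun i => by
    simpa using congrFun hx i
  have e0 := e 0
  have e1 := e 1
  have e2 := e 2
  have ha : (a - a') * det3 u v w = 0 := by
    rw [det3_eq]
    linear_combination (v 1 * w 2 - v 2 * w 1) * e0 + (v 2 * w 0 - v 0 * w 2) * e1 +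
      (v 0 * w 1 - v 1 * w 0) * e2
  have hb : (b - b') * det3 u v w = 0 := by
    rw [det3_eq]
    linear_combination (w 1 * u 2 - w 2 * u 1) * e0 + (w 2 * u 0 - w 0 * u 2) * e1 +
      (w 0 * u 1 - w 1 * u 0) * e2
  have hc : (c - c') * det3 u v w = 0 := by
    rw [det3_eq]
    linear_combination (u 1 * v 2 - u 2 * v 1) * e0 + (u 2 * v 0 - u 0 * v 2) * e1 +
      (u 0 * v 1 - u 1 * v 0) * e2
  refine ⟨?_, ?_, ?_⟩
  · linarith [(mul_eq_zero.1 ha).resolve_right h]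
  · linarith [(mul_eq_zero.1 hb).resolve_right h]
  · linarith [(mul_eq_zero.1 hc).resolve_right h]

/-- Two vectors whose determinant with every third vector vanishes are parallel. -/
theorem exists_smul_of_det3_eq_zero {u v : E3} (hv : v ≠ 0) (h : ∀ w, det3 u v w = 0) :
    ∃ k : ℝ, u = k • v := by
  have h0 := h ![1, 0, 0]
  have h1 := h ![0, 1, 0]
  have h2 := h ![0, 0, 1]
  simp only [det3_eq, Matrix.cons_val_zero, Matrix.cons_val_one, Matrix.cons_val] at h0 h1 h2
  obtain ⟨i, hi⟩ := Function.ne_iff.1 hv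
  have hi : v i ≠ 0 := hi
  refine ⟨u i / v i, ?_⟩
  ext j
  have : u j * v i = u i * v j := by
    fin_cases i <;> fin_cases j <;> simp only [Fin.zero_eta, Fin.mk_one, Fin.reduceFinMk] <;>
      linarith
  simp only [Pi.smul_apply, smul_eq_mul]
  field_simp
  linarith

/-- A proper subspace is a null set. All genericity conditions below reduce to this one; stated
almost everywhere, finitely many of them can be imposed at once. -/
theorem ae_notMem_span (x y : E3) : ∀ᵐ v : E3, v ∉ Submodule.span ℝ {x, y} := by
  have hne : Submodule.span ℝ {x, y} ≠ (⊤ : Submodule ℝ E3) := by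
    intro h
    have h1 : Module.finrank ℝ (Submodule.span ℝ ({x, y} : Set E3)) ≤ 2 := by
      classical
      have := finrank_span_finset_le_card (R := ℝ) ({x, y} : Finset E3)
      rw [Finset.coe_pair] at this
      exact this.trans Finset.card_le_two
    rw [h, finrank_top] at h1
    simp at h1
  have := Measure.addHaar_submodule (volume : Measure E3) _ hne
  exact measure_eq_zero_iff_ae_notMem.1 this

theorem ae_det3_ne_zero {x y : E3} (h : ∃ w, det3 x y w ≠ 0) : ∀ᵐ v : E3, det3 x y v ≠ 0 := by
  obtain ⟨w, hw⟩ := h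
  filter_upwards [ae_notMem_span x y] with v hv h0
  obtain ⟨f, g, k, hx⟩ := exists_coordinates hw
  apply hv
  have hk : k v = 0 := by
    have h2 : det3 x y v = k v * det3 x y w := by
      conv_lhs => rw [hx v]
      simp only [det3_eq, Pi.add_apply, Pi.smul_apply, smul_eq_mul]
      ring
    rw [h2] at h0
    exact (mul_eq_zero.1 h0).resolve_right hw
  rw [hx v, hk, zero_smul, add_zero]
  exact Submodule.mem_span_pair.2 ⟨_, _, rfl⟩

/-- A line from `a` that meets the segment has its direction in the plane spanned by the vectors
from `a` to the two ends. The parameter zero is excluded by `h`. -/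
theorem ae_shadowAvoids {a : E3} {f : E3 × E3} (h : a ∉ segment ℝ f.1 f.2) :
    ∀ᵐ v : E3, ShadowAvoids v a f := by
  filter_upwards [ae_notMem_span (f.1 - a) (f.2 - a)] with v hv r hr
  apply hv
  have hr0 : r ≠ 0 := by
    rintro rfl
    exact h (by simpa using hr)
  obtain ⟨p, q, -, -, hpq, he⟩ := hr
  refine Submodule.mem_span_pair.2 ⟨r⁻¹ * p, r⁻¹ * q, ?_⟩
  have : v = r⁻¹ • (p • f.1 + q • f.2 - a) := by
    rw [he, add_sub_cancel_left, inv_smul_smul₀ hr0]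
  rw [this, mul_smul, mul_smul, ← smul_add]
  congr 1
  have : a = (p + q) • a := by rw [hpq, one_smul]
  nth_rewrite 3 [this]
  module

/-! ## Crossings of a pair of segments -/

/-- The shadows of the endpoints of each segment avoid the shadow of the other one. -/
def GenericPair (v : E3) (e f : E3 × E3) : Prop :=
  ShadowAvoids v e.1 f ∧ ShadowAvoids v e.2 f ∧ ShadowAvoids v f.1 e ∧ ShadowAvoids v f.2 e

theorem lineMap_mem_segment_of_mem_Icc (a b : E3) {t : ℝ} (ht : t ∈ Icc (0 : ℝ) 1) :
    AffineMap.lineMap a b t ∈ segment ℝ a b := by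
  rw [segment_eq_image_lineMap]
  exact mem_image_of_mem _ ht

theorem ae_genericPair {e f : E3 × E3} (h : Disjoint (segment ℝ e.1 e.2) (segment ℝ f.1 f.2)) :
    ∀ᵐ v : E3, GenericPair v e f := by
  have h1 := disjoint_left.1 h
  have h2 := disjoint_right.1 h
  filter_upwards [ae_shadowAvoids (h1 (left_mem_segment ℝ _ _)),
    ae_shadowAvoids (h1 (right_mem_segment ℝ _ _)), ae_shadowAvoids (h2 (left_mem_segment ℝ _ _)),
    ae_shadowAvoids (h2 (right_mem_segment ℝ _ _))] with v a b c d using ⟨a, b, c, d⟩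

theorem ShadowAvoids.neg {v a : E3} {f : E3 × E3} (h : ShadowAvoids v a f) :
    ShadowAvoids (-v) a f := fun r => by simpa using h (-r)

theorem GenericPair.swap {v : E3} {e f : E3 × E3} (h : GenericPair v e f) : GenericPair v f e :=
  ⟨h.2.2.1, h.2.2.2, h.1, h.2.1⟩

theorem GenericPair.neg {v : E3} {e f : E3 × E3} (h : GenericPair v e f) : GenericPair (-v) e f :=
  ⟨h.1.neg, h.2.1.neg, h.2.2.1.neg, h.2.2.2.neg⟩

/-- `e` passes over `f` along `v` exactly where `f` passes over `e` along `-v`. -/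
theorem overSign_swap (v : E3) (e f : E3 × E3) : overSign v e f = overSign (-v) f e := by
  classical
  have hd : det3 (e.2 - e.1) (f.2 - f.1) v = det3 (f.2 - f.1) (e.2 - e.1) (-v) := by
    simp only [det3_eq, Pi.neg_apply]; ring
  rw [overSign, overSign, hd]
  congr 1
  rw [eq_iff_iff]
  constructor
  · rintro ⟨s, hs, t, ht, r, hr, h⟩
    exact ⟨t, ht, s, hs, r, hr, by rw [h, smul_neg, add_neg_cancel_right]⟩
  · rintro ⟨s, hs, t, ht, r, hr, h⟩
    exact ⟨t, ht, s, hs, r, hr, by rw [h, smul_neg, neg_add_cancel_right]⟩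

/-- The crossings of `f` with the sector `p - {μ v + ν w | μ, ν > 0}`. -/
def sectorSign (v w p : E3) (f : E3 × E3) : ℤ :=
  open Classical in
  if ∃ t ∈ Ioo (0 : ℝ) 1, ∃ μ ν : ℝ, 0 < μ ∧ 0 < ν ∧
      p = AffineMap.lineMap f.1 f.2 t + μ • v + ν • w
  then (SignType.sign (det3 (f.2 - f.1) v w) : ℤ) else 0

theorem sign_mul_int (x y : ℝ) : ((SignType.sign (x * y) : SignType) : ℤ) =
    (SignType.sign x : ℤ) * (SignType.sign y : ℤ) := by
  rw [sign_mul, SignType.coe_mul]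

theorem ite_sign_mul {P Q : Prop} [Decidable P] [Decidable Q] (hPQ : P ↔ Q) {x y z : ℝ}
    (h : x = y * z) :
    (if P then ((SignType.sign x : SignType) : ℤ) else 0) =
      (SignType.sign y : ℤ) * if Q then ((SignType.sign z : SignType) : ℤ) else 0 := by
  subst h
  by_cases hP : P
  · rw [if_pos hP, if_pos (hPQ.1 hP), sign_mul_int]
  · rw [if_neg hP, if_neg (fun hq => hP (hPQ.2 hq)), mul_zero]

theorem linearMap_lineMap_sub (l : E3 →ₗ[ℝ] ℝ) (a c d : E3) (t : ℝ) :
    l ((AffineMap.lineMap c d t : E3) - a) = l (c - a) + (l (d - a) - l (c - a)) * t := by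
  have : (AffineMap.lineMap c d t : E3) - a = (c - a) + t • ((d - a) - (c - a)) := by
    rw [AffineMap.lineMap_apply_module']; module
  rw [this, map_add, map_smul, map_sub l (d - a), smul_eq_mul, mul_comm]

/-- Whether all coordinates of a point are positive. -/
def posIndicator {n : ℕ} (co : E3 → Fin n → ℝ) (x : E3) : ℤ :=
  open Classical in if ∀ i, 0 < co x i then 1 else 0

/-- The segment crosses the face of the region `{co > 0}` on which the coordinate `i` vanishes. -/
def CrossesCoordinate {n : ℕ} (co : E3 → Fin n → ℝ) (f : E3 × E3) (i : Fin n) : Prop :=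
  ∃ t ∈ Ioo (0 : ℝ) 1, co (AffineMap.lineMap f.1 f.2 t) i = 0 ∧
    ∀ j, j ≠ i → 0 < co (AffineMap.lineMap f.1 f.2 t) j

-- The count for a segment in space and affine coordinates `co`. The hypotheses say that its ends
-- are not on the boundary of `{co > 0}` and that it meets this boundary only inside faces.
open Classical in
theorem sum_sign_crossesCoordinate {n : ℕ} (co : E3 → Fin n → ℝ)
    (hco : ∀ p q t i, co (AffineMap.lineMap p q t) i = co p i + (co q i - co p i) * t)
    (f : E3 × E3)
    (h0 : (∀ i, 0 ≤ co f.1 i) → ∀ i, 0 < co f.1 i)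
    (h1 : (∀ i, 0 ≤ co f.2 i) → ∀ i, 0 < co f.2 i)
    (h : ∀ t ∈ Ioo (0 : ℝ) 1, (∀ k, 0 ≤ co (AffineMap.lineMap f.1 f.2 t) k) →
      ∀ i j, co (AffineMap.lineMap f.1 f.2 t) i = 0 → co (AffineMap.lineMap f.1 f.2 t) j = 0 →
        i = j) :
    ∑ i, (if CrossesCoordinate co f i then (SignType.sign (co f.2 i - co f.1 i) : ℤ) else 0) =
      posIndicator co f.2 - posIndicator co f.1 := by
  have := sum_sign_crossesFace (fun i => co f.1 i) (fun i => co f.2 i - co f.1 i) h0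
    (by simpa using h1) (by simpa only [hco] using h)
  simp only [add_sub_cancel] at this
  refine (Finset.sum_congr rfl fun i _ => ?_).trans (this.trans ?_)
  · congr 1
    simp only [CrossesCoordinate, CrossesFace, hco]
  · unfold posIndicator
    congr

theorem convexHull_triple_mem (a b c : E3) {x y z : ℝ} (hx : 0 ≤ x) (hy : 0 ≤ y) (hz : 0 ≤ z)
    (h : x + y + z = 1) : x • a + y • b + z • c ∈ convexHull ℝ ({a, b, c} : Set E3) := by
  have := (convex_convexHull ℝ ({a, b, c} : Set E3)).sum_mem (t := Finset.univ)
    (w := ![x, y, z]) (z := ![a, b, c]) (fun i _ => by fin_cases i <;> simpa) (by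
      simpa [Fin.sum_univ_three] using h) (fun i _ => by
      apply subset_convexHull
      fin_cases i <;> simp)
  simpa [Fin.sum_univ_three] using this

/-- A segment disjoint from a triangle crosses under its boundary with the signed count given by
the positions of its endpoints. -/
theorem exists_overSign_triangle (a b c v : E3) (hD : det3 (b - a) (c - a) v ≠ 0) :
    ∃ g : E3 → ℤ, ∀ f : E3 × E3, GenericPair v (a, b) f → GenericPair v (b, c) f →
      GenericPair v (a, c) f → Disjoint (convexHull ℝ {a, b, c}) (segment ℝ f.1 f.2) →
      overSign v (a, b) f + overSign v (b, c) f - overSign v (a, c) f = g f.2 - g f.1 := by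
  classical
  obtain ⟨F, G, K, hx⟩ := exists_coordinates hD
  -- Barycentric coordinates of the shadow, and the depth below the plane of the triangle. So `{co >
  -- 0}` is the open prism below the triangle, and an edge passes over `f` exactly where `f` crosses
  -- the wall below that edge.
  set co : E3 → Fin 4 → ℝ := fun x =>
    ![1 - F (x - a) - G (x - a), F (x - a), G (x - a), -K (x - a)] with hco
  set D := det3 (b - a) (c - a) v with hDdef
  refine ⟨fun x => (SignType.sign D : ℤ) * posIndicator co x, fun f hab hbc hac hdis => ?_⟩
  have hsum : ∀ x, co x 0 + co x 1 + co x 2 = 1 := fun x => by simp [hco, -map_sub]; ring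
  have hpt : ∀ x, x = co x 0 • a + co x 1 • b + co x 2 • c - co x 3 • v := by
    intro x
    have h1 := hx (x - a)
    have h2 : x = a + (x - a) := by abel
    nth_rewrite 1 [h2]
    rw [h1]
    simp only [hco, Matrix.cons_val_zero, Matrix.cons_val_one, Matrix.cons_val]
    module
  have haff : ∀ p q t i, co (AffineMap.lineMap p q t) i = co p i + (co q i - co p i) * t := by
    intro p q t i
    fin_cases i <;> simp [hco, linearMap_lineMap_sub, -map_sub] <;> ring
  -- coordinates of a point with a given expression
  have huniq : ∀ y (s₁ s₂ r : ℝ), y = a + s₁ • (b - a) + s₂ • (c - a) - r • v →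
      co y 0 = 1 - s₁ - s₂ ∧ co y 1 = s₁ ∧ co y 2 = s₂ ∧ co y 3 = r := by
    intro y s₁ s₂ r hy
    have h1 := hx (y - a)
    have h2 : y - a = s₁ • (b - a) + s₂ • (c - a) + (-r) • v := by rw [hy]; module
    obtain ⟨e1, e2, e3⟩ := coordinates_unique hD (h1.symm.trans h2)
    simp [hco, e1, e2, e3, -map_sub]
  have hne3 : ∀ x ∈ segment ℝ f.1 f.2, (∀ k, 0 ≤ co x k) → co x 3 ≠ 0 := by
    intro x hxs hk h3
    refine disjoint_left.1 hdis ?_ hxs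
    have := hpt x
    rw [h3, zero_smul, sub_zero] at this
    rw [this]
    exact convexHull_triple_mem a b c (hk 0) (hk 1) (hk 2) (hsum x)
  have hend : ∀ x ∈ segment ℝ f.1 f.2, ShadowAvoids v x (a, b) → ShadowAvoids v x (b, c) →
      ShadowAvoids v x (a, c) → (∀ i, 0 ≤ co x i) → ∀ i, 0 < co x i := by
    intro x hxs s1 s2 s3 hk i
    refine lt_of_le_of_ne (hk i) (Ne.symm fun h0 => ?_)
    have e := hpt x
    have e' := hsum x
    fin_cases i
    · simp only [Fin.zero_eta] at h0
      exact s2 (co x 3) ⟨co x 1, co x 2, hk 1, hk 2, by linarith, by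
        rw [← sub_eq_iff_eq_add]; refine Eq.trans ?_ e.symm; rw [h0]; module⟩
    · simp only [Fin.mk_one] at h0
      exact s3 (co x 3) ⟨co x 0, co x 2, hk 0, hk 2, by linarith, by
        rw [← sub_eq_iff_eq_add]; refine Eq.trans ?_ e.symm; rw [h0]; module⟩
    · simp only [Fin.reduceFinMk] at h0
      exact s1 (co x 3) ⟨co x 0, co x 1, hk 0, hk 1, by linarith, by
        rw [← sub_eq_iff_eq_add]; refine Eq.trans ?_ e.symm; rw [h0]; module⟩
    · exact hne3 x hxs hk h0
  have hsumF := sum_sign_crossesCoordinate co haff f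
    (hend f.1 (left_mem_segment ℝ _ _) hab.2.2.1 hbc.2.2.1 hac.2.2.1)
    (hend f.2 (right_mem_segment ℝ _ _) hab.2.2.2 hbc.2.2.2 hac.2.2.2) (by
      intro t ht hk i j hi hj
      set x : E3 := AffineMap.lineMap f.1 f.2 t
      have hxs : x ∈ segment ℝ f.1 f.2 :=
        lineMap_mem_segment_of_mem_Icc _ _ (Ioo_subset_Icc_self ht)
      have h3 := hne3 x hxs hk
      have e := hpt x
      have e' := hsum x
      have n01 : co x 0 = 0 → co x 1 = 0 → False := fun h0 h1 => by
        refine hbc.2.1 (-co x 3) ?_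
        have : co x 2 = 1 := by linarith
        rw [h0, h1, this] at e
        convert hxs using 1
        refine Eq.trans ?_ e.symm; module
      have n02 : co x 0 = 0 → co x 2 = 0 → False := fun h0 h1 => by
        refine hab.2.1 (-co x 3) ?_
        have : co x 1 = 1 := by linarith
        rw [h0, h1, this] at e
        convert hxs using 1
        refine Eq.trans ?_ e.symm; module
      have n12 : co x 1 = 0 → co x 2 = 0 → False := fun h0 h1 => by
        refine hab.1 (-co x 3) ?_
        have : co x 0 = 1 := by linarith
        rw [h0, h1, this] at e
        convert hxs using 1
        refine Eq.trans ?_ e.symm; module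
      fin_cases i <;> fin_cases j <;> first
        | rfl
        | exact (h3 hi).elim
        | exact (h3 hj).elim
        | exact (n01 hi hj).elim
        | exact (n01 hj hi).elim
        | exact (n02 hi hj).elim
        | exact (n02 hj hi).elim
        | exact (n12 hi hj).elim
        | exact (n12 hj hi).elim)
  -- The remaining face of the prism is the triangle itself, which `f` does not meet.
  have hn3 : ¬ CrossesCoordinate co f 3 := by
    rintro ⟨t, ht, hz, hj⟩
    refine hne3 _ (lineMap_mem_segment_of_mem_Icc _ _ (Ioo_subset_Icc_self ht)) (fun k => ?_) hz
    by_cases hk : k = 3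
    · rw [hk, hz]
    · exact (hj k hk).le
  have hq : f.2 - f.1 = (co f.2 1 - co f.1 1) • (b - a) + (co f.2 2 - co f.1 2) • (c - a) -
      (co f.2 3 - co f.1 3) • v := by
    have h0 : ∀ x, co x 0 = 1 - co x 1 - co x 2 := fun x => by linarith [hsum x]
    nth_rewrite 1 [hpt f.2]
    nth_rewrite 1 [hpt f.1]
    rw [h0, h0]
    module
  have e1 : overSign v (a, b) f = (SignType.sign D : ℤ) *
      if CrossesCoordinate co f 2 then (SignType.sign (co f.2 2 - co f.1 2) : ℤ) else 0 := by
    refine ite_sign_mul ⟨?_, ?_⟩ ?_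
    · rintro ⟨s, hs, t, ht, r, hr, h⟩
      rw [AffineMap.lineMap_apply_module'] at h
      obtain ⟨c0, c1, c2, c3⟩ := huniq (AffineMap.lineMap f.1 f.2 t) s 0 r
        (by rw [← sub_eq_iff_eq_add] at h; rw [← h]; module)
      refine ⟨t, ht, c2, fun j hj => ?_⟩
      fin_cases j
      · rw [Fin.zero_eta, c0]; linarith [hs.2]
      · rw [Fin.mk_one, c1]; exact hs.1
      · simp at hj
      · exact hr.trans_eq c3.symm
    · rintro ⟨t, ht, hz, hj⟩
      have := hsum (AffineMap.lineMap f.1 f.2 t)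
      have p0 := hj 0 (by decide)
      refine ⟨_, ⟨hj 1 (by decide), by linarith⟩, t, ht, _, hj 3 (by decide), ?_⟩
      nth_rewrite 2 [hpt (AffineMap.lineMap f.1 f.2 t)]
      rw [AffineMap.lineMap_apply_module, hz,
        show co (AffineMap.lineMap f.1 f.2 t) 0 = 1 - co (AffineMap.lineMap f.1 f.2 t) 1 by linarith]
      module
    · rw [hq, hDdef]
      simp only [det3_eq, Pi.add_apply, Pi.sub_apply, Pi.smul_apply, smul_eq_mul]
      ring
  have e2 : overSign v (b, c) f = (SignType.sign D : ℤ) *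
      if CrossesCoordinate co f 0 then (SignType.sign (co f.2 0 - co f.1 0) : ℤ) else 0 := by
    refine ite_sign_mul ⟨?_, ?_⟩ ?_
    · rintro ⟨s, hs, t, ht, r, hr, h⟩
      rw [AffineMap.lineMap_apply_module'] at h
      obtain ⟨c0, c1, c2, c3⟩ := huniq (AffineMap.lineMap f.1 f.2 t) (1 - s) s r
        (by rw [← sub_eq_iff_eq_add] at h; rw [← h]; module)
      refine ⟨t, ht, by rw [c0]; ring, fun j hj => ?_⟩
      fin_cases j
      · simp at hj
      · rw [Fin.mk_one, c1]; linarith [hs.2]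
      · exact hs.1.trans_eq c2.symm
      · exact hr.trans_eq c3.symm
    · rintro ⟨t, ht, hz, hj⟩
      have := hsum (AffineMap.lineMap f.1 f.2 t)
      have p0 := hj 1 (by decide)
      refine ⟨_, ⟨hj 2 (by decide), by linarith⟩, t, ht, _, hj 3 (by decide), ?_⟩
      nth_rewrite 2 [hpt (AffineMap.lineMap f.1 f.2 t)]
      rw [AffineMap.lineMap_apply_module, hz,
        show co (AffineMap.lineMap f.1 f.2 t) 1 = 1 - co (AffineMap.lineMap f.1 f.2 t) 2 by linarith]
      module
    · have h0 : ∀ x, co x 0 = 1 - co x 1 - co x 2 := fun x => by linarith [hsum x]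
      rw [hq, hDdef, h0, h0]
      simp only [det3_eq, Pi.add_apply, Pi.sub_apply, Pi.smul_apply, smul_eq_mul]
      ring
  -- The sign is reversed because `(a, c)` runs against the boundary orientation of the triangle.
  have e3 : overSign v (a, c) f = (SignType.sign (-D) : ℤ) *
      if CrossesCoordinate co f 1 then (SignType.sign (co f.2 1 - co f.1 1) : ℤ) else 0 := by
    refine ite_sign_mul ⟨?_, ?_⟩ ?_
    · rintro ⟨s, hs, t, ht, r, hr, h⟩
      rw [AffineMap.lineMap_apply_module'] at h
      obtain ⟨c0, c1, c2, c3⟩ := huniq (AffineMap.lineMap f.1 f.2 t) 0 s r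
        (by rw [← sub_eq_iff_eq_add] at h; rw [← h]; module)
      refine ⟨t, ht, c1, fun j hj => ?_⟩
      fin_cases j
      · rw [Fin.zero_eta, c0]; linarith [hs.2]
      · simp at hj
      · exact hs.1.trans_eq c2.symm
      · exact hr.trans_eq c3.symm
    · rintro ⟨t, ht, hz, hj⟩
      have := hsum (AffineMap.lineMap f.1 f.2 t)
      have p0 := hj 0 (by decide)
      refine ⟨_, ⟨hj 2 (by decide), by linarith⟩, t, ht, _, hj 3 (by decide), ?_⟩
      nth_rewrite 2 [hpt (AffineMap.lineMap f.1 f.2 t)]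
      rw [AffineMap.lineMap_apply_module, hz,
        show co (AffineMap.lineMap f.1 f.2 t) 0 = 1 - co (AffineMap.lineMap f.1 f.2 t) 2 by linarith]
      module
    · rw [hq, hDdef]
      simp only [det3_eq, Pi.add_apply, Pi.sub_apply, Pi.smul_apply, smul_eq_mul]
      ring
  rw [Fin.sum_univ_four, if_neg hn3] at hsumF
  rw [e1, e2, e3, Left.sign_neg, SignType.coe_neg]
  simp only [← mul_sub]
  rw [← hsumF]
  ring

/-- Comparison of the crossings along two directions. -/
theorem exists_overSign_direction (a b v w : E3) (hD : det3 (b - a) v w ≠ 0) :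
    ∃ g : E3 → ℤ, ∀ f : E3 × E3, GenericPair v (a, b) f → GenericPair w (a, b) f →
      (∀ x ∈ ({a, b} : Set E3), ∀ y ∈ ({f.1, f.2} : Set E3), ∀ μ ν : ℝ, x ≠ y + μ • v + ν • w) →
      Disjoint (segment ℝ a b) (segment ℝ f.1 f.2) →
      overSign v (a, b) f - overSign w (a, b) f + sectorSign v w a f - sectorSign v w b f =
        g f.2 - g f.1 := by
  classical
  obtain ⟨F, G, K, hx⟩ := exists_coordinates hD
  -- The coordinates describe a point `a + s • (b - a) - μ • v - ν • w` by `1 - s, s, μ, ν`. The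
  -- wedge `{co > 0}` has four faces: the strips below the segment along `w` (`μ = 0`) and along `v`
  -- (`ν = 0`), and the sectors at the two ends.
  set co : E3 → Fin 4 → ℝ := fun x =>
    ![1 - F (x - a), F (x - a), -G (x - a), -K (x - a)] with hco
  set D := det3 (b - a) v w with hDdef
  refine ⟨fun x => (SignType.sign D : ℤ) * posIndicator co x, fun f hv hw hvw hdis => ?_⟩
  have h0 : ∀ x, co x 0 = 1 - co x 1 := fun x => by simp [hco, -map_sub]
  have hpt : ∀ x, x = a + co x 1 • (b - a) - co x 2 • v - co x 3 • w := by
    intro x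
    have h1 := hx (x - a)
    have h2 : x = a + (x - a) := by abel
    nth_rewrite 1 [h2]
    rw [h1]
    simp only [hco, Matrix.cons_val_one, Matrix.cons_val]
    module
  have haff : ∀ p q t i, co (AffineMap.lineMap p q t) i = co p i + (co q i - co p i) * t := by
    intro p q t i
    fin_cases i <;> simp [hco, linearMap_lineMap_sub, -map_sub] <;> ring
  have huniq : ∀ y (s μ ν : ℝ), y = a + s • (b - a) - μ • v - ν • w →
      co y 0 = 1 - s ∧ co y 1 = s ∧ co y 2 = μ ∧ co y 3 = ν := by
    intro y s μ ν hy
    have h1 := hx (y - a)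
    have h2 : y - a = s • (b - a) + (-μ) • v + (-ν) • w := by rw [hy]; module
    obtain ⟨e1, e2, e3⟩ := coordinates_unique hD (h1.symm.trans h2)
    simp [hco, e1, e2, e3, -map_sub]
  have hend : ∀ x ∈ ({f.1, f.2} : Set E3), ShadowAvoids v x (a, b) → ShadowAvoids w x (a, b) →
      (∀ i, 0 ≤ co x i) → ∀ i, 0 < co x i := by
    intro x hxs s1 s2 hk i
    refine lt_of_le_of_ne (hk i) (Ne.symm fun hz => ?_)
    have e := hpt x
    have e' := h0 x
    fin_cases i
    · simp only [Fin.zero_eta] at hz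
      have h1 : co x 1 = 1 := by linarith
      refine hvw b (by simp) x hxs (co x 2) (co x 3) ?_
      rw [← sub_eq_iff_eq_add, ← sub_eq_iff_eq_add]; refine Eq.trans ?_ e.symm; rw [h1]; module
    · simp only [Fin.mk_one] at hz
      refine hvw a (by simp) x hxs (co x 2) (co x 3) ?_
      rw [← sub_eq_iff_eq_add, ← sub_eq_iff_eq_add]; refine Eq.trans ?_ e.symm; rw [hz]; module
    · simp only [Fin.reduceFinMk] at hz
      exact s2 (co x 3) ⟨co x 0, co x 1, hk 0, hk 1, by linarith, by
        rw [← sub_eq_iff_eq_add]; refine Eq.trans ?_ e.symm; rw [hz, e']; module⟩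
    · simp only [Fin.reduceFinMk] at hz
      exact s1 (co x 2) ⟨co x 0, co x 1, hk 0, hk 1, by linarith, by
        rw [← sub_eq_iff_eq_add]; refine Eq.trans ?_ e.symm; rw [hz, e']; module⟩
  have hsumF := sum_sign_crossesCoordinate co haff f
    (hend f.1 (by simp) hv.2.2.1 hw.2.2.1) (hend f.2 (by simp) hv.2.2.2 hw.2.2.2) (by
      intro t ht hk i j hi hj
      set x : E3 := AffineMap.lineMap f.1 f.2 t
      have hxs : x ∈ segment ℝ f.1 f.2 :=
        lineMap_mem_segment_of_mem_Icc _ _ (Ioo_subset_Icc_self ht)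
      have e := hpt x
      have e' := h0 x
      have n01 : co x 0 = 0 → co x 1 = 0 → False := fun h0 h1 => by linarith
      have n23 : co x 2 = 0 → co x 3 = 0 → False := fun h2 h3 => by
        refine disjoint_left.1 hdis ?_ hxs
        refine ⟨co x 0, co x 1, hk 0, hk 1, by linarith, ?_⟩
        rw [h2, h3] at e
        refine Eq.trans ?_ e.symm; rw [e']; module
      have n02 : co x 0 = 0 → co x 2 = 0 → False := fun h0 h1 => by
        refine hw.2.1 (-co x 3) ?_
        have : co x 1 = 1 := by linarith
        rw [this, h1] at e
        convert hxs using 1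
        refine Eq.trans ?_ e.symm; module
      have n03 : co x 0 = 0 → co x 3 = 0 → False := fun h0 h1 => by
        refine hv.2.1 (-co x 2) ?_
        have : co x 1 = 1 := by linarith
        rw [this, h1] at e
        convert hxs using 1
        refine Eq.trans ?_ e.symm; module
      have n12 : co x 1 = 0 → co x 2 = 0 → False := fun h0 h1 => by
        refine hw.1 (-co x 3) ?_
        rw [h0, h1] at e
        convert hxs using 1
        refine Eq.trans ?_ e.symm; module
      have n13 : co x 1 = 0 → co x 3 = 0 → False := fun h0 h1 => by
        refine hv.1 (-co x 2) ?_
        rw [h0, h1] at e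
        convert hxs using 1
        refine Eq.trans ?_ e.symm; module
      fin_cases i <;> fin_cases j <;> first
        | rfl
        | exact (n01 hi hj).elim
        | exact (n01 hj hi).elim
        | exact (n02 hi hj).elim
        | exact (n02 hj hi).elim
        | exact (n03 hi hj).elim
        | exact (n03 hj hi).elim
        | exact (n12 hi hj).elim
        | exact (n12 hj hi).elim
        | exact (n13 hi hj).elim
        | exact (n13 hj hi).elim
        | exact (n23 hi hj).elim
        | exact (n23 hj hi).elim)
  have hq : f.2 - f.1 = (co f.2 1 - co f.1 1) • (b - a) - (co f.2 2 - co f.1 2) • v -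
      (co f.2 3 - co f.1 3) • w := by
    nth_rewrite 1 [hpt f.2]
    nth_rewrite 1 [hpt f.1]
    module
  have e1 : overSign v (a, b) f = (SignType.sign D : ℤ) *
      if CrossesCoordinate co f 3 then (SignType.sign (co f.2 3 - co f.1 3) : ℤ) else 0 := by
    refine ite_sign_mul ⟨?_, ?_⟩ ?_
    · rintro ⟨s, hs, t, ht, r, hr, h⟩
      rw [AffineMap.lineMap_apply_module'] at h
      obtain ⟨c0, c1, c2, c3⟩ := huniq (AffineMap.lineMap f.1 f.2 t) s r 0
        (by rw [← sub_eq_iff_eq_add] at h; rw [← h]; module)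
      refine ⟨t, ht, c3, fun j hj => ?_⟩
      fin_cases j
      · rw [Fin.zero_eta, c0]; linarith [hs.2]
      · rw [Fin.mk_one, c1]; exact hs.1
      · exact hr.trans_eq c2.symm
      · simp at hj
    · rintro ⟨t, ht, hz, hj⟩
      have := h0 (AffineMap.lineMap f.1 f.2 t)
      have p0 := hj 0 (by decide)
      refine ⟨_, ⟨hj 1 (by decide), by linarith⟩, t, ht, _, hj 2 (by decide), ?_⟩
      nth_rewrite 2 [hpt (AffineMap.lineMap f.1 f.2 t)]
      rw [AffineMap.lineMap_apply_module, hz]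
      module
    · rw [hq, hDdef]
      simp only [det3_eq, Pi.sub_apply, Pi.smul_apply, smul_eq_mul]
      ring
  have e2 : overSign w (a, b) f = (SignType.sign (-D) : ℤ) *
      if CrossesCoordinate co f 2 then (SignType.sign (co f.2 2 - co f.1 2) : ℤ) else 0 := by
    refine ite_sign_mul ⟨?_, ?_⟩ ?_
    · rintro ⟨s, hs, t, ht, r, hr, h⟩
      rw [AffineMap.lineMap_apply_module'] at h
      obtain ⟨c0, c1, c2, c3⟩ := huniq (AffineMap.lineMap f.1 f.2 t) s 0 r
        (by rw [← sub_eq_iff_eq_add] at h; rw [← h]; module)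
      refine ⟨t, ht, c2, fun j hj => ?_⟩
      fin_cases j
      · rw [Fin.zero_eta, c0]; linarith [hs.2]
      · rw [Fin.mk_one, c1]; exact hs.1
      · simp at hj
      · exact hr.trans_eq c3.symm
    · rintro ⟨t, ht, hz, hj⟩
      have := h0 (AffineMap.lineMap f.1 f.2 t)
      have p0 := hj 0 (by decide)
      refine ⟨_, ⟨hj 1 (by decide), by linarith⟩, t, ht, _, hj 3 (by decide), ?_⟩
      nth_rewrite 2 [hpt (AffineMap.lineMap f.1 f.2 t)]
      rw [AffineMap.lineMap_apply_module, hz]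
      module
    · rw [hq, hDdef]
      simp only [det3_eq, Pi.sub_apply, Pi.smul_apply, smul_eq_mul]
      ring
  have e3 : sectorSign v w a f = (SignType.sign D : ℤ) *
      if CrossesCoordinate co f 1 then (SignType.sign (co f.2 1 - co f.1 1) : ℤ) else 0 := by
    refine ite_sign_mul ⟨?_, ?_⟩ ?_
    · rintro ⟨t, ht, μ, ν, hμ, hν, h⟩
      obtain ⟨c0, c1, c2, c3⟩ := huniq (AffineMap.lineMap f.1 f.2 t) 0 μ ν
        (by rw [eq_comm, ← eq_sub_iff_add_eq, ← eq_sub_iff_add_eq] at h; rw [h]; module)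
      refine ⟨t, ht, c1, fun j hj => ?_⟩
      fin_cases j
      · rw [Fin.zero_eta, c0]; norm_num
      · simp at hj
      · exact hμ.trans_eq c2.symm
      · exact hν.trans_eq c3.symm
    · rintro ⟨t, ht, hz, hj⟩
      refine ⟨t, ht, _, _, hj 2 (by decide), hj 3 (by decide), ?_⟩
      nth_rewrite 1 [hpt (AffineMap.lineMap f.1 f.2 t)]
      rw [hz]
      module
    · rw [hq, hDdef]
      simp only [det3_eq, Pi.sub_apply, Pi.smul_apply, smul_eq_mul]
      ring
  have e4 : sectorSign v w b f = (SignType.sign (-D) : ℤ) *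
      if CrossesCoordinate co f 0 then (SignType.sign (co f.2 0 - co f.1 0) : ℤ) else 0 := by
    refine ite_sign_mul ⟨?_, ?_⟩ ?_
    · rintro ⟨t, ht, μ, ν, hμ, hν, h⟩
      obtain ⟨c0, c1, c2, c3⟩ := huniq (AffineMap.lineMap f.1 f.2 t) 1 μ ν
        (by rw [eq_comm, ← eq_sub_iff_add_eq, ← eq_sub_iff_add_eq] at h; rw [h]; module)
      refine ⟨t, ht, by rw [c0]; norm_num, fun j hj => ?_⟩
      fin_cases j
      · simp at hj
      · rw [Fin.mk_one, c1]; norm_num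
      · exact hμ.trans_eq c2.symm
      · exact hν.trans_eq c3.symm
    · rintro ⟨t, ht, hz, hj⟩
      have := h0 (AffineMap.lineMap f.1 f.2 t)
      refine ⟨t, ht, _, _, hj 2 (by decide), hj 3 (by decide), ?_⟩
      nth_rewrite 1 [hpt (AffineMap.lineMap f.1 f.2 t)]
      rw [show co (AffineMap.lineMap f.1 f.2 t) 1 = 1 by linarith]
      module
    · rw [hq, hDdef, h0, h0]
      simp only [det3_eq, Pi.sub_apply, Pi.smul_apply, smul_eq_mul]
      ring
  rw [Fin.sum_univ_four] at hsumF
  rw [e1, e2, e3, e4, Left.sign_neg, SignType.coe_neg]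
  simp only [← mul_sub]
  rw [← hsumF]
  ring

/-- The sectors at two points of a line parallel to `u` are nested, and they differ by the strip
below the segment between the points. This serves the degenerate cases, where a segment is parallel
to the direction or a triangle is flat. -/
theorem overSign_eq_sectorSign_sub (p u w : E3) (f : E3 × E3) (α β : ℝ)
    (h : GenericPair w (p + α • u, p + β • u) f) :
    overSign w (p + α • u, p + β • u) f =
      sectorSign u w (p + α • u) f - sectorSign u w (p + β • u) f := by
  classical
  have hdet : det3 ((p + β • u) - (p + α • u)) (f.2 - f.1) w =
      (α - β) * det3 (f.2 - f.1) u w := by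
    simp only [det3_eq, Pi.add_apply, Pi.sub_apply, Pi.smul_apply, smul_eq_mul]
    ring
  by_cases hD : det3 (f.2 - f.1) u w = 0
  · simp only [overSign, sectorSign, hdet, hD, mul_zero, sign_zero, SignType.coe_zero, ite_self,
      sub_zero]
  · obtain ⟨F, G, K, hx⟩ := exists_coordinates hD
    set t := F (p - f.1) with ht
    set μ := G (p - f.1) with hμ
    set ν := K (p - f.1) with hν
    have hp : p = f.1 + t • (f.2 - f.1) + μ • u + ν • w := by
      have := hx (p - f.1)
      rw [← ht, ← hμ, ← hν, sub_eq_iff_eq_add] at this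
      rw [this]; abel
    have hcoord : ∀ (x t' μ' ν' : ℝ),
        p + x • u = AffineMap.lineMap f.1 f.2 t' + μ' • u + ν' • w ↔
          t' = t ∧ μ' = μ + x ∧ ν' = ν := by
      intro x t' μ' ν'
      rw [AffineMap.lineMap_apply_module']
      constructor
      · intro he
        have : t' • (f.2 - f.1) + μ' • u + ν' • w = t • (f.2 - f.1) + (μ + x) • u + ν • w := by
          rw [hp] at he
          have h2 := congrArg (fun y => y - f.1 ) he
          calc _ = t' • (f.2 - f.1) + f.1 + μ' • u + ν' • w - f.1 := by module
            _ = _ := by rw [← h2]; module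
        exact coordinates_unique hD this
      · rintro ⟨rfl, rfl, rfl⟩
        nth_rewrite 1 [hp]
        module
    have hsec : ∀ x, (∃ t' ∈ Ioo (0 : ℝ) 1, ∃ μ' ν' : ℝ, 0 < μ' ∧ 0 < ν' ∧
        p + x • u = AffineMap.lineMap f.1 f.2 t' + μ' • u + ν' • w) ↔
          t ∈ Ioo (0 : ℝ) 1 ∧ 0 < ν ∧ 0 < μ + x := by
      intro x
      constructor
      · rintro ⟨t', ht', μ', ν', hμ', hν', he⟩
        obtain ⟨rfl, rfl, rfl⟩ := (hcoord _ _ _ _).1 he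
        exact ⟨ht', hν', hμ'⟩
      · rintro ⟨h1, h2, h3⟩
        exact ⟨t, h1, _, _, h3, h2, (hcoord _ _ _ _).2 ⟨rfl, rfl, rfl⟩⟩
    have hov : (∃ s ∈ Ioo (0 : ℝ) 1, ∃ t' ∈ Ioo (0 : ℝ) 1, ∃ r : ℝ, 0 < r ∧
        AffineMap.lineMap (p + α • u) (p + β • u) s =
          (AffineMap.lineMap f.1 f.2 t' : E3) + r • w) ↔
          t ∈ Ioo (0 : ℝ) 1 ∧ 0 < ν ∧ ∃ s ∈ Ioo (0 : ℝ) 1, μ + (α + s * (β - α)) = 0 := by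
      have hl : ∀ s, (AffineMap.lineMap (p + α • u) (p + β • u) s : E3) =
          p + (α + s * (β - α)) • u := by
        intro s
        rw [AffineMap.lineMap_apply_module']
        module
      constructor
      · rintro ⟨s, hs, t', ht', r, hr, he⟩
        rw [hl, ← add_zero (AffineMap.lineMap f.1 f.2 t' : E3), ← zero_smul ℝ u, hcoord] at he
        obtain ⟨rfl, h1, rfl⟩ := he
        exact ⟨ht', hr, s, hs, h1.symm⟩
      · rintro ⟨h1, h2, s, hs, h3⟩
        refine ⟨s, hs, t, h1, ν, h2, ?_⟩
        rw [hl, ← add_zero (AffineMap.lineMap f.1 f.2 t : E3), ← zero_smul ℝ u, hcoord]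
        exact ⟨rfl, h3.symm, rfl⟩
    simp only [overSign, sectorSign, hsec, hov, hdet, sign_mul_int]
    by_cases hc : t ∈ Ioo (0 : ℝ) 1 ∧ 0 < ν
    · obtain ⟨hc1, hc2⟩ := hc
      simp only [hc1, hc2, true_and]
      have hne : ∀ x, ShadowAvoids w (p + x • u) f → μ + x ≠ 0 := by
        intro x hsh h0
        refine hsh (-ν) ?_
        have := (hcoord x t (μ + x) ν).2 ⟨rfl, rfl, rfl⟩
        rw [this, h0, zero_smul, add_zero, neg_smul, add_neg_cancel_right]
        exact lineMap_mem_segment_of_mem_Icc _ _ (Ioo_subset_Icc_self hc1)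
      have hα := hne α h.1
      have hβ := hne β h.2.1
      have hs : (∃ s ∈ Ioo (0 : ℝ) 1, μ + (α + s * (β - α)) = 0) ↔
          (μ + α < 0 ∧ 0 < μ + β) ∨ (μ + β < 0 ∧ 0 < μ + α) := by
        constructor
        · rintro ⟨s, hs, he⟩
          have e1 : (1 - s) * (μ + α) + s * (μ + β) = 0 := by linarith
          have h1s : 0 < 1 - s := by linarith [hs.2]
          rcases lt_or_gt_of_ne hα with h1 | h1
          · refine Or.inl ⟨h1, ?_⟩
            by_contra hcon
            push Not at hcon
            nlinarith [mul_neg_of_pos_of_neg h1s h1, mul_nonpos_of_nonneg_of_nonpos hs.1.le hcon]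
          · refine Or.inr ⟨?_, h1⟩
            by_contra hcon
            push Not at hcon
            nlinarith [mul_pos h1s h1, mul_nonneg hs.1.le hcon]
        · rintro (⟨h1, h2⟩ | ⟨h1, h2⟩)
          · refine ⟨-(μ + α) / (β - α), ⟨?_, ?_⟩, ?_⟩
            · apply div_pos <;> linarith
            · rw [div_lt_one] <;> linarith
            · have : β - α ≠ 0 := by linarith
              field_simp
              ring
          · refine ⟨(μ + α) / (α - β), ⟨?_, ?_⟩, ?_⟩
            · apply div_pos <;> linarith
            · rw [div_lt_one] <;> linarith
            · have : α - β ≠ 0 := by linarith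
              field_simp
              ring
      rw [if_congr hs rfl rfl]
      rcases lt_or_gt_of_ne hα with h1 | h1 <;> rcases lt_or_gt_of_ne hβ with h2 | h2
      · simp [h1, h2, h1.not_gt, h2.not_gt]
      · simp [h1, h2, h1.not_gt, h2.not_gt, sign_neg (show α - β < 0 by linarith)]
      · simp [h1, h2, h1.not_gt, h2.not_gt, sign_pos (show 0 < α - β by linarith)]
      · simp [h1, h2, h1.not_gt, h2.not_gt]
    · have h1 : ∀ P : Prop, ¬ (t ∈ Ioo (0 : ℝ) 1 ∧ 0 < ν ∧ P) := fun P hP => hc ⟨hP.1, hP.2.1⟩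
      simp only [h1, if_false, sub_zero]

/-! ## Cycles and their linking number -/

/-- The boundary of the chain vanishes. -/
def IsCycle (Z : SegChain) : Prop := ∀ g : E3 → ℤ, (Z.sum fun e c => c * (g e.2 - g e.1)) = 0

/-- The union of the segments of a chain. -/
def chainCarrier (Z : SegChain) : Set E3 := ⋃ e ∈ Z.support, segment ℝ e.1 e.2

theorem segment_subset_chainCarrier {Z : SegChain} {e : E3 × E3} (he : e ∈ Z.support) :
    segment ℝ e.1 e.2 ⊆ chainCarrier Z := by
  intro x hx
  exact mem_iUnion₂.2 ⟨e, he, hx⟩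

theorem disjoint_segments_of_disjoint_carrier {Z W : SegChain}
    (h : Disjoint (chainCarrier Z) (chainCarrier W)) {e f : E3 × E3} (he : e ∈ Z.support)
    (hf : f ∈ W.support) : Disjoint (segment ℝ e.1 e.2) (segment ℝ f.1 f.2) :=
  h.mono (segment_subset_chainCarrier he) (segment_subset_chainCarrier hf)

theorem isGenericDirection_iff {Z W : SegChain} {v : E3} : IsGenericDirection Z W v ↔
    v ≠ 0 ∧ ∀ e ∈ Z.support, ∀ f ∈ W.support, GenericPair v e f := Iff.rfl

theorem ae_ne_zero : ∀ᵐ v : E3, v ≠ 0 := by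
  filter_upwards [ae_notMem_span 0 0] with v hv h
  exact hv (by rw [h]; exact Submodule.zero_mem _)

theorem exists_of_ae {P : E3 → Prop} (h : ∀ᵐ v : E3, P v) : ∃ v, P v := h.exists

theorem ae_isGenericDirection {Z W : SegChain}
    (h : Disjoint (chainCarrier Z) (chainCarrier W)) : ∀ᵐ v : E3, IsGenericDirection Z W v := by
  simp only [isGenericDirection_iff]
  refine ae_ne_zero.and ?_
  refine (Finset.eventually_all _).2 fun e he => (Finset.eventually_all _).2 fun f hf => ?_
  exact ae_genericPair (disjoint_segments_of_disjoint_carrier h he hf)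

theorem overCount_eq_sum (v : E3) (Z W : SegChain) : overCount v Z W =
    ∑ e ∈ Z.support, ∑ f ∈ W.support, Z e * W f * overSign v e f := rfl

theorem IsCycle.sum_eq_zero {W : SegChain} (hW : IsCycle W) (g : E3 → ℤ) :
    ∑ f ∈ W.support, W f * (g f.2 - g f.1) = 0 := hW g

/-- A second direction `w` can be taken generic relative to the given `v`. An equation `x = y + μ •
v + ν • w` contradicts the genericity of `v` if `ν = 0`, and otherwise confines `w` to a plane.
Independence of `e`, `v`, `w` is claimed only when `e` is not parallel to `v`. -/
theorem ae_generic_for_pair {v : E3} {e f : E3 × E3}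
    (hg : GenericPair v e f) (hdis : Disjoint (segment ℝ e.1 e.2) (segment ℝ f.1 f.2)) :
    ∀ᵐ w : E3, GenericPair w e f ∧
      (∀ x ∈ ({e.1, e.2} : Set E3), ∀ y ∈ ({f.1, f.2} : Set E3), ∀ μ ν : ℝ,
        x ≠ y + μ • v + ν • w) ∧
      ((∃ z, det3 (e.2 - e.1) v z ≠ 0) → det3 (e.2 - e.1) v w ≠ 0) := by
  have h1 : ∀ x y : E3, (∀ μ : ℝ, x ≠ y + μ • v) → ∀ᵐ w : E3, ∀ μ ν : ℝ,
      x ≠ y + μ • v + ν • w := by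
    intro x y hxy
    filter_upwards [ae_notMem_span (x - y) v] with w hw μ ν he
    by_cases hν : ν = 0
    · exact hxy μ (by rw [he, hν, zero_smul, add_zero])
    · refine hw (Submodule.mem_span_pair.2 ⟨ν⁻¹, -(ν⁻¹ * μ), ?_⟩)
      rw [he]
      have : w = (ν⁻¹ * ν) • w := by rw [inv_mul_cancel₀ hν, one_smul]
      nth_rewrite 2 [this]
      module
  have h2 : ∀ᵐ w : E3, (∃ z, det3 (e.2 - e.1) v z ≠ 0) → det3 (e.2 - e.1) v w ≠ 0 := by
    by_cases hz : ∃ z, det3 (e.2 - e.1) v z ≠ 0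
    · filter_upwards [ae_det3_ne_zero hz] with w hw _ using hw
    · exact Eventually.of_forall fun w h => absurd h hz
  have key : ∀ {x y z : E3}, ShadowAvoids v x (y, z) →
      (∀ μ : ℝ, x ≠ y + μ • v) ∧ ∀ μ : ℝ, x ≠ z + μ • v := by
    intro x y z h
    refine ⟨fun μ he => h (-μ) ?_, fun μ he => h (-μ) ?_⟩
    · rw [he, neg_smul, add_neg_cancel_right]
      exact left_mem_segment ℝ _ _
    · rw [he, neg_smul, add_neg_cancel_right]
      exact right_mem_segment ℝ _ _
  filter_upwards [ae_genericPair hdis, h2, h1 _ _ (key hg.1).1, h1 _ _ (key hg.1).2,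
    h1 _ _ (key hg.2.1).1, h1 _ _ (key hg.2.1).2] with w a b c d e f
  refine ⟨a, ?_, b⟩
  rintro x (rfl | rfl) y (rfl | rfl)
  exacts [c, d, e, f]

/-- For each pair of segments, the two counts differ by a coboundary in the ends of `f` and by a
coboundary in the ends of `e`. The former sums to zero because `W` is a cycle, the latter because
`Z` is one. -/
theorem ae_overCount_eq {Z W : SegChain} (hZ : IsCycle Z) (hW : IsCycle W)
    (hdis : Disjoint (chainCarrier Z) (chainCarrier W)) {v : E3}
    (hv : IsGenericDirection Z W v) : ∀ᵐ w : E3, overCount v Z W = overCount w Z W := by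
  have hall : ∀ᵐ w : E3, ∀ e ∈ Z.support, ∀ f ∈ W.support, _ :=
    (Finset.eventually_all _).2 fun e he => (Finset.eventually_all _).2 fun f hf =>
      ae_generic_for_pair (hv.2 e he f hf)
        (disjoint_segments_of_disjoint_carrier hdis he hf)
  filter_upwards [hall] with w hw
  have hloc : ∀ e ∈ Z.support, ∃ g : E3 → ℤ, ∀ f ∈ W.support,
      overSign v e f - overSign w e f =
        (g f.2 - g f.1) + (sectorSign v w e.2 f - sectorSign v w e.1 f) := by
    intro e he
    by_cases hz : ∃ z, det3 (e.2 - e.1) v z ≠ 0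
    · by_cases hne : W.support.Nonempty
      · obtain ⟨f₀, hf₀⟩ := hne
        obtain ⟨g, hg⟩ := exists_overSign_direction e.1 e.2 v w ((hw e he f₀ hf₀).2.2 hz)
        refine ⟨g, fun f hf => ?_⟩
        have := hg f (hv.2 e he f hf) (hw e he f hf).1 (hw e he f hf).2.1
          (disjoint_segments_of_disjoint_carrier hdis he hf)
        simp only [Prod.mk.eta] at this
        linarith
      · exact ⟨0, fun f hf => absurd ⟨f, hf⟩ hne⟩
    -- Here `e` is parallel to `v`: it has no crossings along `v`, and those along `w` are already a
    -- difference of sector signs.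
    · push Not at hz
      obtain ⟨k, hk⟩ := exists_smul_of_det3_eq_zero hv.1 hz
      refine ⟨0, fun f hf => ?_⟩
      have h1 : e.1 + (0 : ℝ) • v = e.1 := by simp
      have h2 : e.1 + k • v = e.2 := by rw [← hk]; abel
      have h3 := overSign_eq_sectorSign_sub e.1 v w f 0 k (by
        rw [h1, h2]; exact (hw e he f hf).1)
      rw [h1, h2, Prod.mk.eta] at h3
      have h4 : overSign v e f = 0 := by
        have : det3 (e.2 - e.1) (f.2 - f.1) v = 0 := by
          rw [hk]
          simp only [det3_eq, Pi.sub_apply, Pi.smul_apply, smul_eq_mul]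
          ring
        simp [overSign, this]
      rw [h3, h4]
      simp
  choose! g hg using hloc
  rw [← sub_eq_zero, overCount_eq_sum, overCount_eq_sum, ← Finset.sum_sub_distrib]
  calc _ = ∑ e ∈ Z.support, (Z e * ∑ f ∈ W.support, W f * (g e f.2 - g e f.1) +
        ∑ f ∈ W.support, W f * (Z e * (sectorSign v w e.2 f - sectorSign v w e.1 f))) := by
        refine Finset.sum_congr rfl fun e he => ?_
        rw [← Finset.sum_sub_distrib, Finset.mul_sum, ← Finset.sum_add_distrib]
        refine Finset.sum_congr rfl fun f hf => ?_
        rw [← mul_sub, hg e he f hf]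
        ring
    _ = 0 := by
        rw [Finset.sum_add_distrib, Finset.sum_comm]
        simp only [← Finset.mul_sum]
        rw [Finset.sum_eq_zero fun e _ => by rw [hW.sum_eq_zero (g e), mul_zero],
          Finset.sum_eq_zero fun f _ => by
            rw [hZ.sum_eq_zero fun x => sectorSign v w x f, mul_zero], add_zero]

/-- The chosen direction and `v` need not be in general position to each other, so both are compared
with a third one. -/
theorem linkingNumber_eq_overCount {Z W : SegChain} (hZ : IsCycle Z) (hW : IsCycle W)
    (hdis : Disjoint (chainCarrier Z) (chainCarrier W)) {v : E3}
    (hv : IsGenericDirection Z W v) : linkingNumber Z W = overCount v Z W := by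
  classical
  have h : ∃ v, IsGenericDirection Z W v := ⟨v, hv⟩
  rw [linkingNumber, dif_pos h]
  obtain ⟨w, h1, h2⟩ := exists_of_ae ((ae_overCount_eq hZ hW hdis hv).and
    (ae_overCount_eq hZ hW hdis h.choose_spec))
  rw [h1, h2]

theorem ae_linkingNumber_eq {Z W : SegChain} (hZ : IsCycle Z) (hW : IsCycle W)
    (hdis : Disjoint (chainCarrier Z) (chainCarrier W)) :
    ∀ᵐ v : E3, linkingNumber Z W = overCount v Z W :=
  (ae_isGenericDirection hdis).mono fun _ hv => linkingNumber_eq_overCount hZ hW hdis hv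

theorem overCount_swap (v : E3) (Z W : SegChain) : overCount v Z W = overCount (-v) W Z := by
  rw [overCount_eq_sum, overCount_eq_sum, Finset.sum_comm]
  refine Finset.sum_congr rfl fun f _ => Finset.sum_congr rfl fun e _ => ?_
  rw [overSign_swap, mul_comm (Z e)]

theorem IsGenericDirection.swap {v : E3} {Z W : SegChain} (h : IsGenericDirection Z W v) :
    IsGenericDirection W Z (-v) :=
  ⟨neg_ne_zero.2 h.1, fun f hf e he => (GenericPair.neg (h.2 e he f hf)).swap⟩

theorem linkingNumber_comm {Z W : SegChain} (hZ : IsCycle Z) (hW : IsCycle W)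
    (hdis : Disjoint (chainCarrier Z) (chainCarrier W)) :
    linkingNumber Z W = linkingNumber W Z := by
  obtain ⟨v, hv⟩ := exists_of_ae (ae_isGenericDirection hdis)
  rw [linkingNumber_eq_overCount hZ hW hdis hv,
    linkingNumber_eq_overCount hW hZ hdis.symm hv.swap, overCount_swap]

/-- The crossings over a fixed chain, as a linear map. -/
def overCountHom (v : E3) (W : SegChain) : SegChain →+ ℤ :=
  Finsupp.liftAddHom fun e => (AddMonoidHom.mulRight (∑ f ∈ W.support, W f * overSign v e f))

theorem overCountHom_apply (v : E3) (Z W : SegChain) : overCountHom v W Z = overCount v Z W := by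
  rw [overCount_eq_sum]
  simp only [overCountHom, Finsupp.liftAddHom_apply, Finsupp.sum, AddMonoidHom.coe_mulRight,
    Finset.mul_sum, mul_assoc]

theorem overCountHom_single (v : E3) (W : SegChain) (e : E3 × E3) (c : ℤ) :
    overCountHom v W (Finsupp.single e c) = c * ∑ f ∈ W.support, W f * overSign v e f := by
  simp [overCountHom]

/-- The boundary of a triangle disjoint from a cycle has vanishing crossing number with it. -/
theorem ae_overCountHom_triangle {W : SegChain} (hW : IsCycle W) {a b c : E3}
    (hdis : Disjoint (convexHull ℝ {a, b, c}) (chainCarrier W)) :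
    ∀ᵐ v : E3, overCountHom v W (Finsupp.single (a, b) 1) + overCountHom v W
      (Finsupp.single (b, c) 1) = overCountHom v W (Finsupp.single (a, c) 1) := by
  have hsub : ∀ {x y : E3}, x ∈ ({a, b, c} : Set E3) → y ∈ ({a, b, c} : Set E3) →
      segment ℝ x y ⊆ convexHull ℝ {a, b, c} := fun hx hy => segment_subset_convexHull hx hy
  have hgen : ∀ {x y : E3}, x ∈ ({a, b, c} : Set E3) → y ∈ ({a, b, c} : Set E3) →
      ∀ᵐ v : E3, ∀ f ∈ W.support, GenericPair v (x, y) f := fun hx hy =>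
    (Finset.eventually_all _).2 fun f hf =>
      ae_genericPair (hdis.mono (hsub hx hy) (segment_subset_chainCarrier hf))
  have hdet : ∀ᵐ v : E3, (∃ z, det3 (b - a) (c - a) z ≠ 0) → det3 (b - a) (c - a) v ≠ 0 := by
    by_cases hz : ∃ z, det3 (b - a) (c - a) z ≠ 0
    · filter_upwards [ae_det3_ne_zero hz] with w hw _ using hw
    · exact Eventually.of_forall fun w h => absurd h hz
  filter_upwards [hgen (x := a) (y := b) (by simp) (by simp),
    hgen (x := b) (y := c) (by simp) (by simp), hgen (x := a) (y := c) (by simp) (by simp),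
    hdet] with v hab hbc hac hd
  have key : ∃ g : E3 → ℤ, ∀ f ∈ W.support,
      overSign v (a, b) f + overSign v (b, c) f - overSign v (a, c) f = g f.2 - g f.1 := by
    by_cases hz : ∃ z, det3 (b - a) (c - a) z ≠ 0
    · obtain ⟨g, hg⟩ := exists_overSign_triangle a b c v (hd hz)
      exact ⟨g, fun f hf => hg f (hab f hf) (hbc f hf) (hac f hf)
        (hdis.mono_right (segment_subset_chainCarrier hf))⟩
    -- A degenerate triangle has its vertices on one line, and the sector signs of its edges
    -- telescope.
    · push Not at hz
      have hcol : ∃ (u : E3) (β γ : ℝ), b = a + β • u ∧ c = a + γ • u := by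
        by_cases hca : c - a = 0
        · exact ⟨b - a, 1, 0, by simp, by simpa [sub_eq_zero] using hca⟩
        · obtain ⟨k, hk⟩ := exists_smul_of_det3_eq_zero hca hz
          exact ⟨c - a, k, 1, by rw [← hk]; abel, by simp⟩
      obtain ⟨u, β, γ, hb, hc⟩ := hcol
      have ha : a = a + (0 : ℝ) • u := by simp
      refine ⟨0, fun f hf => ?_⟩
      have e1 := overSign_eq_sectorSign_sub a u v f 0 β (by rw [← hb, ← ha]; exact hab f hf)
      have e2 := overSign_eq_sectorSign_sub a u v f β γ (by rw [← hb, ← hc]; exact hbc f hf)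
      have e3 := overSign_eq_sectorSign_sub a u v f 0 γ (by rw [← hc, ← ha]; exact hac f hf)
      rw [← ha, ← hb] at e1
      rw [← hb, ← hc] at e2
      rw [← ha, ← hc] at e3
      rw [e1, e2, e3]
      simp
  obtain ⟨g, hg⟩ := key
  rw [← sub_eq_zero]
  simp only [overCountHom_single, one_mul]
  rw [← Finset.sum_add_distrib, ← Finset.sum_sub_distrib, ← hW.sum_eq_zero g]
  refine Finset.sum_congr rfl fun f hf => ?_
  rw [← hg f hf]
  ring

/-- Since `overCountHom` is additive on arbitrary chains, the comparison `h` can be assembled from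
pieces that are not cycles. -/
theorem linkingNumber_congr_left {Z Z' W : SegChain} (hZ : IsCycle Z) (hZ' : IsCycle Z')
    (hW : IsCycle W) (hdis : Disjoint (chainCarrier Z) (chainCarrier W))
    (hdis' : Disjoint (chainCarrier Z') (chainCarrier W))
    (h : ∀ᵐ v : E3, overCountHom v W Z = overCountHom v W Z') :
    linkingNumber Z W = linkingNumber Z' W := by
  obtain ⟨v, h1, h2, h3⟩ := exists_of_ae ((ae_linkingNumber_eq hZ hW hdis).and
    ((ae_linkingNumber_eq hZ' hW hdis').and h))
  rw [h1, h2, ← overCountHom_apply, ← overCountHom_apply, h3]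

/-- The boundary of a chain, evaluated against a function on the points. -/
def boundaryHom (g : E3 → ℤ) : SegChain →+ ℤ :=
  Finsupp.liftAddHom fun e => AddMonoidHom.mulRight (g e.2 - g e.1)

theorem boundaryHom_single (g : E3 → ℤ) (e : E3 × E3) (c : ℤ) :
    boundaryHom g (Finsupp.single e c) = c * (g e.2 - g e.1) := by
  simp [boundaryHom]

theorem isCycle_iff {Z : SegChain} : IsCycle Z ↔ ∀ g, boundaryHom g Z = 0 := by
  refine forall_congr' fun g => ?_
  simp [boundaryHom, Finsupp.liftAddHom_apply]

theorem mem_support_sum_single {ι : Type*} {s : Finset ι} {E : ι → E3 × E3} {c : ι → ℤ}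
    {e : E3 × E3} (he : e ∈ (∑ i ∈ s, Finsupp.single (E i) (c i) : SegChain).support) :
    ∃ i ∈ s, c i ≠ 0 ∧ E i = e := by
  classical
  by_contra hc
  push Not at hc
  rw [Finsupp.mem_support_iff, Finsupp.finsetSum_apply] at he
  refine he (Finset.sum_eq_zero fun i hi => ?_)
  rw [Finsupp.single_apply]
  split_ifs with h
  · by_contra h0
    exact hc i hi h0 h
  · rfl

theorem mem_chainCarrier_sum_single {ι : Type*} {s : Finset ι} {E : ι → E3 × E3} {c : ι → ℤ}
    {x : E3} (hx : x ∈ chainCarrier (∑ i ∈ s, Finsupp.single (E i) (c i) : SegChain)) :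
    ∃ i ∈ s, c i ≠ 0 ∧ x ∈ segment ℝ (E i).1 (E i).2 := by
  obtain ⟨e, he, hxe⟩ := mem_iUnion₂.1 hx
  obtain ⟨i, hi, hc, rfl⟩ := mem_support_sum_single he
  exact ⟨i, hi, hc, hxe⟩

theorem overCountHom_single_self (v : E3) (W : SegChain) (x : E3) (c : ℤ) :
    overCountHom v W (Finsupp.single (x, x) c) = 0 := by
  rw [overCountHom_single]
  have : ∀ f, overSign v (x, x) f = 0 := fun f => by
    have : det3 (x - x) (f.2 - f.1) v = 0 := by simp [det3_eq]
    simp only [overSign, this, sign_zero, SignType.coe_zero, ite_self]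
  simp [this]

/-! ## Closed polygons -/

/-- The polygonal path with the vertices `P 0, …, P M`. -/
def polygonChain (P : ℕ → E3) (M : ℕ) : SegChain :=
  ∑ k ∈ Finset.range M, Finsupp.single (P k, P (k + 1)) 1

theorem mem_chainCarrier_polygonChain {P : ℕ → E3} {M : ℕ} {x : E3}
    (hx : x ∈ chainCarrier (polygonChain P M)) : ∃ k < M, x ∈ segment ℝ (P k) (P (k + 1)) := by
  obtain ⟨k, hk, -, h⟩ := mem_chainCarrier_sum_single hx
  exact ⟨k, Finset.mem_range.1 hk, h⟩

theorem isCycle_polygonChain {P : ℕ → E3} {M : ℕ} (h : P M = P 0) :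
    IsCycle (polygonChain P M) := by
  rw [isCycle_iff]
  intro g
  rw [polygonChain, map_sum]
  simp only [boundaryHom_single, one_mul]
  rw [Finset.sum_range_sub (fun k => g (P k)), h, sub_self]

/-- The band between the polygons consists of quadrilaterals, each cut by the diagonal from `P k` to
`P' (k + 1)` into two triangles. The rungs from `P k` to `P' k` telescope around the closed band. -/
theorem ae_overCountHom_polygonChain {W : SegChain} (hW : IsCycle W) {P P' : ℕ → E3} {M : ℕ}
    (hP : P M = P 0) (hP' : P' M = P' 0)
    (h : ∀ k < M, Disjoint (convexHull ℝ {P k, P (k + 1), P' k, P' (k + 1)}) (chainCarrier W)) :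
    ∀ᵐ v : E3, overCountHom v W (polygonChain P M) = overCountHom v W (polygonChain P' M) := by
  have h1 : ∀ᵐ v : E3, ∀ k ∈ Finset.range M,
      overCountHom v W (Finsupp.single (P k, P (k + 1)) 1) +
        overCountHom v W (Finsupp.single (P (k + 1), P' (k + 1)) 1) =
        overCountHom v W (Finsupp.single (P k, P' (k + 1)) 1) :=
    (Finset.eventually_all _).2 fun k hk => ae_overCountHom_triangle hW
      ((h k (Finset.mem_range.1 hk)).mono_left (convexHull_mono (by
        rintro x (rfl | rfl | rfl) <;> simp)))
  have h2 : ∀ᵐ v : E3, ∀ k ∈ Finset.range M,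
      overCountHom v W (Finsupp.single (P k, P' k) 1) +
        overCountHom v W (Finsupp.single (P' k, P' (k + 1)) 1) =
        overCountHom v W (Finsupp.single (P k, P' (k + 1)) 1) :=
    (Finset.eventually_all _).2 fun k hk => ae_overCountHom_triangle hW
      ((h k (Finset.mem_range.1 hk)).mono_left (convexHull_mono (by
        rintro x (rfl | rfl | rfl) <;> simp)))
  filter_upwards [h1, h2] with v a b
  rw [polygonChain, polygonChain, map_sum, map_sum, ← sub_eq_zero, ← Finset.sum_sub_distrib]
  calc _ = ∑ k ∈ Finset.range M, (overCountHom v W (Finsupp.single (P k, P' k) 1) -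
        overCountHom v W (Finsupp.single (P (k + 1), P' (k + 1)) 1)) := by
        refine Finset.sum_congr rfl fun k hk => ?_
        linarith [a k hk, b k hk]
    _ = 0 := by
        rw [Finset.sum_range_sub' (fun k => overCountHom v W (Finsupp.single (P k, P' k) 1)), hP,
          hP', sub_self]

theorem linkingNumber_polygonChain_congr {W : SegChain} (hW : IsCycle W) {P P' : ℕ → E3} {M : ℕ}
    (hP : P M = P 0) (hP' : P' M = P' 0)
    (h : ∀ k < M, Disjoint (convexHull ℝ {P k, P (k + 1), P' k, P' (k + 1)}) (chainCarrier W)) :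
    linkingNumber (polygonChain P M) W = linkingNumber (polygonChain P' M) W := by
  refine linkingNumber_congr_left (isCycle_polygonChain hP) (isCycle_polygonChain hP') hW ?_ ?_
    (ae_overCountHom_polygonChain hW hP hP' h)
  · refine disjoint_left.2 fun x hx hxW => ?_
    obtain ⟨k, hk, hxk⟩ := mem_chainCarrier_polygonChain hx
    exact disjoint_left.1 (h k hk) (segment_subset_convexHull (by simp) (by simp) hxk) hxW
  · refine disjoint_left.2 fun x hx hxW => ?_
    obtain ⟨k, hk, hxk⟩ := mem_chainCarrier_polygonChain hx
    exact disjoint_left.1 (h k hk) (segment_subset_convexHull (by simp) (by simp) hxk) hxW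

namespace PLLink

variable {m : ℕ}

/-! ## The components of a link -/

/-- The underlying set of a component. -/
def compCarrier (L : PLLink m) (i : Fin m) : Set E3 :=
  ⋃ (v : Fin L.n) (_ : L.comp v = i), segment ℝ (L.pos v) (L.pos (L.next v))

theorem mem_compCarrier {L : PLLink m} {i : Fin m} {x : E3} :
    x ∈ L.compCarrier i ↔ ∃ v, L.comp v = i ∧ x ∈ segment ℝ (L.pos v) (L.pos (L.next v)) := by
  simp [compCarrier]

theorem comp_next (L : PLLink m) (v : Fin L.n) : L.comp (L.next v) = L.comp v :=
  ((L.comp_eq_iff _ _).2 (Equiv.Perm.sameCycle_apply_left.2 (Equiv.Perm.SameCycle.refl _ _)))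

theorem comp_zpow (L : PLLink m) (v : Fin L.n) (k : ℤ) : L.comp ((L.next ^ k) v) = L.comp v :=
  ((L.comp_eq_iff _ _).2 (Equiv.Perm.sameCycle_zpow_left.2 (Equiv.Perm.SameCycle.refl _ _)))

theorem chainCarrier_component_subset (L : PLLink m) (i : Fin m) :
    chainCarrier (L.component i) ⊆ L.compCarrier i := by
  intro x hx
  obtain ⟨v, hv, -, h⟩ := mem_chainCarrier_sum_single hx
  exact mem_compCarrier.2 ⟨v, (Finset.mem_filter.1 hv).2, h⟩

theorem exists_lineMap_of_mem_compCarrier {L : PLLink m} {i : Fin m} {x : E3}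
    (hx : x ∈ L.compCarrier i) : ∃ v, L.comp v = i ∧ ∃ s ∈ Ico (0 : ℝ) 1,
      AffineMap.lineMap (L.pos v) (L.pos (L.next v)) s = x := by
  obtain ⟨v, hv, hxv⟩ := mem_compCarrier.1 hx
  rw [segment_eq_image_lineMap] at hxv
  obtain ⟨s, hs, rfl⟩ := hxv
  rcases hs.2.lt_or_eq with h | rfl
  · exact ⟨v, hv, s, ⟨hs.1, h⟩, rfl⟩
  · exact ⟨L.next v, by rw [comp_next, hv], 0, by simp, by simp⟩

theorem disjoint_compCarrier (L : PLLink m) {i j : Fin m} (hij : i ≠ j) :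
    Disjoint (L.compCarrier i) (L.compCarrier j) := by
  refine disjoint_left.2 fun x hi hj => ?_
  obtain ⟨v, hv, s, hs, h1⟩ := exists_lineMap_of_mem_compCarrier hi
  obtain ⟨w, hw, t, ht, h2⟩ := exists_lineMap_of_mem_compCarrier hj
  have := (L.embedded v w s hs t ht (h1.trans h2.symm)).1
  exact hij (by rw [← hv, ← hw, this])

theorem disjoint_chainCarrier_component (L : PLLink m) {i j : Fin m} (hij : i ≠ j) :
    Disjoint (chainCarrier (L.component i)) (chainCarrier (L.component j)) :=
  (L.disjoint_compCarrier hij).mono (L.chainCarrier_component_subset i)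
    (L.chainCarrier_component_subset j)

theorem isCycle_sum_filter_comp (L : PLLink m) (i : Fin m) (p : Fin L.n → E3) :
    IsCycle (∑ v : Fin L.n with L.comp v = i, Finsupp.single (p v, p (L.next v)) 1) := by
  rw [isCycle_iff]
  intro g
  rw [map_sum]
  simp only [boundaryHom_single, one_mul, Finset.sum_sub_distrib]
  rw [sub_eq_zero]
  refine Finset.sum_bij (fun v _ => L.next v) (fun v hv => ?_) (fun v _ w _ h => ?_)
    (fun w hw => ?_) fun v _ => rfl
  · simpa [comp_next] using hv
  · exact L.next.injective h
  · refine ⟨L.next.symm w, ?_, by simp⟩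
    have := L.comp_next (L.next.symm w)
    rw [Equiv.apply_symm_apply] at this
    simpa [← this] using hw

theorem isCycle_component (L : PLLink m) (i : Fin m) : IsCycle (L.component i) :=
  L.isCycle_sum_filter_comp i L.pos

theorem isCompact_compCarrier (L : PLLink m) (i : Fin m) : IsCompact (L.compCarrier i) := by
  refine isCompact_iUnion fun v => isCompact_iUnion fun _ => ?_
  rw [segment_eq_image_lineMap]
  exact isCompact_Icc.image AffineMap.lineMap_continuous

/-- The number of vertices of the component through `v`. -/
def period (L : PLLink m) (v : Fin L.n) : ℕ := Function.minimalPeriod (fun w => L.next • w) v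

theorem zpow_eq_self_iff (L : PLLink m) (v : Fin L.n) (k : ℤ) :
    (L.next ^ k) v = v ↔ (L.period v : ℤ) ∣ k := by
  rw [period, ← MulAction.zpow_smul_eq_iff_minimalPeriod_dvd]
  rfl

theorem zpow_eq_zpow_iff (L : PLLink m) (v : Fin L.n) (k l : ℤ) :
    (L.next ^ k) v = (L.next ^ l) v ↔ (L.period v : ℤ) ∣ k - l := by
  rw [← zpow_eq_self_iff, sub_eq_neg_add, zpow_add, Equiv.Perm.mul_apply, zpow_neg,
    Equiv.Perm.inv_eq_iff_eq]

theorem period_zpow (L : PLLink m) (v : Fin L.n) (k : ℤ) :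
    L.period ((L.next ^ k) v) = L.period v := by
  have : ∀ l : ℤ, (L.period ((L.next ^ k) v) : ℤ) ∣ l ↔ (L.period v : ℤ) ∣ l := by
    intro l
    rw [← zpow_eq_self_iff, ← Equiv.Perm.mul_apply, ← zpow_add, zpow_eq_zpow_iff,
      add_sub_cancel_right]
  exact Nat.dvd_antisymm (Int.natCast_dvd_natCast.1 ((this _).2 dvd_rfl))
    (Int.natCast_dvd_natCast.1 ((this _).1 dvd_rfl))

theorem period_pos (L : PLLink m) (v : Fin L.n) : 0 < L.period v := by
  rw [Nat.pos_iff_ne_zero]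
  intro h
  have h1 := (L.zpow_eq_self_iff v (orderOf L.next)).1 (by
    rw [zpow_natCast, pow_orderOf_eq_one]; rfl)
  rw [h, Nat.cast_zero, zero_dvd_iff] at h1
  exact (orderOf_pos L.next).ne' (by exact_mod_cast h1)

theorem sum_filter_comp (L : PLLink m) {A : Type*} [AddCommMonoid A] (v : Fin L.n)
    (f : Fin L.n → A) : ∑ w : Fin L.n with L.comp w = L.comp v, f w =
      ∑ k ∈ Finset.range (L.period v), f ((L.next ^ (k : ℤ)) v) := by
  symm
  refine Finset.sum_bij (fun k _ => (L.next ^ (k : ℤ)) v) (fun k _ => ?_) (fun k hk l hl h => ?_)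
    (fun w hw => ?_) fun _ _ => rfl
  · simp only [Finset.mem_filter, Finset.mem_univ, true_and]
    exact L.comp_zpow v k
  · rw [zpow_eq_zpow_iff] at h
    rw [Finset.mem_range] at hk hl
    have := Int.eq_zero_of_abs_lt_dvd h (by rw [abs_lt]; omega)
    omega
  · have hw := (L.comp_eq_iff _ _).1 (Finset.mem_filter.1 hw).2.symm
    obtain ⟨k, hk⟩ := hw
    have hp : (0 : ℤ) < L.period v := by exact_mod_cast L.period_pos v
    refine ⟨(k % L.period v).toNat, ?_, ?_⟩
    · rw [Finset.mem_range, Int.toNat_lt (Int.emod_nonneg _ hp.ne')]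
      exact Int.emod_lt_of_pos _ hp
    · rw [Int.toNat_of_nonneg (Int.emod_nonneg _ hp.ne'), ← hk, zpow_eq_zpow_iff]
      rw [← Int.dvd_neg, neg_sub]
      exact Int.dvd_self_sub_emod

theorem component_eq_polygonChain (L : PLLink m) (v : Fin L.n) : L.component (L.comp v) =
    polygonChain (fun k => L.pos ((L.next ^ (k : ℤ)) v)) (L.period v) := by
  rw [component, L.sum_filter_comp v fun w => Finsupp.single (L.pos w, L.pos (L.next w)) 1]
  refine Finset.sum_congr rfl fun k _ => ?_
  beta_reduce
  rw [Nat.cast_add, Nat.cast_one, add_comm, zpow_add, Equiv.Perm.mul_apply, zpow_one]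

/-! ## The parametrization of a component -/

theorem curve_eq_lineMap (L : PLLink m) (v : Fin L.n) (n : ℤ) {x : ℝ}
    (hx : x ∈ Icc (n : ℝ) (n + 1)) : L.curve v x =
      AffineMap.lineMap (L.pos ((L.next ^ n) v)) (L.pos ((L.next ^ (n + 1)) v)) (x - n) := by
  rcases hx.2.lt_or_eq with h | rfl
  · have : ⌊x⌋ = n := Int.floor_eq_iff.2 ⟨hx.1, h⟩
    rw [curve, Int.fract, this]
  · have h1 : ⌊(n : ℝ) + 1⌋ = n + 1 := by simp
    rw [curve, Int.fract, h1]
    simp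

theorem next_zpow (L : PLLink m) (v : Fin L.n) (n : ℤ) :
    L.next ((L.next ^ n) v) = (L.next ^ (n + 1)) v := by
  rw [add_comm, zpow_add, Equiv.Perm.mul_apply, zpow_one]

theorem curve_mem_segment (L : PLLink m) (v : Fin L.n) (n : ℤ) {x : ℝ}
    (hx : x ∈ Icc (n : ℝ) (n + 1)) : L.curve v x ∈
      segment ℝ (L.pos ((L.next ^ n) v)) (L.pos (L.next ((L.next ^ n) v))) := by
  rw [L.curve_eq_lineMap v n hx, next_zpow]
  exact lineMap_mem_segment_of_mem_Icc _ _ ⟨by linarith [hx.1], by linarith [hx.2]⟩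

theorem floor_mem (x : ℝ) : x ∈ Icc (⌊x⌋ : ℝ) (⌊x⌋ + 1) :=
  ⟨Int.floor_le x, (Int.lt_floor_add_one x).le⟩

theorem segment_zpow_subset_compCarrier (L : PLLink m) (v : Fin L.n) (n : ℤ) :
    segment ℝ (L.pos ((L.next ^ n) v)) (L.pos (L.next ((L.next ^ n) v))) ⊆
      L.compCarrier (L.comp v) :=
  fun _ hx => mem_compCarrier.2 ⟨_, L.comp_zpow v n, hx⟩

theorem curve_mem_compCarrier (L : PLLink m) (v : Fin L.n) (x : ℝ) :
    L.curve v x ∈ L.compCarrier (L.comp v) :=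
  L.segment_zpow_subset_compCarrier v _ (L.curve_mem_segment v ⌊x⌋ (floor_mem x))

theorem exists_curve_eq {L : PLLink m} {v : Fin L.n} {x : E3}
    (hx : x ∈ L.compCarrier (L.comp v)) : ∃ t, L.curve v t = x := by
  obtain ⟨w, hw, s, hs, rfl⟩ := exists_lineMap_of_mem_compCarrier hx
  obtain ⟨k, rfl⟩ := (L.comp_eq_iff _ _).1 hw.symm
  refine ⟨k + s, ?_⟩
  rw [L.curve_eq_lineMap v k ⟨by linarith [hs.1], by linarith [hs.2]⟩, next_zpow,
    add_sub_cancel_left]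

theorem curve_add_period (L : PLLink m) (v : Fin L.n) (x : ℝ) :
    L.curve v (x + L.period v) = L.curve v x := by
  have h : ∀ k : ℤ, (L.next ^ (k + L.period v)) v = (L.next ^ k) v := fun k =>
    (L.zpow_eq_zpow_iff _ _ _).2 (by rw [add_sub_cancel_left])
  rw [curve, curve, Int.floor_add_natCast, Int.fract_add_natCast, h, add_right_comm, h]

/-- By embeddedness a point determines its half-open edge and its place there, hence its parameter
up to the period. -/
theorem curve_eq_curve {L : PLLink m} {v : Fin L.n} {x y : ℝ} (h : L.curve v x = L.curve v y) :
    ∃ k : ℤ, x - y = k * L.period v := by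
  rw [curve, curve, ← next_zpow, ← next_zpow] at h
  obtain ⟨h1, h2⟩ := L.embedded _ _ _ ⟨Int.fract_nonneg x, Int.fract_lt_one x⟩ _
    ⟨Int.fract_nonneg y, Int.fract_lt_one y⟩ h
  obtain ⟨k, hk⟩ := (L.zpow_eq_zpow_iff _ _ _).1 h1
  refine ⟨k, ?_⟩
  have hk' : (⌊x⌋ : ℝ) - ⌊y⌋ = L.period v * k := by exact_mod_cast hk
  rw [Int.fract, Int.fract] at h2
  linarith

end PLLink

/-- A convex hull of points of a ball lies in the ball. -/
theorem convexHull_quadruple_subset {S : Set E3} (hS : Convex ℝ S) {a b c d : E3} (ha : a ∈ S)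
    (hb : b ∈ S) (hc : c ∈ S) (hd : d ∈ S) : convexHull ℝ {a, b, c, d} ⊆ S :=
  convexHull_min (by rintro x (rfl | rfl | rfl | rfl) <;> assumption) hS

namespace PLLink

variable {m : ℕ}

/-! ## Subdivisions and inscribed polygons -/

/-- A fine polygon inscribed in a component is homologous to it in the complement of a cycle that
stays away from the component. -/
theorem ae_overCountHom_inscribed (L : PLLink m) (v : Fin L.n) (ψ : ℕ → ℝ) (M : ℕ)
    (hψ : ∀ k < M, ψ k ≤ ψ (k + 1) ∧ ψ (k + 1) < ψ k + 1) (hM : ψ M = ψ 0 + L.period v) {ε : ℝ}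
    (hε : 0 < ε) (hd : ∀ k < M, dist (L.curve v (ψ (k + 1))) (L.curve v (ψ k)) < ε)
    {W : SegChain} (hW : IsCycle W)
    (hdis : Disjoint (Metric.thickening ε (L.compCarrier (L.comp v))) (chainCarrier W)) :
    ∀ᵐ w : E3, overCountHom w W (L.component (L.comp v)) =
      overCountHom w W (polygonChain (fun k => L.curve v (ψ k)) M) := by
  -- The comparison polygon jumps to the initial vertex of the edge reached at `ψ k`. As the
  -- parameter advances by less than one, it stays put or advances by one vertex. So it runs once
  -- around the component, up to constant edges, which count zero.
  set P : ℕ → E3 := fun k => L.pos ((L.next ^ ⌊ψ k⌋) v) with hP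
  have hfl : ∀ k < M, ⌊ψ (k + 1)⌋ = ⌊ψ k⌋ ∨ ⌊ψ (k + 1)⌋ = ⌊ψ k⌋ + 1 := by
    intro k hk
    have h1 := Int.floor_mono (hψ k hk).1
    have h2 := Int.floor_mono (hψ k hk).2.le
    rw [Int.floor_add_one] at h2
    omega
  have hcl : P M = P 0 := by
    simp only [hP]
    rw [hM, Int.floor_add_natCast, (L.zpow_eq_zpow_iff _ _ _).2 (by rw [add_sub_cancel_left])]
  have hcl' : L.curve v (ψ M) = L.curve v (ψ 0) := by rw [hM, curve_add_period]
  have hsub := ae_overCountHom_polygonChain hW (P := P) (P' := fun k => L.curve v (ψ k)) hcl hcl'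
    (fun k hk => by
      refine hdis.mono_left ?_
      set S := segment ℝ (L.pos ((L.next ^ ⌊ψ k⌋) v)) (L.pos (L.next ((L.next ^ ⌊ψ k⌋) v)))
      have hS : S ⊆ L.compCarrier (L.comp v) := L.segment_zpow_subset_compCarrier v _
      refine Subset.trans ?_ (Metric.thickening_subset_of_subset ε hS)
      have hself : S ⊆ Metric.thickening ε S := Metric.self_subset_thickening hε S
      have hc : L.curve v (ψ k) ∈ S := L.curve_mem_segment v ⌊ψ k⌋ (floor_mem _)
      -- The quadrilateral lies in the thickening of a single edge, which is convex.
      refine convexHull_quadruple_subset ((convex_segment _ _).thickening ε)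
        (hself (left_mem_segment ℝ _ _)) (hself ?_) (hself hc) ?_
      · simp only [hP]
        rcases hfl k hk with h | h
        · rw [h]
          exact left_mem_segment ℝ _ _
        · rw [h, ← next_zpow]
          exact right_mem_segment ℝ _ _
      · exact Metric.mem_thickening_iff.2 ⟨_, hc, hd k hk⟩)
  filter_upwards [hsub] with w hw
  rw [← hw]
  set F : ℤ → ℤ := fun n => overCountHom w W (Finsupp.single
    (L.pos ((L.next ^ n) v), L.pos ((L.next ^ (n + 1)) v)) 1) with hF
  have hsum : ∀ k ≤ M, ∃ j : ℕ, ⌊ψ k⌋ = ⌊ψ 0⌋ + j ∧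
      overCountHom w W (polygonChain P k) = ∑ l ∈ Finset.range j, F (⌊ψ 0⌋ + l) := by
    intro k
    induction k with
    | zero => exact fun _ => ⟨0, by simp, by simp [polygonChain]⟩
    | succ k ih =>
      intro hk
      obtain ⟨j, h1, h2⟩ := ih (by omega)
      rw [polygonChain, Finset.sum_range_succ, map_add, ← polygonChain, h2]
      rcases hfl k (by omega) with h | h
      · refine ⟨j, by rw [h, h1], ?_⟩
        simp only [hP, h, overCountHom_single_self, add_zero]
      · refine ⟨j + 1, by rw [h, h1]; push_cast; ring, ?_⟩
        rw [Finset.sum_range_succ]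
        simp only [hP, hF, h, h1]
  obtain ⟨j, h1, h2⟩ := hsum M le_rfl
  have hj : j = L.period v := by
    rw [hM, Int.floor_add_natCast] at h1
    exact_mod_cast (add_left_cancel h1).symm
  rw [h2, hj, ← L.comp_zpow v ⌊ψ 0⌋, component_eq_polygonChain, period_zpow, polygonChain, map_sum]
  refine Finset.sum_congr rfl fun k _ => ?_
  simp only [hF, ← Equiv.Perm.mul_apply, ← zpow_add]
  congr 6 <;> push_cast <;> ring

theorem chainCarrier_inscribed_subset (L : PLLink m) (v : Fin L.n) (ψ : ℕ → ℝ) (M : ℕ) {ε : ℝ}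
    (hε : 0 < ε) (hd : ∀ k < M, dist (L.curve v (ψ (k + 1))) (L.curve v (ψ k)) < ε) :
    chainCarrier (polygonChain (fun k => L.curve v (ψ k)) M) ⊆
      Metric.thickening ε (L.compCarrier (L.comp v)) := by
  intro x hx
  obtain ⟨k, hk, hxk⟩ := mem_chainCarrier_polygonChain hx
  refine Metric.mem_thickening_iff.2 ⟨_, L.curve_mem_compCarrier v (ψ k), ?_⟩
  exact (convex_ball (L.curve v (ψ k)) ε).segment_subset (Metric.mem_ball_self hε) (hd k hk) hxk

/-- The two components are replaced one after the other. The bound `2 * ε` keeps their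
`ε`-neighbourhoods disjoint, in which everything takes place. -/
theorem lk_eq_inscribed (L : PLLink m) {v w : Fin L.n} {ψ χ : ℕ → ℝ}
    {M N : ℕ} (hψ : ∀ k < M, ψ k ≤ ψ (k + 1) ∧ ψ (k + 1) < ψ k + 1)
    (hM : ψ M = ψ 0 + L.period v) (hχ : ∀ k < N, χ k ≤ χ (k + 1) ∧ χ (k + 1) < χ k + 1)
    (hN : χ N = χ 0 + L.period w) {ε : ℝ} (hε : 0 < ε)
    (hdψ : ∀ k < M, dist (L.curve v (ψ (k + 1))) (L.curve v (ψ k)) < ε)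
    (hdχ : ∀ k < N, dist (L.curve w (χ (k + 1))) (L.curve w (χ k)) < ε)
    (hsep : ∀ x ∈ L.compCarrier (L.comp v), ∀ y ∈ L.compCarrier (L.comp w), 2 * ε ≤ dist x y) :
    L.lk (L.comp v) (L.comp w) = linkingNumber (polygonChain (fun k => L.curve v (ψ k)) M)
      (polygonChain (fun k => L.curve w (χ k)) N) := by
  have hcψ : IsCycle (polygonChain (fun k => L.curve v (ψ k)) M) :=
    isCycle_polygonChain (by rw [hM, curve_add_period])
  have hcχ : IsCycle (polygonChain (fun k => L.curve w (χ k)) N) :=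
    isCycle_polygonChain (by rw [hN, curve_add_period])
  have hdis : Disjoint (Metric.thickening ε (L.compCarrier (L.comp v)))
      (Metric.thickening ε (L.compCarrier (L.comp w))) := by
    refine disjoint_left.2 fun z h1 h2 => ?_
    obtain ⟨x, hx, hzx⟩ := Metric.mem_thickening_iff.1 h1
    obtain ⟨y, hy, hzy⟩ := Metric.mem_thickening_iff.1 h2
    have := hsep x hx y hy
    have := dist_triangle_left x y z
    linarith
  have hψs := L.chainCarrier_inscribed_subset v ψ M hε hdψ
  have hχs := L.chainCarrier_inscribed_subset w χ N hε hdχ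
  have hv := (L.chainCarrier_component_subset (L.comp v)).trans
    (Metric.self_subset_thickening hε _)
  have hw := (L.chainCarrier_component_subset (L.comp w)).trans
    (Metric.self_subset_thickening hε _)
  rw [lk, linkingNumber_congr_left (L.isCycle_component _) hcψ (L.isCycle_component _)
      (hdis.mono hv hw) (hdis.mono hψs hw)
      (L.ae_overCountHom_inscribed v ψ M hψ hM hε hdψ (L.isCycle_component _)
        (hdis.mono_right hw)),
    linkingNumber_comm hcψ (L.isCycle_component _) (hdis.mono hψs hw),
    linkingNumber_congr_left (L.isCycle_component _) hcχ hcψ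
      (hdis.mono hψs hw).symm (hdis.mono hψs hχs).symm
      (L.ae_overCountHom_inscribed w χ N hχ hN hε hdχ hcψ (hdis.mono_left hψs).symm),
    linkingNumber_comm hcχ hcψ (hdis.mono hψs hχs).symm]

/-- Neighbouring points of a fine subdivision of the parameter line. -/
theorem exists_dist_curve_lt (L : PLLink m) (v : Fin L.n) {δ : ℝ} (hδ : 0 < δ) :
    ∀ᶠ N : ℕ in atTop, ∀ k : ℕ,
      dist (L.curve v ((k + 1 : ℕ) / N)) (L.curve v (k / N)) < δ := by
  obtain ⟨C, hC⟩ := (Set.finite_range fun w => dist (L.pos w) (L.pos (L.next w))).bddAbove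
  have hC' : ∀ w, dist (L.pos w) (L.pos (L.next w)) ≤ C := fun w => hC ⟨w, rfl⟩
  obtain ⟨N₀, hN₀⟩ := exists_nat_gt (C / δ)
  filter_upwards [eventually_ge_atTop (N₀ + 1)] with N hN k
  have hNpos : (0 : ℝ) < N := by exact_mod_cast (by omega : 0 < N)
  have hdiv : ((k / N : ℕ) : ℝ) * N + (k % N : ℕ) = k := by
    exact_mod_cast Nat.div_add_mod' k N
  have hmod : ((k % N : ℕ) : ℝ) + 1 ≤ N := by
    exact_mod_cast Nat.mod_lt k (by omega)
  have hm0 : (0 : ℝ) ≤ (k % N : ℕ) := by positivity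
  have e1 : (k : ℝ) / N = (k / N : ℕ) + (k % N : ℕ) / N := by
    field_simp
    linarith
  have e2 : ((k + 1 : ℕ) : ℝ) / N = (k / N : ℕ) + ((k % N : ℕ) + 1) / N := by
    field_simp
    push_cast
    linarith
  have b1 : ((k % N : ℕ) : ℝ) / N ≤ 1 := by rw [div_le_one hNpos]; linarith
  have b2 : (((k % N : ℕ) : ℝ) + 1) / N ≤ 1 := by rw [div_le_one hNpos]; linarith
  have b3 : 0 ≤ ((k % N : ℕ) : ℝ) / N := by positivity
  have b4 : 0 ≤ (((k % N : ℕ) : ℝ) + 1) / N := by positivity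
  -- Vertices have integral parameters, so `k / N` and `(k + 1) / N` belong to one edge, and the
  -- points differ by `1 / N` of its length.
  rw [L.curve_eq_lineMap v ((k / N : ℕ) : ℤ) (x := ((k + 1 : ℕ) : ℝ) / N) (by
      rw [e2, Int.cast_natCast]; constructor <;> linarith),
    L.curve_eq_lineMap v ((k / N : ℕ) : ℤ) (x := (k : ℝ) / N) (by
      rw [e1, Int.cast_natCast]; constructor <;> linarith), dist_lineMap_lineMap, ← next_zpow]
  have e3 : dist (((k + 1 : ℕ) : ℝ) / N - (((k / N : ℕ) : ℤ) : ℝ))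
      ((k : ℝ) / N - (((k / N : ℕ) : ℤ) : ℝ)) = 1 / N := by
    rw [dist_sub_right, Real.dist_eq, ← sub_div]
    push_cast
    rw [add_sub_cancel_left, abs_of_pos (by positivity)]
  rw [e3]
  have h1 := hC' ((L.next ^ ((k / N : ℕ) : ℤ)) v)
  have h2 : C < δ * N := by
    rw [div_lt_iff₀ hδ] at hN₀
    have : (N₀ : ℝ) ≤ N := by exact_mod_cast (by omega : N₀ ≤ N)
    nlinarith
  rw [one_div, inv_mul_lt_iff₀ hNpos]
  linarith

/-- The lift of an orientation preserving identification of two components has degree one. -/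
theorem map_period {L L' : PLLink m} {v : Fin L.n} {v' : Fin L'.n} {h : E3 ≃ₜ E3} {φ : ℝ ≃o ℝ}
    (hφ : ∀ x, h (L.curve v x) = L'.curve v' (φ x)) : φ (L.period v) = φ 0 + L'.period v' := by
  have hp : (0 : ℝ) < L.period v := by exact_mod_cast L.period_pos v
  have hp' : (0 : ℝ) < L'.period v' := by exact_mod_cast L'.period_pos v'
  obtain ⟨k, hk⟩ : ∃ k : ℤ, φ (L.period v) - φ 0 = k * L'.period v' := by
    apply curve_eq_curve (L := L')
    rw [← hφ, ← hφ, ← L.curve_add_period v 0, zero_add]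
  obtain ⟨l, hl⟩ : ∃ l : ℤ, φ.symm (φ 0 + L'.period v') - 0 = l * L.period v := by
    apply curve_eq_curve (L := L)
    apply h.injective
    rw [hφ, hφ, φ.apply_symm_apply, curve_add_period]
  -- Monotonicity makes the degrees `k` of the lift and `l` of its inverse positive. Then `k ≥ 1`
  -- bounds the image of the period from below and `l ≥ 1` bounds it from above.
  have hk1 : 1 ≤ k := by
    have h1 : φ 0 < φ (L.period v) := φ.lt_iff_lt.2 hp
    have : (0 : ℝ) < k := pos_of_mul_pos_left (by linarith) hp'.le
    exact_mod_cast this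
  have hl1 : 1 ≤ l := by
    have h1 : φ.symm (φ 0) < φ.symm (φ 0 + L'.period v') := φ.symm.lt_iff_lt.2 (by linarith)
    rw [φ.symm_apply_apply] at h1
    have : (0 : ℝ) < l := pos_of_mul_pos_left (by linarith) hp.le
    exact_mod_cast this
  have h2 : (L.period v : ℝ) ≤ φ.symm (φ 0 + L'.period v') := by
    have : (1 : ℝ) ≤ l := by exact_mod_cast hl1
    nlinarith
  have h3 : φ (L.period v) ≤ φ 0 + L'.period v' := by
    have := φ.monotone h2
    rwa [φ.apply_symm_apply] at this
  have h4 : (1 : ℝ) ≤ k := by exact_mod_cast hk1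
  nlinarith

end PLLink

/-- Fine polygons that are moved by little keep their linking number. -/
theorem linkingNumber_polygonChain_near {P P' Q Q' : ℕ → E3} {M N : ℕ} (hP : P M = P 0)
    (hP' : P' M = P' 0) (hQ : Q N = Q 0) (hQ' : Q' N = Q' 0) {ε : ℝ} (hε : 0 < ε)
    (hdP : ∀ k < M, dist (P (k + 1)) (P k) < ε) (hdP' : ∀ k < M, dist (P' (k + 1)) (P' k) < ε)
    (hdQ : ∀ k < N, dist (Q (k + 1)) (Q k) < ε) (hdQ' : ∀ k < N, dist (Q' (k + 1)) (Q' k) < ε)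
    (hPP : ∀ k ≤ M, dist (P' k) (P k) < ε) (hQQ : ∀ k ≤ N, dist (Q' k) (Q k) < ε)
    (hsep : ∀ k < M, ∀ l < N, 8 * ε ≤ dist (P k) (Q l)) :
    linkingNumber (polygonChain P M) (polygonChain Q N) =
      linkingNumber (polygonChain P' M) (polygonChain Q' N) := by
  -- All quadrilaterals and polygons stay within `2 * ε` of the vertices of `P` or of `Q`, so the
  -- separation `8 * ε` leaves room to spare.
  have hsub : ∀ {R R' : ℕ → E3} {K : ℕ}, (∀ k < K, dist (R (k + 1)) (R k) < ε) →
      (∀ k ≤ K, dist (R' k) (R k) < ε) → ∀ k < K,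
      convexHull ℝ {R k, R (k + 1), R' k, R' (k + 1)} ⊆ Metric.ball (R k) (2 * ε) := by
    intro R R' K h1 h2 k hk
    refine convexHull_quadruple_subset (convex_ball _ _) (Metric.mem_ball_self (by linarith)) ?_
      ?_ ?_ <;> rw [Metric.mem_ball]
    · linarith [h1 k hk]
    · linarith [h2 k hk.le]
    · linarith [h1 k hk, h2 (k + 1) hk, dist_triangle (R' (k + 1)) (R (k + 1)) (R k)]
  have hcar : ∀ {R R' : ℕ → E3} {K : ℕ}, (∀ k < K, dist (R' (k + 1)) (R' k) < ε) →
      (∀ k ≤ K, dist (R' k) (R k) < ε) → ∀ x ∈ chainCarrier (polygonChain R' K),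
      ∃ k < K, dist x (R k) < 2 * ε := by
    intro R R' K h1 h2 x hx
    obtain ⟨k, hk, hxk⟩ := mem_chainCarrier_polygonChain hx
    have h3 : dist x (R' k) < ε :=
      (convex_ball (R' k) ε).segment_subset (Metric.mem_ball_self hε) (h1 k hk) hxk
    exact ⟨k, hk, by linarith [h2 k hk.le, dist_triangle x (R' k) (R k)]⟩
  have hself : ∀ {R : ℕ → E3} {K : ℕ}, ∀ k ≤ K, dist (R k) (R k) < ε := fun k _ => by simpa
  have hdis : ∀ {x : E3} {k l : ℕ}, k < M → l < N → dist x (P k) < 2 * ε → dist x (Q l) < 2 * ε →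
      False := by
    intro x k l hk hl h1 h2
    linarith [hsep k hk l hl, dist_triangle_left (P k) (Q l) x]
  have e1 : linkingNumber (polygonChain P M) (polygonChain Q N) =
      linkingNumber (polygonChain P' M) (polygonChain Q N) := by
    refine linkingNumber_polygonChain_congr (isCycle_polygonChain hQ) hP hP' fun k hk => ?_
    refine disjoint_left.2 fun x hx hxQ => ?_
    obtain ⟨l, hl, h⟩ := hcar hdQ hself x hxQ
    exact hdis hk hl (hsub hdP hPP k hk hx) h
  have e2 : linkingNumber (polygonChain Q N) (polygonChain P' M) =
      linkingNumber (polygonChain Q' N) (polygonChain P' M) := by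
    refine linkingNumber_polygonChain_congr (isCycle_polygonChain hP') hQ hQ' fun l hl => ?_
    refine disjoint_left.2 fun x hx hxP => ?_
    obtain ⟨k, hk, h⟩ := hcar hdP' hPP x hxP
    exact hdis hk hl h (hsub hdQ hQQ l hl hx)
  have d1 : ∀ {R : ℕ → E3}, (∀ k < N, dist (R (k + 1)) (R k) < ε) → (∀ k ≤ N, dist (R k) (Q k) < ε) →
      Disjoint (chainCarrier (polygonChain P' M)) (chainCarrier (polygonChain R N)) := by
    intro R hR1 hR2
    refine disjoint_left.2 fun x hx hxQ => ?_
    obtain ⟨k, hk, h⟩ := hcar hdP' hPP x hx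
    obtain ⟨l, hl, h'⟩ := hcar hR1 hR2 x hxQ
    exact hdis hk hl h h'
  rw [e1, linkingNumber_comm (isCycle_polygonChain hP') (isCycle_polygonChain hQ) (d1 hdQ hself),
    e2, linkingNumber_comm (isCycle_polygonChain hQ') (isCycle_polygonChain hP')
      (d1 hdQ' hQQ).symm]

/-! ### Invariance under ambient isotopy -/

namespace PLLink

variable {m : ℕ}

/-- The linking numbers of the components are invariant under ambient isotopy. -/
theorem AmbientIsotopic.lk_eq {L L' : PLLink m} (h : L.AmbientIsotopic L') {i j : Fin m}
    (hij : i ≠ j) : L.lk i j = L'.lk i j := by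
  obtain ⟨H, hcont, hH0, hH1⟩ := h
  obtain ⟨v, v', rfl, hv', φ, hφ⟩ := hH1 i
  obtain ⟨w, w', rfl, hw', χ, hχ⟩ := hH1 j
  set K := L.compCarrier (L.comp v) with hKdef
  set J := L.compCarrier (L.comp w) with hJdef
  have hK : IsCompact K := L.isCompact_compCarrier _
  have hJ : IsCompact J := L.isCompact_compCarrier _
  have hH : ∀ {f : unitInterval × E3 × E3 → unitInterval} {g : unitInterval × E3 × E3 → E3},
      Continuous f → Continuous g → Continuous fun q => H (f q) (g q) := fun hf hg =>
    hcont.comp (hf.prodMk hg)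
  -- uniform separation
  obtain ⟨ε, hε, hsep⟩ : ∃ ε > 0, ∀ t, ∀ x ∈ K, ∀ y ∈ J, 8 * ε ≤ dist (H t x) (H t y) := by
    have hcpt : IsCompact ((univ : Set unitInterval) ×ˢ (K ×ˢ J)) :=
      isCompact_univ.prod (hK.prod hJ)
    have hne : ((univ : Set unitInterval) ×ˢ (K ×ˢ J)).Nonempty :=
      ⟨(0, L.curve v 0, L.curve w 0), mem_univ _, L.curve_mem_compCarrier v 0,
        L.curve_mem_compCarrier w 0⟩
    obtain ⟨q, hq, hmin⟩ := hcpt.exists_isMinOn hne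
      (f := fun q : unitInterval × E3 × E3 => dist (H q.1 q.2.1) (H q.1 q.2.2))
      ((hH continuous_fst (continuous_fst.comp continuous_snd)).dist
        (hH continuous_fst (continuous_snd.comp continuous_snd))).continuousOn
    have hpos : 0 < dist (H q.1 q.2.1) (H q.1 q.2.2) := by
      rw [dist_pos]
      intro he
      have := (H q.1).injective he
      exact disjoint_left.1 (L.disjoint_compCarrier hij) hq.2.1 (this ▸ hq.2.2)
    refine ⟨dist (H q.1 q.2.1) (H q.1 q.2.2) / 8, by positivity, fun t x hx y hy => ?_⟩
    have : dist (H q.1 q.2.1) (H q.1 q.2.2) ≤ dist (H t x) (H t y) :=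
      hmin (show (t, x, y) ∈ (univ : Set unitInterval) ×ˢ (K ×ˢ J) from ⟨mem_univ _, hx, hy⟩)
    linarith
  -- uniform continuity
  obtain ⟨δ, hδ, hunif⟩ : ∃ δ > 0, ∀ t, ∀ x ∈ K ∪ J, ∀ y ∈ K ∪ J, dist x y < δ →
      dist (H t x) (H t y) < ε := by
    have hcpt : IsCompact ((univ : Set unitInterval) ×ˢ (K ∪ J)) :=
      isCompact_univ.prod (hK.union hJ)
    obtain ⟨δ, hδ, hu⟩ := Metric.uniformContinuousOn_iff.1
      (hcpt.uniformContinuousOn_of_continuous hcont.continuousOn) ε hε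
    refine ⟨δ, hδ, fun t x hx y hy hxy => ?_⟩
    refine hu (t, x) ⟨mem_univ _, hx⟩ (t, y) ⟨mem_univ _, hy⟩ ?_
    rw [Prod.dist_eq, dist_self]
    exact max_lt hδ hxy
  -- At time one the polygon has the parameters `φ (k / N)` in the second link. Steps smaller than
  -- one ensure that it does not skip an edge there.
  have hstep : ∀ (ξ : ℝ ≃o ℝ) (p : ℕ), ∀ᶠ N : ℕ in atTop, ∀ k < p * N,
      ξ ((k + 1 : ℕ) / N) < ξ (k / N) + 1 := by
    intro ξ p
    obtain ⟨η, hη, hu⟩ := Metric.uniformContinuousOn_iff.1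
      (isCompact_Icc (a := (0 : ℝ)) (b := p) |>.uniformContinuousOn_of_continuous
        ξ.continuous.continuousOn) 1 one_pos
    obtain ⟨N₀, hN₀⟩ := exists_nat_gt (1 / η)
    filter_upwards [eventually_ge_atTop (N₀ + 1)] with N hN k hk
    have hNpos : (0 : ℝ) < N := by exact_mod_cast (by omega : 0 < N)
    have hk' : ((k + 1 : ℕ) : ℝ) ≤ p * N := by exact_mod_cast hk
    have h1 : ((k + 1 : ℕ) : ℝ) / N ≤ p := by rwa [div_le_iff₀ hNpos]
    have h2 : (k : ℝ) / N ≤ ((k + 1 : ℕ) : ℝ) / N := by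
      gcongr
      linarith
    have := hu _ ⟨by positivity, h1⟩ ((k : ℝ) / N) ⟨by positivity, h2.trans h1⟩ (by
      rw [Real.dist_eq, ← sub_div]
      push_cast
      rw [add_sub_cancel_left, abs_of_pos (by positivity), div_lt_iff₀ hNpos]
      rw [div_lt_iff₀ hη] at hN₀
      have : (N₀ : ℝ) ≤ N := by exact_mod_cast (by omega : N₀ ≤ N)
      nlinarith)
    rw [Real.dist_eq] at this
    linarith [(abs_lt.1 this).2]
  obtain ⟨N, hNv, hNw, hNφ, hNχ, hN2⟩ := ((L.exists_dist_curve_lt v (lt_min hδ hε)).and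
    ((L.exists_dist_curve_lt w (lt_min hδ hε)).and ((hstep φ (L.period v)).and
      ((hstep χ (L.period w)).and (eventually_gt_atTop 1))))).exists
  have hN0 : (0 : ℝ) < N := by exact_mod_cast (by omega : 0 < N)
  -- Only the finitely many vertices follow the isotopy; the edges between them are straight at all
  -- times. The polygons are inscribed in the components of `L` at time zero and of `L'` at time
  -- one.
  set P : unitInterval → ℕ → E3 := fun t k => H t (L.curve v (k / N)) with hP
  set Q : unitInterval → ℕ → E3 := fun t k => H t (L.curve w (k / N)) with hQ
  have hmv : ∀ x, L.curve v x ∈ K := L.curve_mem_compCarrier v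
  have hmw : ∀ x, L.curve w x ∈ J := L.curve_mem_compCarrier w
  have hPcl : ∀ t, P t (L.period v * N) = P t 0 := fun t => by
    simp only [hP]
    push_cast
    rw [mul_div_cancel_right₀ _ hN0.ne', zero_div, ← zero_add (L.period v : ℝ),
      L.curve_add_period]
  have hQcl : ∀ t, Q t (L.period w * N) = Q t 0 := fun t => by
    simp only [hQ]
    push_cast
    rw [mul_div_cancel_right₀ _ hN0.ne', zero_div, ← zero_add (L.period w : ℝ),
      L.curve_add_period]
  have hPd : ∀ t k, dist (P t (k + 1)) (P t k) < ε := fun t k =>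
    hunif t _ (Or.inl (hmv _)) _ (Or.inl (hmv _)) ((hNv k).trans_le (min_le_left _ _))
  have hQd : ∀ t k, dist (Q t (k + 1)) (Q t k) < ε := fun t k =>
    hunif t _ (Or.inr (hmw _)) _ (Or.inr (hmw _)) ((hNw k).trans_le (min_le_left _ _))
  -- For times close to `t` all vertices have moved by less than `ε`, while `ε` itself does not
  -- depend on `t`.
  have hloc : IsLocallyConstant fun t => linkingNumber (polygonChain (P t) (L.period v * N))
      (polygonChain (Q t) (L.period w * N)) := by
    rw [IsLocallyConstant.iff_eventually_eq]
    intro t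
    have hc : ∀ x, ∀ᶠ s in nhds t, dist (H s x) (H t x) < ε := fun x => by
      have : Continuous fun s => H s x := hcont.comp (continuous_id.prodMk continuous_const)
      exact (Metric.tendsto_nhds.1 (this.tendsto t)) ε hε
    have h1 : ∀ᶠ s in nhds t, ∀ k ∈ Finset.range (L.period v * N + 1), dist (P s k) (P t k) < ε :=
      (Finset.eventually_all _).2 fun k _ => hc _
    have h2 : ∀ᶠ s in nhds t, ∀ k ∈ Finset.range (L.period w * N + 1), dist (Q s k) (Q t k) < ε :=
      (Finset.eventually_all _).2 fun k _ => hc _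
    filter_upwards [h1, h2] with s a b
    symm
    exact linkingNumber_polygonChain_near (hPcl t) (hPcl s) (hQcl t) (hQcl s) hε
      (fun k _ => hPd t k) (fun k _ => hPd s k) (fun k _ => hQd t k) (fun k _ => hQd s k)
      (fun k hk => a k (Finset.mem_range.2 (by omega)))
      (fun k hk => b k (Finset.mem_range.2 (by omega)))
      fun k _ l _ => hsep t _ (hmv _) _ (hmw _)
  have h01 := hloc.apply_eq_of_isPreconnected isPreconnected_univ (mem_univ 0) (mem_univ 1)
  have hmono : ∀ k : ℕ, (k : ℝ) / N ≤ ((k + 1 : ℕ) : ℝ) / N := fun k => by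
    gcongr
    linarith
  have hlt : ∀ k : ℕ, ((k + 1 : ℕ) : ℝ) / N < (k : ℝ) / N + 1 := fun k => by
    rw [div_add_one hN0.ne', div_lt_div_iff_of_pos_right hN0]
    push_cast
    have : (1 : ℝ) < N := by exact_mod_cast hN2
    linarith
  have hend : ∀ p : ℕ, ((p * N : ℕ) : ℝ) / N = p := fun p => by
    push_cast
    rw [mul_div_cancel_right₀ _ hN0.ne']
  have hstart : L.lk (L.comp v) (L.comp w) = linkingNumber (polygonChain (P 0) (L.period v * N))
      (polygonChain (Q 0) (L.period w * N)) := by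
    simp only [hP, hQ, hH0, Homeomorph.refl_apply]
    refine L.lk_eq_inscribed (ψ := fun k => k / N) (χ := fun k => k / N)
      (fun k _ => ⟨hmono k, hlt k⟩) ?_ (fun k _ => ⟨hmono k, hlt k⟩) ?_ hε
      (fun k _ => (hNv k).trans_le (min_le_right _ _))
      (fun k _ => (hNw k).trans_le (min_le_right _ _)) fun x hx y hy => ?_
    · simp only [hend]; simp
    · simp only [hend]; simp
    · have := hsep 0 x hx y hy
      rw [hH0] at this
      simp only [Homeomorph.refl_apply, id_eq] at this
      linarith
  have hfin : L'.lk (L'.comp v') (L'.comp w') =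
      linkingNumber (polygonChain (P 1) (L.period v * N))
        (polygonChain (Q 1) (L.period w * N)) := by
    have hP1 : P 1 = fun k : ℕ => L'.curve v' (φ (k / N)) := funext fun k => hφ _
    have hQ1 : Q 1 = fun k : ℕ => L'.curve w' (χ (k / N)) := funext fun k => hχ _
    have hPd1 := hPd 1
    have hQd1 := hQd 1
    rw [hP1] at hPd1 ⊢
    rw [hQ1] at hQd1 ⊢
    refine L'.lk_eq_inscribed (ψ := fun k : ℕ => φ (k / N)) (χ := fun k : ℕ => χ (k / N))
      (fun k hk => ⟨φ.monotone (hmono k), hNφ k hk⟩) ?_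
      (fun k hk => ⟨χ.monotone (hmono k), hNχ k hk⟩) ?_ hε
      (fun k _ => hPd1 k) (fun k _ => hQd1 k) fun x hx y hy => ?_
    · simp only [hend, map_period hφ]; simp
    · simp only [hend, map_period hχ]; simp
    · obtain ⟨s, rfl⟩ := exists_curve_eq hx
      obtain ⟨r, rfl⟩ := exists_curve_eq hy
      rw [← φ.apply_symm_apply s, ← χ.apply_symm_apply r, ← hφ, ← hχ]
      have := hsep 1 _ (hmv (φ.symm s)) _ (hmw (χ.symm r))
      linarith
  rw [hstart, h01, ← hfin, hv', hw']

end PLLink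

/-! ## Integral points -/

/-- Points with integral coordinates. -/
abbrev Z3 : Type := ℤ × ℤ × ℤ

/-- An integral point as a point of Euclidean space. -/
def toE3 (p : Z3) : E3 := ![p.1, p.2.1, p.2.2]

/-- The determinant of three integral vectors. -/
def intDet (u v w : Z3) : ℤ :=
  u.1 * v.2.1 * w.2.2 - u.1 * v.2.2 * w.2.1 - u.2.1 * v.1 * w.2.2 + u.2.1 * v.2.2 * w.1 +
    u.2.2 * v.1 * w.2.1 - u.2.2 * v.2.1 * w.1

/-- The scalar product of two integral vectors. -/
def intDot (l p : Z3) : ℤ := l.1 * p.1 + l.2.1 * p.2.1 + l.2.2 * p.2.2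

@[simp] theorem toE3_apply_zero (p : Z3) : toE3 p 0 = p.1 := rfl
@[simp] theorem toE3_apply_one (p : Z3) : toE3 p 1 = p.2.1 := rfl
@[simp] theorem toE3_apply_two (p : Z3) : toE3 p 2 = p.2.2 := rfl

theorem toE3_sub (p q : Z3) : toE3 (p - q) = toE3 p - toE3 q := by
  ext i
  fin_cases i <;> simp [toE3]

theorem toE3_add (p q : Z3) : toE3 (p + q) = toE3 p + toE3 q := by
  ext i
  fin_cases i <;> simp [toE3]

theorem toE3_injective : Function.Injective toE3 := by
  intro p q h
  have h0 := congrFun h 0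
  have h1 := congrFun h 1
  have h2 := congrFun h 2
  simp only [toE3_apply_zero, toE3_apply_one, toE3_apply_two, Int.cast_inj] at h0 h1 h2
  exact Prod.ext h0 (Prod.ext h1 h2)

theorem det3_toE3 (u v w : Z3) : det3 (toE3 u) (toE3 v) (toE3 w) = intDet u v w := by
  simp only [det3_eq, toE3_apply_zero, toE3_apply_one, toE3_apply_two, intDet]
  push_cast
  ring

/-- The segment between two integral points. -/
def toSeg (e : Z3 × Z3) : E3 × E3 := (toE3 e.1, toE3 e.2)

/-- `overSign` for integral data. -/
def crossSign (v : Z3) (e f : Z3 × Z3) : ℤ :=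
  let D := intDet (e.2 - e.1) (f.2 - f.1) v
  -- By Cramer's rule the parameters of the crossing are quotients with denominator `D`. Multiplied
  -- by `D * D`, the conditions that they lie between `0` and `1` and that `e` is above `f` become
  -- integral.
  let s := D * intDet (f.1 - e.1) (f.2 - f.1) v
  let t := D * intDet (f.1 - e.1) (e.2 - e.1) v
  if 0 < s ∧ s < D * D ∧ 0 < t ∧ t < D * D ∧ D * intDet (e.2 - e.1) (f.2 - f.1) (f.1 - e.1) < 0
  then D.sign else 0

/-- A sufficient condition for integral segments to be disjoint and in general position with
respect to a direction. -/
def GeneralPosition (v : Z3) (e f : Z3 × Z3) : Prop :=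
  let D := intDet (e.2 - e.1) (f.2 - f.1) v
  let s := D * intDet (f.1 - e.1) (f.2 - f.1) v
  let t := D * intDet (f.1 - e.1) (e.2 - e.1) v
  -- No end of one segment lies in the plane through the other one parallel to `v`. The last clause
  -- excludes a common point: the shadows cross outside of a segment or at different heights. If `D
  -- = 0`, the first condition already makes the parallel shadows lie on different lines.
  intDet (f.2 - f.1) v (e.1 - f.1) ≠ 0 ∧ intDet (f.2 - f.1) v (e.2 - f.1) ≠ 0 ∧
    intDet (e.2 - e.1) v (f.1 - e.1) ≠ 0 ∧ intDet (e.2 - e.1) v (f.2 - e.1) ≠ 0 ∧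
    (D = 0 ∨ s < 0 ∨ D * D < s ∨ t < 0 ∨ D * D < t ∨
      intDet (e.2 - e.1) (f.2 - f.1) (f.1 - e.1) ≠ 0)

instance (v : Z3) (e f : Z3 × Z3) : Decidable (GeneralPosition v e f) := by
  unfold GeneralPosition
  infer_instance

theorem shadowAvoids_of_intDet_ne_zero {v a : Z3} {f : Z3 × Z3}
    (h : intDet (f.2 - f.1) v (a - f.1) ≠ 0) : ShadowAvoids (toE3 v) (toE3 a) (toSeg f) := by
  intro r hr
  rw [segment_eq_image_lineMap] at hr
  obtain ⟨θ, -, hθ⟩ := hr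
  rw [AffineMap.lineMap_apply_module'] at hθ
  apply h
  have h1 : toE3 (a - f.1) = θ • toE3 (f.2 - f.1) - r • toE3 v := by
    rw [toE3_sub, toE3_sub, eq_sub_iff_add_eq, sub_add_eq_add_sub, ← hθ]
    simp only [toSeg]
    abel
  have h2 := det3_toE3 (f.2 - f.1) v (a - f.1)
  rw [h1] at h2
  have h3 : det3 (toE3 (f.2 - f.1)) (toE3 v) (θ • toE3 (f.2 - f.1) - r • toE3 v) = 0 := by
    simp only [det3_eq, Pi.sub_apply, Pi.smul_apply, smul_eq_mul]
    ring
  exact_mod_cast h2.symm.trans h3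

/-- Cramer's rule for the crossing of two lines. -/
theorem crossing_equations {u w g v : E3} {s t r : ℝ} (h : s • u = g + t • w + r • v) :
    s * det3 u w v = det3 g w v ∧ t * det3 u w v = det3 g u v ∧
      r * det3 u w v = - det3 u w g := by
  have hg : g = s • u - t • w - r • v := by rw [h]; abel
  rw [hg]
  simp only [det3_eq, Pi.sub_apply, Pi.smul_apply, smul_eq_mul]
  refine ⟨?_, ?_, ?_⟩ <;> ring

theorem crossing_solution {u w g v : E3} (h : det3 u w v ≠ 0) :
    (det3 g w v / det3 u w v) • u =
      g + (det3 g u v / det3 u w v) • w + (-det3 u w g / det3 u w v) • v := by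
  have key : det3 g w v • u = det3 u w v • g + det3 g u v • w + (-det3 u w g) • v := by
    ext i
    fin_cases i <;> simp only [det3_eq, Pi.smul_apply, Pi.add_apply, smul_eq_mul, Fin.zero_eta,
      Fin.mk_one, Fin.reduceFinMk] <;> ring
  rw [div_eq_inv_mul, mul_smul, key, smul_add, smul_add, inv_smul_smul₀ h, smul_smul, smul_smul,
    ← div_eq_inv_mul, ← div_eq_inv_mul]

theorem overSign_toSeg (v : Z3) (e f : Z3 × Z3) :
    overSign (toE3 v) (toSeg e) (toSeg f) = crossSign v e f := by
  classical
  set D := intDet (e.2 - e.1) (f.2 - f.1) v with hD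
  have hdet : det3 ((toSeg e).2 - (toSeg e).1) ((toSeg f).2 - (toSeg f).1) (toE3 v) = D := by
    simp only [toSeg, ← toE3_sub, det3_toE3, hD]
  have hS : det3 (toE3 (f.1 - e.1)) (toE3 (f.2 - f.1)) (toE3 v) =
    intDet (f.1 - e.1) (f.2 - f.1) v := det3_toE3 _ _ _
  have hT : det3 (toE3 (f.1 - e.1)) (toE3 (e.2 - e.1)) (toE3 v) =
    intDet (f.1 - e.1) (e.2 - e.1) v := det3_toE3 _ _ _
  have hR : det3 (toE3 (e.2 - e.1)) (toE3 (f.2 - f.1)) (toE3 (f.1 - e.1)) =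
    intDet (e.2 - e.1) (f.2 - f.1) (f.1 - e.1) := det3_toE3 _ _ _
  have hDD : det3 (toE3 (e.2 - e.1)) (toE3 (f.2 - f.1)) (toE3 v) = D := det3_toE3 _ _ _
  rw [overSign, crossSign, hdet]
  simp only [← hD]
  by_cases h0 : D = 0
  · simp [h0]
  have h0' : (D : ℝ) ≠ 0 := by exact_mod_cast h0
  have hpos : (0 : ℝ) < D * D := mul_self_pos.2 h0'
  have hiff : (∃ s ∈ Ioo (0 : ℝ) 1, ∃ t ∈ Ioo (0 : ℝ) 1, ∃ r : ℝ, 0 < r ∧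
      AffineMap.lineMap (toSeg e).1 (toSeg e).2 s =
        (AffineMap.lineMap (toSeg f).1 (toSeg f).2 t : E3) + r • toE3 v) ↔
      (0 < D * intDet (f.1 - e.1) (f.2 - f.1) v ∧ D * intDet (f.1 - e.1) (f.2 - f.1) v < D * D ∧
      0 < D * intDet (f.1 - e.1) (e.2 - e.1) v ∧ D * intDet (f.1 - e.1) (e.2 - e.1) v < D * D ∧
      D * intDet (e.2 - e.1) (f.2 - f.1) (f.1 - e.1) < 0) := by
    have hline : ∀ s t r : ℝ, AffineMap.lineMap (toSeg e).1 (toSeg e).2 s =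
        (AffineMap.lineMap (toSeg f).1 (toSeg f).2 t : E3) + r • toE3 v ↔
        s • toE3 (e.2 - e.1) = toE3 (f.1 - e.1) + t • toE3 (f.2 - f.1) + r • toE3 v := by
      intro s t r
      simp only [AffineMap.lineMap_apply_module', toSeg, toE3_sub]
      rw [← eq_sub_iff_add_eq]
      constructor <;> intro h <;> rw [h] <;> abel
    constructor
    · rintro ⟨s, hs, t, ht, r, hr, h⟩
      obtain ⟨e1, e2, e3⟩ := crossing_equations ((hline s t r).1 h)
      rw [hDD, hS] at e1
      rw [hDD, hT] at e2
      rw [hDD, hR] at e3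
      have k1 : (0 : ℝ) < D * intDet (f.1 - e.1) (f.2 - f.1) v := by
        rw [← e1]; nlinarith [mul_pos hs.1 hpos]
      have k2 : (D * intDet (f.1 - e.1) (f.2 - f.1) v : ℝ) < D * D := by
        rw [← e1]; nlinarith [mul_pos (sub_pos.2 hs.2) hpos]
      have k3 : (0 : ℝ) < D * intDet (f.1 - e.1) (e.2 - e.1) v := by
        rw [← e2]; nlinarith [mul_pos ht.1 hpos]
      have k4 : (D * intDet (f.1 - e.1) (e.2 - e.1) v : ℝ) < D * D := by
        rw [← e2]; nlinarith [mul_pos (sub_pos.2 ht.2) hpos]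
      have k5 : (D * intDet (e.2 - e.1) (f.2 - f.1) (f.1 - e.1) : ℝ) < 0 := by
        have : (D * intDet (e.2 - e.1) (f.2 - f.1) (f.1 - e.1) : ℝ) = -(r * (D * D)) := by
          linear_combination (D : ℝ) * e3
        rw [this]
        exact neg_neg_of_pos (mul_pos hr hpos)
      exact ⟨by exact_mod_cast k1, by exact_mod_cast k2, by exact_mod_cast k3,
        by exact_mod_cast k4, by exact_mod_cast k5⟩
    · rintro ⟨k1, k2, k3, k4, k5⟩
      have k1' : (0 : ℝ) < D * intDet (f.1 - e.1) (f.2 - f.1) v := by exact_mod_cast k1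
      have k2' : (D * intDet (f.1 - e.1) (f.2 - f.1) v : ℝ) < D * D := by exact_mod_cast k2
      have k3' : (0 : ℝ) < D * intDet (f.1 - e.1) (e.2 - e.1) v := by exact_mod_cast k3
      have k4' : (D * intDet (f.1 - e.1) (e.2 - e.1) v : ℝ) < D * D := by exact_mod_cast k4
      have k5' : (D * intDet (e.2 - e.1) (f.2 - f.1) (f.1 - e.1) : ℝ) < 0 := by exact_mod_cast k5
      have hsol := crossing_solution (g := toE3 (f.1 - e.1)) (hDD.trans_ne h0')
      rw [hDD, hS, hT, hR] at hsol
      have hq : ∀ x : ℝ, x / D = D * x / (D * D) := fun x => by field_simp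
      refine ⟨_, ⟨?_, ?_⟩, _, ⟨?_, ?_⟩, _, ?_, (hline _ _ _).2 hsol⟩
      · rw [hq]; exact div_pos k1' hpos
      · rw [hq, div_lt_one hpos]; exact k2'
      · rw [hq]; exact div_pos k3' hpos
      · rw [hq, div_lt_one hpos]; exact k4'
      · rw [hq]; exact div_pos (by linarith) hpos
  rw [if_congr hiff rfl rfl]
  congr 1
  rcases lt_or_gt_of_ne h0 with h | h
  · rw [Int.sign_eq_neg_one_of_neg h, sign_neg (by exact_mod_cast h)]; rfl
  · rw [Int.sign_eq_one_of_pos h, sign_pos (by exact_mod_cast h)]; rfl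

theorem GeneralPosition.genericPair {v : Z3} {e f : Z3 × Z3} (h : GeneralPosition v e f) :
    GenericPair (toE3 v) (toSeg e) (toSeg f) :=
  ⟨shadowAvoids_of_intDet_ne_zero h.1, shadowAvoids_of_intDet_ne_zero h.2.1,
    shadowAvoids_of_intDet_ne_zero h.2.2.1, shadowAvoids_of_intDet_ne_zero h.2.2.2.1⟩

theorem GeneralPosition.disjoint {v : Z3} {e f : Z3 × Z3} (h : GeneralPosition v e f) :
    Disjoint (segment ℝ (toSeg e).1 (toSeg e).2) (segment ℝ (toSeg f).1 (toSeg f).2) := by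
  refine disjoint_left.2 fun x hx hx' => ?_
  rw [segment_eq_image_lineMap] at hx hx'
  obtain ⟨s, hs, rfl⟩ := hx
  obtain ⟨t, ht, he⟩ := hx'
  have hline : s • toE3 (e.2 - e.1) =
      toE3 (f.1 - e.1) + t • toE3 (f.2 - f.1) + (0 : ℝ) • toE3 v := by
    simp only [AffineMap.lineMap_apply_module', toSeg] at he
    simp only [toE3_sub]
    rw [← eq_sub_iff_add_eq] at he
    rw [he]
    module
  obtain ⟨e1, e2, e3⟩ := crossing_equations hline
  rw [det3_toE3, det3_toE3] at e1 e2 e3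
  set D := intDet (e.2 - e.1) (f.2 - f.1) v with hD
  obtain ⟨g1, -, -, -, h5⟩ := h
  have h0 : D ≠ 0 := by
    intro h0
    rw [h0, Int.cast_zero, mul_zero] at e1
    apply g1
    have h2 := det3_toE3 (f.2 - f.1) v (e.1 - f.1)
    have h3 : toE3 (e.1 - f.1) = -toE3 (f.1 - e.1) := by rw [toE3_sub, toE3_sub, neg_sub]
    have h4 : det3 (toE3 (f.2 - f.1)) (toE3 v) (-toE3 (f.1 - e.1)) =
        -det3 (toE3 (f.1 - e.1)) (toE3 (f.2 - f.1)) (toE3 v) := by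
      simp only [det3_eq, Pi.neg_apply]
      ring
    rw [h3, h4, det3_toE3, ← e1, neg_zero] at h2
    exact_mod_cast h2.symm
  have h0' : (D : ℝ) ≠ 0 := by exact_mod_cast h0
  have hpos : (0 : ℝ) < D * D := mul_self_pos.2 h0'
  simp only [← hD] at h5
  rcases h5 with h | h | h | h | h | h
  · exact h0 h
  · have : (D * intDet (f.1 - e.1) (f.2 - f.1) v : ℝ) < 0 := by exact_mod_cast h
    rw [← e1] at this
    nlinarith [mul_nonneg hs.1 hpos.le]
  · have : (D * D : ℝ) < D * intDet (f.1 - e.1) (f.2 - f.1) v := by exact_mod_cast h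
    rw [← e1] at this
    nlinarith [mul_nonneg (sub_nonneg.2 hs.2) hpos.le]
  · have : (D * intDet (f.1 - e.1) (e.2 - e.1) v : ℝ) < 0 := by exact_mod_cast h
    rw [← e2] at this
    nlinarith [mul_nonneg ht.1 hpos.le]
  · have : (D * D : ℝ) < D * intDet (f.1 - e.1) (e.2 - e.1) v := by exact_mod_cast h
    rw [← e2] at this
    nlinarith [mul_nonneg (sub_nonneg.2 ht.2) hpos.le]
  · rw [zero_mul] at e3
    exact h (by exact_mod_cast (neg_eq_zero.1 e3.symm))

/-- A combination of integral segments. -/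
def intChain {ι : Type*} (s : Finset ι) (E : ι → Z3 × Z3) (c : ι → ℤ) : SegChain :=
  ∑ i ∈ s, Finsupp.single (toSeg (E i)) (c i)

theorem overCount_single_single (v : E3) (e f : E3 × E3) (c d : ℤ) :
    overCount v (Finsupp.single e c) (Finsupp.single f d) = c * d * overSign v e f := by
  simp [overCount, Finsupp.sum_single_index]

/-- Equal segments may merge in the chains, so the sum over supports is reached through additivity
in each argument. Additivity in the second one comes from looking along the opposite direction. -/
theorem overCount_intChain {ι κ : Type*} (v : Z3) (s : Finset ι) (E : ι → Z3 × Z3) (c : ι → ℤ)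
    (t : Finset κ) (F : κ → Z3 × Z3) (d : κ → ℤ) :
    overCount (toE3 v) (intChain s E c) (intChain t F d) =
      ∑ i ∈ s, ∑ j ∈ t, c i * d j * crossSign v (E i) (F j) := by
  rw [← overCountHom_apply]
  refine (map_sum _ _ _).trans (Finset.sum_congr rfl fun i _ => ?_)
  rw [overCountHom_apply, overCount_swap, ← overCountHom_apply]
  refine (map_sum _ _ _).trans (Finset.sum_congr rfl fun j _ => ?_)
  rw [overCountHom_apply, ← overCount_swap, overCount_single_single, overSign_toSeg]

theorem disjoint_chainCarrier_intChain {ι κ : Type*} {v : Z3} {s : Finset ι} {E : ι → Z3 × Z3}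
    {c : ι → ℤ} {t : Finset κ} {F : κ → Z3 × Z3} {d : κ → ℤ}
    (h : ∀ i ∈ s, c i ≠ 0 → ∀ j ∈ t, d j ≠ 0 → GeneralPosition v (E i) (F j)) :
    Disjoint (chainCarrier (intChain s E c)) (chainCarrier (intChain t F d)) := by
  refine disjoint_left.2 fun x hx hx' => ?_
  obtain ⟨i, hi, hci, h1⟩ := mem_chainCarrier_sum_single hx
  obtain ⟨j, hj, hdj, h2⟩ := mem_chainCarrier_sum_single hx'
  exact disjoint_left.1 (h i hi hci j hj hdj).disjoint h1 h2

theorem linkingNumber_intChain {ι κ : Type*} (v : Z3) {s : Finset ι} {E : ι → Z3 × Z3}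
    {c : ι → ℤ} {t : Finset κ} {F : κ → Z3 × Z3} {d : κ → ℤ} (hv : v ≠ 0)
    (hs : IsCycle (intChain s E c)) (ht : IsCycle (intChain t F d))
    (h : ∀ i ∈ s, c i ≠ 0 → ∀ j ∈ t, d j ≠ 0 → GeneralPosition v (E i) (F j)) :
    linkingNumber (intChain s E c) (intChain t F d) =
      ∑ i ∈ s, ∑ j ∈ t, c i * d j * crossSign v (E i) (F j) := by
  rw [← overCount_intChain]
  refine linkingNumber_eq_overCount hs ht (disjoint_chainCarrier_intChain h) ⟨?_, ?_⟩
  · intro h0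
    apply hv
    apply toE3_injective
    rw [h0]
    ext i
    fin_cases i <;> simp [toE3]
  · intro e he f hf
    obtain ⟨i, hi, hci, rfl⟩ := mem_support_sum_single he
    obtain ⟨j, hj, hdj, rfl⟩ := mem_support_sum_single hf
    exact (h i hi hci j hj hdj).genericPair

/-! ## Separation of convex hulls -/

/-- The scalar product with an integral vector, as a linear form. -/
def dotForm (l : Z3) : E3 →ₗ[ℝ] ℝ :=
  (l.1 : ℝ) • LinearMap.proj 0 + (l.2.1 : ℝ) • LinearMap.proj 1 + (l.2.2 : ℝ) • LinearMap.proj 2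

theorem dotForm_toE3 (l p : Z3) : dotForm l (toE3 p) = intDot l p := by
  simp [dotForm, intDot]

/-- A convex hull touches a supporting hyperplane only in the hull of the points on it. -/
theorem mem_convexHull_of_le {E : Type*} [AddCommGroup E] [Module ℝ E] (f : E →ₗ[ℝ] ℝ)
    {A B : Set E} {c : ℝ} (hA : ∀ a ∈ A, a ∈ B ∨ f a < c) (hB : ∀ a ∈ B, f a ≤ c) {x : E}
    (hx : x ∈ convexHull ℝ A) (hc : c ≤ f x) : x ∈ convexHull ℝ B := by
  have hconv : Convex ℝ {y | f y ≤ c ∧ (c ≤ f y → y ∈ convexHull ℝ B)} := by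
    intro y hy z hz a b ha hb hab
    have h1 : f (a • y + b • z) = a * f y + b * f z := by simp
    have hya : a * f y ≤ a * c := mul_le_mul_of_nonneg_left hy.1 ha
    have hzb : b * f z ≤ b * c := mul_le_mul_of_nonneg_left hz.1 hb
    have hsum : a * c + b * c = c := by rw [← add_mul, hab, one_mul]
    refine ⟨?_, fun h => ?_⟩
    · rw [h1]
      linarith
    · rw [h1] at h
      rcases ha.eq_or_lt with rfl | ha
      · rw [zero_add] at hab
        subst hab
        rw [zero_smul, zero_add, one_smul]
        exact hz.2 (by linarith)
      · rcases hb.eq_or_lt with rfl | hb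
        · rw [add_zero] at hab
          subst hab
          rw [zero_smul, add_zero, one_smul]
          exact hy.2 (by linarith)
        · refine (convex_convexHull ℝ B) (hy.2 ?_) (hz.2 ?_) ha.le hb.le hab
          · exact le_of_mul_le_mul_left (by linarith) ha
          · exact le_of_mul_le_mul_left (by linarith) hb
  refine (convexHull_min (fun a ha => ?_) hconv hx).2 hc
  rcases hA a ha with h | h
  · exact ⟨hB a h, fun _ => subset_convexHull ℝ B h⟩
  · exact ⟨h.le, fun h' => absurd h (not_lt.2 h')⟩

theorem dotForm_le_of_mem_convexHull {l : Z3} {A : Set E3} {c : ℝ}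
    (h : ∀ a ∈ A, c ≤ dotForm l a) {x : E3} (hx : x ∈ convexHull ℝ A) : c ≤ dotForm l x :=
  convexHull_min (t := {y | c ≤ dotForm l y}) h
    (convex_halfSpace_ge (dotForm l).isLinear c) hx

/-! ## Linking numbers as bilinear forms -/

theorem chainCarrier_add_subset (Z Z' : SegChain) :
    chainCarrier (Z + Z') ⊆ chainCarrier Z ∪ chainCarrier Z' := by
  classical
  intro x hx
  simp only [chainCarrier, mem_iUnion] at hx
  obtain ⟨e, he, hxe⟩ := hx
  rcases Finset.mem_union.1 (Finsupp.support_add he) with h | h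
  · exact Or.inl (segment_subset_chainCarrier h hxe)
  · exact Or.inr (segment_subset_chainCarrier h hxe)

theorem chainCarrier_neg (Z : SegChain) : chainCarrier (-Z) = chainCarrier Z := by
  simp [chainCarrier]

theorem chainCarrier_sub_subset (Z Z' : SegChain) :
    chainCarrier (Z - Z') ⊆ chainCarrier Z ∪ chainCarrier Z' := by
  rw [sub_eq_add_neg, ← chainCarrier_neg Z']
  exact chainCarrier_add_subset Z (-Z')

theorem chainCarrier_zero : chainCarrier 0 = ∅ := by simp [chainCarrier]

theorem chainCarrier_sum_subset {ι : Type*} (s : Finset ι) (Z : ι → SegChain) :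
    chainCarrier (∑ i ∈ s, Z i) ⊆ ⋃ i ∈ s, chainCarrier (Z i) := by
  classical
  induction s using Finset.induction_on with
  | empty => simp [chainCarrier_zero]
  | insert a s ha ih =>
    rw [Finset.sum_insert ha, Finset.set_biUnion_insert]
    exact (chainCarrier_add_subset _ _).trans (union_subset_union_right _ ih)

theorem IsCycle.add {Z Z' : SegChain} (h : IsCycle Z) (h' : IsCycle Z') : IsCycle (Z + Z') := by
  rw [isCycle_iff] at *
  intro g
  rw [map_add, h g, h' g, add_zero]

theorem IsCycle.sub {Z Z' : SegChain} (h : IsCycle Z) (h' : IsCycle Z') : IsCycle (Z - Z') := by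
  rw [isCycle_iff] at *
  intro g
  rw [map_sub, h g, h' g, sub_zero]

theorem IsCycle.sum {ι : Type*} {s : Finset ι} {Z : ι → SegChain}
    (h : ∀ i ∈ s, IsCycle (Z i)) : IsCycle (∑ i ∈ s, Z i) := by
  rw [isCycle_iff]
  intro g
  rw [map_sum]
  exact Finset.sum_eq_zero fun i hi => isCycle_iff.1 (h i hi) g

theorem linkingNumber_add_left {Z Z' W : SegChain} (hZ : IsCycle Z) (hZ' : IsCycle Z')
    (hW : IsCycle W) (h : Disjoint (chainCarrier Z) (chainCarrier W))
    (h' : Disjoint (chainCarrier Z') (chainCarrier W)) :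
    linkingNumber (Z + Z') W = linkingNumber Z W + linkingNumber Z' W := by
  obtain ⟨v, h1, h2, h3⟩ := exists_of_ae ((ae_linkingNumber_eq hZ hW h).and
    ((ae_linkingNumber_eq hZ' hW h').and (ae_linkingNumber_eq (hZ.add hZ') hW
      ((h.union_left h').mono_left (chainCarrier_add_subset Z Z')))))
  rw [h1, h2, h3, ← overCountHom_apply, map_add, overCountHom_apply, overCountHom_apply]

theorem linkingNumber_zero_left (W : SegChain) : linkingNumber 0 W = 0 := by
  rw [linkingNumber]
  split_ifs <;> simp [overCount]

theorem linkingNumber_sum_left {ι : Type*} {s : Finset ι} {Z : ι → SegChain} {W : SegChain}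
    (hZ : ∀ i ∈ s, IsCycle (Z i)) (hW : IsCycle W)
    (h : ∀ i ∈ s, Disjoint (chainCarrier (Z i)) (chainCarrier W)) :
    linkingNumber (∑ i ∈ s, Z i) W = ∑ i ∈ s, linkingNumber (Z i) W := by
  classical
  induction s using Finset.induction_on with
  | empty => simp [linkingNumber_zero_left]
  | insert a s ha ih =>
    rw [Finset.sum_insert ha, Finset.sum_insert ha, linkingNumber_add_left
      (hZ a (Finset.mem_insert_self a s))
      (IsCycle.sum fun i hi => hZ i (Finset.mem_insert_of_mem hi)) hW
      (h a (Finset.mem_insert_self a s))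
      ((disjoint_iUnion₂_left.2 fun i hi => h i (Finset.mem_insert_of_mem hi)).mono_left
        (chainCarrier_sum_subset s Z)),
      ih (fun i hi => hZ i (Finset.mem_insert_of_mem hi))
        fun i hi => h i (Finset.mem_insert_of_mem hi)]

/-- A cycle in a convex set does not link a cycle outside of it. -/
theorem linkingNumber_eq_zero_of_convexHull {Z W : SegChain} (hZ : IsCycle Z) (hW : IsCycle W)
    {A : Set E3} (hA : ∀ e ∈ Z.support, e.1 ∈ A ∧ e.2 ∈ A)
    (hdis : Disjoint (convexHull ℝ A) (chainCarrier W)) : linkingNumber Z W = 0 := by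
  rcases A.eq_empty_or_nonempty with rfl | ⟨p, hp⟩
  · have : Z = 0 := by
      by_contra h
      obtain ⟨e, he⟩ := Finsupp.support_nonempty_iff.2 h
      exact (hA e he).1
    rw [this, linkingNumber_zero_left]
  have hZW : Disjoint (chainCarrier Z) (chainCarrier W) := by
    refine hdis.mono_left (iUnion₂_subset fun e he => ?_)
    exact segment_subset_convexHull (hA e he).1 (hA e he).2
  -- The cycle is coned off from a point `p` of `A`. The triangles lie in the hull, and the radial
  -- edges cancel because `Z` is a cycle.
  have h1 : ∀ᵐ v : E3, ∀ e ∈ Z.support, overCountHom v W (Finsupp.single (p, e.1) 1) +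
      overCountHom v W (Finsupp.single (e.1, e.2) 1) =
      overCountHom v W (Finsupp.single (p, e.2) 1) :=
    (Finset.eventually_all _).2 fun e he => ae_overCountHom_triangle hW
      (hdis.mono_left (convexHull_mono (by
        rintro x (rfl | rfl | rfl)
        exacts [hp, (hA e he).1, (hA e he).2])))
  obtain ⟨v, hv, hv'⟩ := exists_of_ae ((ae_linkingNumber_eq hZ hW hZW).and h1)
  rw [hv, ← overCountHom_apply, ← hZ fun x => overCountHom v W (Finsupp.single (p, x) 1)]
  conv_lhs => rw [← Finsupp.sum_single Z, Finsupp.sum, map_sum]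
  refine Finset.sum_congr rfl fun e he => ?_
  have h2 : overCountHom v W (Finsupp.single e (Z e)) =
      Z e * overCountHom v W (Finsupp.single (e.1, e.2) 1) := by
    rw [overCountHom_single, overCountHom_single, one_mul]
  rw [h2]
  dsimp only
  rw [← hv' e he]
  ring

/-- Hulls of finite sets of integral points that are strictly separated by a linear form are
disjoint. -/
theorem disjoint_convexHull_of_intDot_lt {ι κ : Type*} {l : Z3} {A : ι → Z3} {B : κ → Z3}
    (h : ∀ i j, intDot l (A i) < intDot l (B j)) :
    Disjoint (convexHull ℝ (range fun i => toE3 (A i)))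
      (convexHull ℝ (range fun j => toE3 (B j))) := by
  refine disjoint_left.2 fun x hx hx' => ?_
  have h1 : ∀ j, dotForm l x < intDot l (B j) := fun j =>
    convexHull_min (t := {y | dotForm l y < intDot l (B j)})
      (by
        rintro _ ⟨i, rfl⟩
        rw [mem_ofPred_eq, dotForm_toE3]
        exact_mod_cast h i j)
      (convex_halfSpace_lt (dotForm l).isLinear _) hx
  exact lt_irrefl (dotForm l x) (convexHull_min (t := {y | dotForm l x < dotForm l y})
    (by
      rintro _ ⟨j, rfl⟩
      rw [mem_ofPred_eq, dotForm_toE3]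
      exact h1 j)
    (convex_halfSpace_gt (dotForm l).isLinear _) hx')

/-! ## The strands of the doubled-delta move -/

/-- The vertices of the strands in integral coordinates. -/
def strandPoint (s : ℤ) (after : Bool) (i : Fin 3) (j : Fin 2) (k : Fin 4) : Z3 :=
  let d : ℤ := ((j : ℕ) : ℤ)
  ![ (![-10, -5, 5, 11] k, d, s),
     (d, ![-10, -5, 5, 10] k, 0),
     if after then (![-10, -5, -4, 10] k + d, ![10, -4, -5, -10] k, s * ![0, 4, -3, 0] k)
     else (![-10, 4, 5, 10] k + d, ![10, 5, 4, -10] k, s * ![0, -3, 4, 0] k) ] i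

theorem ddStrand_eq_toE3 (s : ℤ) (after : Bool) (i : Fin 3) (j : Fin 2) (k : Fin 4) :
    ddStrand s after i j k = toE3 (strandPoint s after i j k) := by
  cases after <;> fin_cases i <;> fin_cases j <;> fin_cases k <;>
    simp [ddStrand, strandPoint, toE3] <;> norm_num

/-- The additional vertices of a closed polygon that contains a strand of the given band. -/
def detourPoint (i : Fin 3) : Fin 2 → Z3 :=
  ![![(20, 60, 0), (-20, 60, 0)], ![(-60, 20, 0), (-60, -20, 0)],
    ![(-60, -20, 0), (-60, 20, 0)]] i

/-- An edge, or the reversed edge. -/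
def orientEdge (b : Bool) (p q : Z3) : Z3 × Z3 := if b then (p, q) else (q, p)

/-- The edges of a strand. -/
def strandEdge (s : ℤ) (after : Bool) (i : Fin 3) (j : Fin 2) (b : Bool) (k : Fin 3) : Z3 × Z3 :=
  orientEdge b (strandPoint s after i j k.castSucc) (strandPoint s after i j k.succ)

/-- The edges of a path outside of the box from the end of a strand to its beginning. -/
def detourEdge (s : ℤ) (i : Fin 3) (j : Fin 2) (b : Bool) (k : Fin 3) : Z3 × Z3 :=
  ![orientEdge b (strandPoint s false i j 3) (detourPoint i 0),
    orientEdge b (detourPoint i 0) (detourPoint i 1),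
    orientEdge b (detourPoint i 1) (strandPoint s false i j 0)] k

/-- A strand as a chain. -/
def strandChain (s : ℤ) (after : Bool) (i : Fin 3) (j : Fin 2) (b : Bool) : SegChain :=
  intChain Finset.univ (strandEdge s after i j b) 1

/-- The path outside of the box as a chain. -/
def detourChain (s : ℤ) (i : Fin 3) (j : Fin 2) (b : Bool) : SegChain :=
  intChain Finset.univ (detourEdge s i j b) 1

/-- The edges of a strand closed up outside of the box. -/
def closedStrandEdge (s : ℤ) (after : Bool) (i : Fin 3) (j : Fin 2) (b : Bool)
    (x : Bool × Fin 3) : Z3 × Z3 :=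
  if x.1 then detourEdge s i j b x.2 else strandEdge s after i j b x.2

theorem strandChain_add_detourChain (s : ℤ) (after : Bool) (i : Fin 3) (j : Fin 2) (b : Bool) :
    strandChain s after i j b + detourChain s i j b =
      intChain Finset.univ (closedStrandEdge s after i j b) 1 := by
  simp [strandChain, detourChain, intChain, Fintype.sum_prod_type, closedStrandEdge, add_comm]

theorem strandChain_sub_strandChain (s : ℤ) (i : Fin 3) (j : Fin 2) (b : Bool) :
    strandChain s false i j b - strandChain s true i j b =
      intChain Finset.univ (fun x : Bool × Fin 3 => strandEdge s x.1 i j b x.2)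
        (fun x => if x.1 then -1 else 1) := by
  simp [strandChain, intChain, Fintype.sum_prod_type, sub_eq_neg_add]

theorem isCycle_strandChain_add_detourChain (s : ℤ) (after : Bool) (i : Fin 3) (j : Fin 2)
    (b : Bool) : IsCycle (strandChain s after i j b + detourChain s i j b) := by
  have h : ∀ k : Fin 4, k = 0 ∨ k = 3 → strandPoint s false i j k = strandPoint s after i j k := by
    cases after <;> fin_cases i <;> fin_cases j <;> intro k <;> fin_cases k <;> simp [strandPoint]
  rw [isCycle_iff]
  intro g
  rw [map_add, strandChain, detourChain, intChain, intChain, map_sum, map_sum]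
  simp only [boundaryHom_single, Fin.sum_univ_three]
  cases b <;> simp [strandEdge, detourEdge, orientEdge, toSeg, h 0 (Or.inl rfl), h 3 (Or.inr rfl)]

/-- The strands that have been moved at time `t`; the strand `(2, j)` is moved between the times
`j` and `j + 1`. -/
def isMoved (t : ℕ) (i : Fin 3) (j : Fin 2) : Bool := i = 2 ∧ (j : ℕ) < t

/-- A strand is made a cycle by a path outside of the box, so that its linking number with the
difference of two positions of another strand makes sense. The direction `(0, -1, -2)` is generic
for all the configurations that occur. -/
theorem generalPosition_strands :
    ∀ s ∈ ({1, -1} : Finset ℤ), ∀ (a : Fin 2) (i : Fin 3) (j : Fin 2), (i, j) ≠ (2, a) →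
      ∀ (b b' : Bool) (x y : Bool × Fin 3),
        GeneralPosition (0, -1, -2) (closedStrandEdge s (isMoved a i j) i j b x)
          (strandEdge s y.1 2 a b' y.2) := by
  decide +kernel

/-- The move keeps the over/under information of each pair of strands, so the old position minus the
new one has linking number zero with every other strand. The new position enters with coefficient
`-1`. -/
theorem sum_crossSign_strands :
    ∀ s ∈ ({1, -1} : Finset ℤ), ∀ (a : Fin 2) (i : Fin 3) (j : Fin 2), (i, j) ≠ (2, a) →
      ∀ b b' : Bool, ∑ x : Bool × Fin 3, ∑ y : Bool × Fin 3,
        (if y.1 then -1 else 1) *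
        crossSign (0, -1, -2) (closedStrandEdge s (isMoved a i j) i j b x)
          (strandEdge s y.1 2 a b' y.2) = 0 := by
  decide +kernel

/-- Each edge of the path outside has a plane that strictly separates it from both positions of the
strand `(2, a)`, hence from their convex hull. -/
theorem exists_separating_detour :
    ∀ s ∈ ({1, -1} : Finset ℤ), ∀ (a : Fin 2) (i : Fin 3) (j : Fin 2), (i, j) ≠ (2, a) →
      ∀ k : Fin 3, ∃ l ∈ ({(-1, 1, 0), (-1, -3, 0), (1, 6, 0), (1, 1, 0), (-6, -1, 0), (1, -8, 0)} :
        Finset Z3), ∀ y : Bool × Fin 4,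
          intDot l (strandPoint s y.1 2 a y.2) < intDot l (detourEdge s i j true k).1 ∧
          intDot l (strandPoint s y.1 2 a y.2) < intDot l (detourEdge s i j true k).2 := by
  decide +kernel

/-- The pairs are the outer normals and the bounds of the six faces of the box. The hull of all
positions of the strand meets such a face at most in an end of the strand, so otherwise it lies in
the open box. -/
theorem exists_corner_of_face :
    ∀ s ∈ ({1, -1} : Finset ℤ), ∀ (a : Fin 2),
      ∀ f ∈ ({((-1, 0, 0), 10), ((1, 0, 0), 11), ((0, -1, 0), 10), ((0, 1, 0), 10), ((0, 0, -1), 5),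
        ((0, 0, 1), 5)} : Finset (Z3 × ℤ)), ∃ k ∈ ({0, 3} : Finset (Fin 4)),
        intDot f.1 (strandPoint s false 2 a k) ≤ f.2 ∧ ∀ y : Bool × Fin 4,
          strandPoint s y.1 2 a y.2 = strandPoint s false 2 a k ∨
          intDot f.1 (strandPoint s y.1 2 a y.2) < f.2 := by
  decide +kernel

theorem strandPoint_injective : ∀ s ∈ ({1, -1} : Finset ℤ), ∀ x y : Fin 3 × Fin 2 × Fin 4,
    strandPoint s false x.1 x.2.1 x.2.2 = strandPoint s false y.1 y.2.1 y.2.2 → x = y := by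
  decide +kernel

theorem strandPoint_ends {s : ℤ} {after : Bool} {i : Fin 3} {j : Fin 2} {k : Fin 4}
    (h : k = 0 ∨ k = 3) : strandPoint s after i j k = strandPoint s false i j k := by
  cases after <;> fin_cases i <;> fin_cases j <;> rcases h with rfl | rfl <;> simp [strandPoint]

theorem strandPoint_eq_of_ne {s : ℤ} {b b' : Bool} {i : Fin 3} {j : Fin 2} {k : Fin 4}
    (h : i ≠ 2) : strandPoint s b i j k = strandPoint s b' i j k := by
  fin_cases i
  · rfl
  · rfl
  · exact absurd rfl h

theorem toE3_mem_ddBox {p : Z3} : toE3 p ∈ ddBox ↔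
    -10 < p.1 ∧ p.1 < 11 ∧ -10 < p.2.1 ∧ p.2.1 < 10 ∧ -5 < p.2.2 ∧ p.2.2 < 5 := by
  simp only [ddBox, mem_ofPred_eq, toE3_apply_zero, toE3_apply_one, toE3_apply_two]
  norm_cast

theorem strandPoint_interior : ∀ s ∈ ({1, -1} : Finset ℤ), ∀ (i : Fin 3) (j : Fin 2) (k : Fin 4),
    let p := strandPoint s false i j k
    (-10 < p.1 ∧ p.1 < 11 ∧ -10 < p.2.1 ∧ p.2.1 < 10 ∧ -5 < p.2.2 ∧ p.2.2 < 5) →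
      k = 1 ∨ k = 2 := by
  decide +kernel

/-- All positions of the vertices of the strand `(2, a)`. -/
def strandRange (s : ℤ) (a : Fin 2) : Set E3 :=
  range fun y : Bool × Fin 4 => toE3 (strandPoint s y.1 2 a y.2)

theorem mem_ddBox_of_mem_convexHull {s : ℤ} (hs : s ∈ ({1, -1} : Finset ℤ)) {a : Fin 2} {x : E3}
    (hx : x ∈ convexHull ℝ (strandRange s a)) :
    (∃ k, x = toE3 (strandPoint s false 2 a k)) ∨ x ∈ ddBox := by
  by_contra! hcon
  obtain ⟨hk, hbox⟩ := hcon
  have key : ∀ f ∈ ({((-1, 0, 0), 10), ((1, 0, 0), 11), ((0, -1, 0), 10), ((0, 1, 0), 10),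
      ((0, 0, -1), 5), ((0, 0, 1), 5)} : Finset (Z3 × ℤ)), dotForm f.1 x < f.2 := by
    intro f hf
    by_contra! h
    obtain ⟨k, -, h1, h2⟩ := exists_corner_of_face s hs a f hf
    apply hk k
    rw [← mem_singleton_iff, ← convexHull_singleton (𝕜 := ℝ)]
    refine mem_convexHull_of_le (dotForm f.1) ?_ ?_ hx h
    · rintro _ ⟨y, rfl⟩
      rcases h2 y with h3 | h3
      · exact Or.inl (congrArg toE3 h3)
      · right
        rw [dotForm_toE3]
        exact_mod_cast h3
    · rintro _ rfl
      rw [dotForm_toE3]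
      exact_mod_cast h1
  apply hbox
  simp only [Finset.mem_insert, Finset.mem_singleton, forall_eq_or_imp, forall_eq, dotForm] at key
  simp at key
  obtain ⟨k1, k2, k3, k4, k5, k6⟩ := key
  exact ⟨by linarith, k2, by linarith, k4, by linarith, k6⟩

/-! ### Invariance under a doubled-delta move -/

namespace PLLink

variable {m : ℕ}

/-- The six strands of a doubled-delta move in a link. -/
structure DoubledDeltaTangle (L : PLLink m) where
  s : ℤ
  hs : s ∈ ({1, -1} : Finset ℤ)
  w : Fin 3 → Fin 2 → Fin 4 → Fin L.n
  o : Fin 3 → Fin 2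
  pos_w : ∀ i j k, L.pos (w i j k) = toE3 (strandPoint s false i j k)
  next_w : ∀ (i : Fin 3) (j : Fin 2) (k : Fin 3),
    if j = o i then L.next (w i j k.castSucc) = w i j k.succ
    else L.next (w i j k.succ) = w i j k.castSucc
  carrier_inter : L.carrier ∩ ddBox ⊆
    ⋃ (i : Fin 3) (j : Fin 2) (k : Fin 3), segment ℝ (toE3 (strandPoint s false i j k.castSucc))
      (toE3 (strandPoint s false i j k.succ))

namespace DoubledDeltaTangle

variable {L : PLLink m} (D : L.DoubledDeltaTangle)

theorem w_injective : Function.Injective fun x : Fin 3 × Fin 2 × Fin 4 => D.w x.1 x.2.1 x.2.2 := by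
  intro x y h
  apply strandPoint_injective D.s D.hs
  apply toE3_injective
  rw [← D.pos_w, ← D.pos_w]
  exact congrArg L.pos h

/-- The first vertices of the edges of the strands. -/
def src (x : (Fin 3 × Fin 2) × Fin 3) : Fin L.n :=
  if x.1.2 = D.o x.1.1 then D.w x.1.1 x.1.2 x.2.castSucc else D.w x.1.1 x.1.2 x.2.succ

theorem next_src (x : (Fin 3 × Fin 2) × Fin 3) : L.next (D.src x) =
    if x.1.2 = D.o x.1.1 then D.w x.1.1 x.1.2 x.2.succ else D.w x.1.1 x.1.2 x.2.castSucc := by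
  have := D.next_w x.1.1 x.1.2 x.2
  rw [src]
  split_ifs with h
  · rwa [if_pos h] at this
  · rwa [if_neg h] at this

theorem src_injective : Function.Injective D.src := by
  rintro ⟨⟨i, j⟩, k⟩ ⟨⟨i', j'⟩, k'⟩ h
  simp only [src] at h
  split_ifs at h <;> have h' := D.w_injective (a₁ := (_, _, _)) (a₂ := (_, _, _)) h <;>
    rw [Prod.mk.injEq, Prod.mk.injEq] at h' <;> obtain ⟨rfl, rfl, h2⟩ := h'
  · rw [Fin.castSucc_inj.1 h2]
  · contradiction
  · contradiction
  · rw [Fin.succ_inj.1 h2]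

theorem comp_w (i : Fin 3) (j : Fin 2) (k : Fin 4) : L.comp (D.w i j k) = L.comp (D.w i j 0) := by
  have h : ∀ k : Fin 3, L.comp (D.w i j k.succ) = L.comp (D.w i j k.castSucc) := by
    intro k
    have := D.next_w i j k
    split_ifs at this
    · rw [← this, comp_next]
    · rw [← this, comp_next]
  induction k using Fin.induction with
  | zero => rfl
  | succ k ih => rw [h, ih]

theorem comp_src (x : (Fin 3 × Fin 2) × Fin 3) : L.comp (D.src x) = L.comp (D.w x.1.1 x.1.2 0) := by
  rw [src]
  split_ifs <;> rw [comp_w]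

/-- A vertex in the interior of a strand. -/
theorem exists_src_eq (i : Fin 3) (j : Fin 2) {k : Fin 4} (hk : k = 1 ∨ k = 2) :
    (∃ x, D.w i j k = D.src x) ∧ ∃ x, D.w i j k = L.next (D.src x) := by
  by_cases h : j = D.o i
  · rcases hk with rfl | rfl
    · exact ⟨⟨((i, j), 1), by simp [src, h]⟩, ((i, j), 0), by rw [next_src]; simp [h]⟩
    · exact ⟨⟨((i, j), 2), by simp [src, h]⟩, ((i, j), 1), by rw [next_src]; simp [h]⟩
  · rcases hk with rfl | rfl
    · exact ⟨⟨((i, j), 0), by simp [src, h]⟩, ((i, j), 1), by rw [next_src]; simp [h]⟩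
    · exact ⟨⟨((i, j), 1), by simp [src, h]⟩, ((i, j), 2), by rw [next_src]; simp [h]⟩

/-- The positions of the vertices at time `t`. -/
def position (t : ℕ) : Fin L.n → E3 :=
  Function.extend (fun x : Fin 3 × Fin 2 × Fin 4 => D.w x.1 x.2.1 x.2.2)
    (fun x => toE3 (strandPoint D.s (isMoved t x.1 x.2.1) x.1 x.2.1 x.2.2)) L.pos

theorem position_w (t : ℕ) (i : Fin 3) (j : Fin 2) (k : Fin 4) :
    D.position t (D.w i j k) = toE3 (strandPoint D.s (isMoved t i j) i j k) :=
  D.w_injective.extend_apply _ _ (i, j, k)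

theorem position_of_forall_ne (t : ℕ) {v : Fin L.n} (hv : ∀ i j k, v ≠ D.w i j k) :
    D.position t v = L.pos v :=
  Function.extend_apply' _ _ _ fun ⟨_, hx⟩ => hv _ _ _ hx.symm

theorem position_eq_pos (t : ℕ) {v : Fin L.n} (hv : ∀ i j k, v = D.w i j k → k = 0 ∨ k = 3) :
    D.position t v = L.pos v := by
  by_cases h : ∃ i j k, v = D.w i j k
  · obtain ⟨i, j, k, rfl⟩ := h
    rw [position_w, D.pos_w, strandPoint_ends (hv i j k rfl)]
  · push Not at h
    exact D.position_of_forall_ne t h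

/-- The `i`-th component at time `t`. -/
def chain (t : ℕ) (i : Fin m) : SegChain :=
  ∑ v : Fin L.n with L.comp v = i, Finsupp.single (D.position t v, D.position t (L.next v)) 1

/-- The part of the `i`-th component that does not belong to the strands. -/
def rest (i : Fin m) : SegChain :=
  open Classical in
  ∑ v : Fin L.n with L.comp v = i ∧ v ∉ range D.src, Finsupp.single (L.pos v, L.pos (L.next v)) 1

theorem single_src (t : ℕ) (x : (Fin 3 × Fin 2) × Fin 3) :
    Finsupp.single (D.position t (D.src x), D.position t (L.next (D.src x))) (1 : ℤ) =
      Finsupp.single (toSeg (strandEdge D.s (isMoved t x.1.1 x.1.2) x.1.1 x.1.2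
        (decide (x.1.2 = D.o x.1.1)) x.2)) 1 := by
  rw [next_src, src, strandEdge, orientEdge]
  by_cases h : x.1.2 = D.o x.1.1 <;> simp [h, position_w, toSeg]

/-- Both edges at an inner vertex of a strand belong to the strand, and the ends of the strands do
not move. -/
theorem position_eq_pos_of_notMem_range_src (t : ℕ) {v : Fin L.n} (hv : v ∉ range D.src) :
    D.position t v = L.pos v ∧ D.position t (L.next v) = L.pos (L.next v) := by
  have key : ∀ k : Fin 4, (k = 1 ∨ k = 2) ∨ (k = 0 ∨ k = 3) := by decide
  constructor
  · refine D.position_eq_pos t fun i j k h => (key k).resolve_left fun hk => hv ?_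
    obtain ⟨x, hx⟩ := (D.exists_src_eq i j hk).1
    exact ⟨x, by rw [← hx, h]⟩
  · refine D.position_eq_pos t fun i j k h => (key k).resolve_left fun hk => hv ?_
    obtain ⟨x, hx⟩ := (D.exists_src_eq i j hk).2
    exact ⟨x, L.next.injective (by rw [← hx, h])⟩

theorem chain_eq (t : ℕ) (i : Fin m) : D.chain t i = D.rest i +
    ∑ y : Fin 3 × Fin 2 with L.comp (D.w y.1 y.2 0) = i,
      strandChain D.s (isMoved t y.1 y.2) y.1 y.2 (decide (y.2 = D.o y.1)) := by
  classical
  rw [chain, ← Finset.sum_filter_add_sum_filter_not _ (fun v => v ∉ range D.src),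
    Finset.filter_filter, Finset.filter_filter, rest]
  congr 1
  · refine Finset.sum_congr rfl fun v hv => ?_
    obtain ⟨h1, h2⟩ := D.position_eq_pos_of_notMem_range_src t (Finset.mem_filter.1 hv).2.2
    rw [h1, h2]
  · have h1 : (Finset.univ.filter fun v => L.comp v = i ∧ ¬ v ∉ range D.src) =
        ((Finset.univ.filter fun y : Fin 3 × Fin 2 => L.comp (D.w y.1 y.2 0) = i) ×ˢ
          (Finset.univ : Finset (Fin 3))).map ⟨D.src, D.src_injective⟩ := by
      ext v
      simp only [Finset.mem_filter, Finset.mem_univ, true_and, not_not, Finset.mem_map,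
        Finset.mem_product, and_true, Function.Embedding.coeFn_mk]
      constructor
      · rintro ⟨h, x, rfl⟩
        exact ⟨x, by rw [← h, comp_src], rfl⟩
      · rintro ⟨x, h, rfl⟩
        exact ⟨by rw [comp_src, h], x, rfl⟩
    rw [h1, Finset.sum_map, Finset.sum_product]
    refine Finset.sum_congr rfl fun y _ => Finset.sum_congr rfl fun k _ => ?_
    exact D.single_src t (y, k)

/-- Inside the box the link consists of the strands, so another edge could enter it only at a common
vertex with a strand. A strand vertex in the open box is an inner one, whose two edges both belong
to the strand. -/
theorem notMem_ddBox_of_notMem_range_src {v : Fin L.n} (hv : v ∉ range D.src) {x : E3}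
    (hx : x ∈ segment ℝ (L.pos v) (L.pos (L.next v))) : x ∉ ddBox := by
  intro hbox
  have h1 := D.carrier_inter ⟨mem_iUnion.2 ⟨v, hx⟩, hbox⟩
  simp only [mem_iUnion] at h1
  obtain ⟨i, j, k, hxk⟩ := h1
  obtain ⟨u, ⟨hu, hun⟩, hxu⟩ : ∃ u, ((∃ k', u = D.w i j k') ∧ ∃ k', L.next u = D.w i j k') ∧
      x ∈ segment ℝ (L.pos u) (L.pos (L.next u)) ∧ u ∈ range D.src := by
    refine ⟨D.src ((i, j), k), ?_, ?_, mem_range_self _⟩ <;> rw [next_src, src]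
    · split_ifs <;> exact ⟨⟨_, rfl⟩, _, rfl⟩
    · dsimp only
      split_ifs
      · rwa [D.pos_w, D.pos_w]
      · rwa [D.pos_w, D.pos_w, segment_symm]
  have huv : v ≠ u := fun h => hv (h ▸ hxu.2)
  have hcorner : ∀ k', x ≠ L.pos (D.w i j k') ∨ k' = 1 ∨ k' = 2 := by
    intro k'
    by_cases h : x = L.pos (D.w i j k')
    · right
      rw [D.pos_w] at h
      rw [h, toE3_mem_ddBox] at hbox
      exact strandPoint_interior D.s D.hs i j k' hbox
    · exact Or.inl h
  have hmain : ∃ k', x = L.pos (D.w i j k') ∧ (v = D.w i j k' ∨ L.next v = D.w i j k') := by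
    obtain ⟨hxu, -⟩ := hxu
    rw [segment_eq_image_lineMap] at hx hxu
    obtain ⟨s, hs, rfl⟩ := hx
    obtain ⟨t, ht, he⟩ := hxu
    rcases hs.2.eq_or_lt with rfl | hs1
    · rw [AffineMap.lineMap_apply_one] at he ⊢
      rcases ht.2.eq_or_lt with rfl | ht1
      · rw [AffineMap.lineMap_apply_one] at he
        have := (L.embedded (L.next u) (L.next v) 0 (by simp) 0 (by simp) (by simpa using he)).1
        exact absurd (L.next.injective this).symm huv
      · have := L.embedded u (L.next v) t ⟨ht.1, ht1⟩ 0 (by simp) (by simpa using he)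
        obtain ⟨k', hk'⟩ := hu
        exact ⟨k', by rw [← hk', ← this.1], Or.inr (by rw [← hk', this.1])⟩
    · rcases ht.2.eq_or_lt with rfl | ht1
      · rw [AffineMap.lineMap_apply_one] at he
        have := L.embedded (L.next u) v 0 (by simp) s ⟨hs.1, hs1⟩ (by simpa using he)
        obtain ⟨k', hk'⟩ := hun
        exact ⟨k', by rw [← hk', he], Or.inl (by rw [← hk', this.1])⟩
      · exact absurd (L.embedded v u s ⟨hs.1, hs1⟩ t ⟨ht.1, ht1⟩ he.symm).1 huv
  obtain ⟨k', hxk', h⟩ := hmain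
  have hk' := (hcorner k').resolve_left (not_not.2 hxk')
  rcases h with h | h
  · obtain ⟨y, hy⟩ := (D.exists_src_eq i j hk').1
    exact hv ⟨y, by rw [h, hy]⟩
  · obtain ⟨y, hy⟩ := (D.exists_src_eq i j hk').2
    exact hv ⟨y, L.next.injective (by rw [h, hy])⟩

/-- A point of the hull lies in the open box, which the rest avoids, or is a vertex of the strand,
which belongs to another component. -/
theorem disjoint_rest (a : Fin 2) {j : Fin m} (hj : j ≠ L.comp (D.w 2 a 0)) :
    Disjoint (convexHull ℝ (strandRange D.s a)) (chainCarrier (D.rest j)) := by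
  classical
  refine disjoint_left.2 fun x hx hx' => ?_
  obtain ⟨v, hv, -, hxv⟩ := mem_chainCarrier_sum_single hx'
  rw [Finset.mem_filter] at hv
  rcases mem_ddBox_of_mem_convexHull D.hs hx with ⟨k, hk⟩ | h
  · refine disjoint_left.1 (L.disjoint_compCarrier hj) (mem_compCarrier.2 ⟨v, hv.2.1, hxv⟩)
      (mem_compCarrier.2 ⟨D.w 2 a k, D.comp_w 2 a k, ?_⟩)
    rw [hk, ← D.pos_w]
    exact left_mem_segment ℝ _ _
  · exact D.notMem_ddBox_of_notMem_range_src hv.2.2 hxv h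

theorem disjoint_detourChain {a : Fin 2} {i : Fin 3} {j : Fin 2} (h : (i, j) ≠ (2, a)) (b : Bool) :
    Disjoint (convexHull ℝ (strandRange D.s a)) (chainCarrier (detourChain D.s i j b)) := by
  refine disjoint_left.2 fun x hx hx' => ?_
  obtain ⟨k, -, -, hxk⟩ := mem_chainCarrier_sum_single hx'
  obtain ⟨l, -, hl⟩ := exists_separating_detour D.s D.hs a i j h k
  have hsep := disjoint_convexHull_of_intDot_lt (l := l)
    (A := fun y : Bool × Fin 4 => strandPoint D.s y.1 2 a y.2)
    (B := ![(detourEdge D.s i j true k).1, (detourEdge D.s i j true k).2])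
    (fun y c => by fin_cases c; exacts [(hl y).1, (hl y).2])
  refine disjoint_left.1 hsep hx ?_
  have hr : ∀ b : Bool, segment ℝ (toSeg (detourEdge D.s i j b k)).1
      (toSeg (detourEdge D.s i j b k)).2 = segment ℝ (toE3 (detourEdge D.s i j true k).1)
      (toE3 (detourEdge D.s i j true k).2) := by
    intro b
    cases b
    · rw [segment_symm]
      fin_cases k <;> rfl
    · rfl
  rw [hr] at hxk
  exact segment_subset_convexHull (mem_range.2 ⟨0, rfl⟩) (mem_range.2 ⟨1, rfl⟩) hxk

/-- The difference of the positions of the strand `(2, a)` before and after its move. -/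
def moveChain (a : Fin 2) : SegChain :=
  strandChain D.s false 2 a (decide (a = D.o 2)) - strandChain D.s true 2 a (decide (a = D.o 2))

theorem chain_sub_chain (a : Fin 2) (i : Fin m) : D.chain a i - D.chain (a + 1) i =
    if i = L.comp (D.w 2 a 0) then D.moveChain a else 0 := by
  rw [chain_eq, chain_eq, add_sub_add_left_eq_sub, ← Finset.sum_sub_distrib, Finset.sum_filter,
    Fintype.sum_eq_single (2, a)]
  · have h1 : isMoved a 2 a = false := by simp [isMoved]
    have h2 : isMoved (a + 1) 2 a = true := by simp [isMoved]
    rw [h1, h2]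
    simp only [eq_comm, moveChain]
  · intro y hy
    have h1 : isMoved (a + 1) y.1 y.2 = isMoved a y.1 y.2 := by
      have h2 : y.1 = 2 → y.2 ≠ a := fun h h' => hy (Prod.ext h h')
      simp only [isMoved]
      congr 1
      simp only [eq_iff_iff, and_congr_right_iff, Order.lt_add_one_iff]
      intro h
      have := Fin.val_ne_of_ne (h2 h)
      omega
    rw [h1, sub_self, ite_self]

theorem isCycle_chain (t : ℕ) (i : Fin m) : IsCycle (D.chain t i) :=
  L.isCycle_sum_filter_comp i (D.position t)

theorem isCycle_moveChain (a : Fin 2) : IsCycle (D.moveChain a) := by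
  have := D.chain_sub_chain a (L.comp (D.w 2 a 0))
  rw [if_pos rfl] at this
  rw [← this]
  exact (D.isCycle_chain _ _).sub (D.isCycle_chain _ _)

theorem moveChain_eq (a : Fin 2) : D.moveChain a = intChain Finset.univ
    (fun x : Bool × Fin 3 => strandEdge D.s x.1 2 a (decide (a = D.o 2)) x.2)
    (fun x => if x.1 then -1 else 1) :=
  strandChain_sub_strandChain _ _ _ _

theorem mem_strandRange_of_mem_support {a : Fin 2} {e : E3 × E3}
    (he : e ∈ (D.moveChain a).support) : e.1 ∈ strandRange D.s a ∧ e.2 ∈ strandRange D.s a := by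
  rw [moveChain_eq] at he
  obtain ⟨x, -, -, rfl⟩ := mem_support_sum_single he
  dsimp only [strandEdge, orientEdge]
  split_ifs
  · exact ⟨⟨(x.1, x.2.castSucc), rfl⟩, (x.1, x.2.succ), rfl⟩
  · exact ⟨⟨(x.1, x.2.succ), rfl⟩, (x.1, x.2.castSucc), rfl⟩

theorem chainCarrier_moveChain_subset (a : Fin 2) :
    chainCarrier (D.moveChain a) ⊆ convexHull ℝ (strandRange D.s a) :=
  iUnion₂_subset fun _ he => segment_subset_convexHull (D.mem_strandRange_of_mem_support he).1
    (D.mem_strandRange_of_mem_support he).2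

theorem disjoint_and_linkingNumber_closedStrand {a : Fin 2} {i : Fin 3} {j : Fin 2}
    (h : (i, j) ≠ (2, a)) (b : Bool) :
    Disjoint (chainCarrier (strandChain D.s (isMoved a i j) i j b + detourChain D.s i j b))
      (chainCarrier (D.moveChain a)) ∧
    linkingNumber (strandChain D.s (isMoved a i j) i j b + detourChain D.s i j b)
      (D.moveChain a) = 0 := by
  have hgp := fun x y => generalPosition_strands D.s D.hs a i j h b (decide (a = D.o 2)) x y
  have hc := isCycle_strandChain_add_detourChain D.s (isMoved a i j) i j b
  have hm := D.isCycle_moveChain a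
  rw [strandChain_add_detourChain] at hc ⊢
  rw [moveChain_eq] at hm ⊢
  refine ⟨disjoint_chainCarrier_intChain fun x _ _ y _ _ => hgp x y, ?_⟩
  rw [linkingNumber_intChain (0, -1, -2) (by decide) hc hm fun x _ _ y _ _ => hgp x y]
  simpa only [Pi.one_apply, one_mul] using
    sum_crossSign_strands D.s D.hs a i j h b (decide (a = D.o 2))

theorem disjoint_and_linkingNumber_moveChain {a : Fin 2} {j : Fin m}
    (hj : j ≠ L.comp (D.w 2 a 0)) :
    Disjoint (chainCarrier (D.chain a j)) (chainCarrier (D.moveChain a)) ∧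
      linkingNumber (D.chain a j) (D.moveChain a) = 0 := by
  set J := Finset.univ.filter fun y : Fin 3 × Fin 2 => L.comp (D.w y.1 y.2 0) = j with hJ
  set S : Fin 3 × Fin 2 → SegChain := fun y =>
    strandChain D.s (isMoved a y.1 y.2) y.1 y.2 (decide (y.2 = D.o y.1)) with hS
  set T : Fin 3 × Fin 2 → SegChain := fun y =>
    detourChain D.s y.1 y.2 (decide (y.2 = D.o y.1)) with hT
  have hy : ∀ y ∈ J, (y.1, y.2) ≠ (2, a) := by
    intro y hy h
    rw [Prod.mk.injEq] at h
    rw [hJ, Finset.mem_filter, h.1, h.2] at hy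
    exact hj hy.2.symm
  -- The outside paths are subtracted and added again. The first cycle avoids a convex set
  -- containing `moveChain`; the second one consists of closed strands, which are covered by the
  -- finite computation.
  have heq : D.chain a j = (D.rest j - ∑ y ∈ J, T y) + ∑ y ∈ J, (S y + T y) := by
    rw [chain_eq, Finset.sum_add_distrib]
    abel
  have hcS : IsCycle (∑ y ∈ J, (S y + T y)) :=
    IsCycle.sum fun y _ => isCycle_strandChain_add_detourChain _ _ _ _ _
  have hcR : IsCycle (D.rest j - ∑ y ∈ J, T y) := by
    rw [eq_sub_of_add_eq heq.symm]
    exact (D.isCycle_chain a j).sub hcS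
  have hm := D.isCycle_moveChain a
  have hdS := fun y hyJ => D.disjoint_and_linkingNumber_closedStrand (hy y hyJ)
    (decide (y.2 = D.o y.1))
  have hd1 : Disjoint (chainCarrier (∑ y ∈ J, (S y + T y))) (chainCarrier (D.moveChain a)) :=
    (disjoint_iUnion₂_left.2 fun y hyJ => (hdS y hyJ).1).mono_left (chainCarrier_sum_subset _ _)
  have hd2 : Disjoint (convexHull ℝ (strandRange D.s a))
      (chainCarrier (D.rest j - ∑ y ∈ J, T y)) := by
    refine Disjoint.mono_right (chainCarrier_sub_subset _ _) ((D.disjoint_rest a hj).union_right ?_)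
    refine Disjoint.mono_right (chainCarrier_sum_subset _ _) (disjoint_iUnion₂_right.2 ?_)
    exact fun y hyJ => D.disjoint_detourChain (hy y hyJ) _
  have hd3 := (hd2.mono_left (D.chainCarrier_moveChain_subset a)).symm
  rw [heq]
  refine ⟨(hd3.union_left hd1).mono_left (chainCarrier_add_subset _ _), ?_⟩
  rw [linkingNumber_add_left hcR hcS hm hd3 hd1, linkingNumber_comm hcR hm hd3,
    linkingNumber_eq_zero_of_convexHull hm hcR (fun e he => D.mem_strandRange_of_mem_support he) hd2,
    linkingNumber_sum_left (fun y _ => isCycle_strandChain_add_detourChain _ _ _ _ _) hm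
      (fun y hyJ => (hdS y hyJ).1), zero_add]
  exact Finset.sum_eq_zero fun y hyJ => (hdS y hyJ).2

/-- Only the `i`-th chain changes, by `moveChain`, which does not link the `j`-th one. The
intermediate polygons are not known to form a link, so their disjointness is carried along. -/
theorem linkingNumber_chain_succ_of_eq {a : Fin 2} {i j : Fin m} (hi : i = L.comp (D.w 2 a 0))
    (hij : j ≠ i) (hdis : Disjoint (chainCarrier (D.chain a i)) (chainCarrier (D.chain a j))) :
    Disjoint (chainCarrier (D.chain (a + 1) i)) (chainCarrier (D.chain (a + 1) j)) ∧
      linkingNumber (D.chain (a + 1) i) (D.chain (a + 1) j) =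
        linkingNumber (D.chain a i) (D.chain a j) := by
  have hj := D.chain_sub_chain a j
  have hi' := D.chain_sub_chain a i
  rw [if_neg (hi ▸ hij), sub_eq_zero] at hj
  rw [if_pos hi] at hi'
  obtain ⟨hd, hl⟩ := D.disjoint_and_linkingNumber_moveChain (hi ▸ hij)
  have hd' : Disjoint (chainCarrier (D.chain (a + 1) i)) (chainCarrier (D.chain a j)) := by
    rw [← sub_sub_cancel (D.chain a i) (D.chain (a + 1) i), hi']
    exact (hdis.union_left hd.symm).mono_left (chainCarrier_sub_subset _ _)
  rw [← hj]
  refine ⟨hd', ?_⟩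
  rw [← sub_add_cancel (D.chain a i) (D.chain (a + 1) i), hi',
    linkingNumber_add_left (D.isCycle_moveChain a) (D.isCycle_chain _ _) (D.isCycle_chain _ _)
      hd.symm hd', linkingNumber_comm (D.isCycle_moveChain a) (D.isCycle_chain _ _) hd.symm, hl,
    zero_add]

theorem linkingNumber_chain_succ (a : Fin 2) {t t' : ℕ} (ht : t = a) (ht' : t' = a + 1)
    {i j : Fin m} (hij : i ≠ j)
    (hdis : Disjoint (chainCarrier (D.chain t i)) (chainCarrier (D.chain t j))) :
    Disjoint (chainCarrier (D.chain t' i)) (chainCarrier (D.chain t' j)) ∧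
      linkingNumber (D.chain t' i) (D.chain t' j) =
        linkingNumber (D.chain t i) (D.chain t j) := by
  subst ht ht'
  by_cases hi : i = L.comp (D.w 2 a 0)
  · exact D.linkingNumber_chain_succ_of_eq hi hij.symm hdis
  · by_cases hj : j = L.comp (D.w 2 a 0)
    · obtain ⟨h1, h2⟩ := D.linkingNumber_chain_succ_of_eq hj hij hdis.symm
      refine ⟨h1.symm, ?_⟩
      rw [linkingNumber_comm (D.isCycle_chain _ _) (D.isCycle_chain _ _) h1.symm, h2,
        linkingNumber_comm (D.isCycle_chain _ _) (D.isCycle_chain _ _) hdis]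
    · have h1 := D.chain_sub_chain a i
      have h2 := D.chain_sub_chain a j
      rw [if_neg hi, sub_eq_zero] at h1
      rw [if_neg hj, sub_eq_zero] at h2
      rw [← h1, ← h2]
      exact ⟨hdis, rfl⟩

theorem chain_zero (i : Fin m) : D.chain 0 i = L.component i := by
  have h : D.position 0 = L.pos := by
    funext v
    by_cases hv : ∃ i j k, v = D.w i j k
    · obtain ⟨i, j, k, rfl⟩ := hv
      rw [position_w, D.pos_w]
      simp [isMoved]
    · push Not at hv
      exact D.position_of_forall_ne 0 hv
  rw [chain, h, component]

theorem linkingNumber_chain_two {i j : Fin m} (hij : i ≠ j) :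
    linkingNumber (D.chain 2 i) (D.chain 2 j) = L.lk i j := by
  have h0 := L.disjoint_chainCarrier_component hij
  rw [← D.chain_zero, ← D.chain_zero] at h0
  obtain ⟨h1, h2⟩ := D.linkingNumber_chain_succ 0 (t' := 1) rfl rfl hij h0
  obtain ⟨-, h3⟩ := D.linkingNumber_chain_succ 1 (t' := 2) rfl rfl hij h1
  rw [lk, ← D.chain_zero, ← D.chain_zero]
  exact h3.trans h2

end DoubledDeltaTangle

/-- At time `2` both strands of the third band have moved. The other two bands have the same
position before and after the move, so the chains are then the components of `L'`. -/
theorem DoubledDeltaMove.lk_eq {L L' : PLLink m} (h : L.DoubledDeltaMove L') {i j : Fin m}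
    (hij : i ≠ j) : L.lk i j = L'.lk i j := by
  obtain ⟨s, e, w, o, hs, hpos, hnext, hbox, henext, hecomp, hepos, heold⟩ := h
  obtain ⟨s, rfl, hs1⟩ : ∃ s' : ℤ, s = s' ∧ s' ∈ ({1, -1} : Finset ℤ) := by
    rcases hs with rfl | rfl
    · exact ⟨1, by simp, by simp⟩
    · exact ⟨-1, by simp, by simp⟩
  simp only [ddStrand_eq_toE3] at hpos hbox hepos
  let D : L.DoubledDeltaTangle := ⟨s, hs1, w, o, hpos, hnext, hbox⟩
  have hp : D.position 2 = L'.pos ∘ e := by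
    funext v
    by_cases hv : ∃ i j k, v = w i j k
    · obtain ⟨i, j, k, rfl⟩ := hv
      refine (D.position_w 2 i j k).trans ?_
      rw [Function.comp_apply, hepos]
      congr 1
      by_cases h2 : i = 2
      · congr 1
        simp [isMoved, h2]
        omega
      · exact strandPoint_eq_of_ne h2
    · push Not at hv
      rw [D.position_of_forall_ne 2 hv, Function.comp_apply, heold v hv]
  have hc : ∀ i, D.chain 2 i = L'.component i := by
    intro i
    rw [DoubledDeltaTangle.chain, component, hp]
    refine Finset.sum_equiv e (fun v => ?_) fun v _ => ?_
    · simp [hecomp]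
    · simp [henext]
  rw [← D.linkingNumber_chain_two hij, hc, hc, lk]

theorem DoubledDeltaRelated.lk_eq {L L' : PLLink m} (h : L.DoubledDeltaRelated L') {i j : Fin m}
    (hij : i ≠ j) : L.lk i j = L'.lk i j := by
  induction h with
  | rel L L' h => exact h.elim (fun h => h.lk_eq hij) fun h => h.lk_eq hij
  | refl L => rfl
  | symm _ _ _ ih => exact ih.symm
  | trans _ _ _ _ _ ih ih' => exact ih.trans ih'

end PLLink

/-! ## Links and surfaces with integral vertices -/

/-- The linear form `l` separates two faces of a complex: it is nowhere larger on the first face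
than on the second one, with equality only at vertices of the first face that belong to the
second one. -/
def SeparatesFaces {n a b : ℕ} (pos : Fin n → Z3) (l : Z3) (A : Fin a → Fin n) (B : Fin b → Fin n) :
    Prop :=
  ∀ i j, intDot l (pos (A i)) ≤ intDot l (pos (B j)) ∧
    ((∀ j', B j' ≠ A i) → intDot l (pos (A i)) < intDot l (pos (B j)))

instance {n a b : ℕ} (pos : Fin n → Z3) (l : Z3) (A : Fin a → Fin n) (B : Fin b → Fin n) :
    Decidable (SeparatesFaces pos l A B) := by
  unfold SeparatesFaces
  infer_instance

/-- A common point `x` lies in the hull of `B`, so no vertex of `A` has a larger value of `l` than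
`x`. Thus `x` is a combination of vertices of `A` with that same value, and strictness forces these
to belong to `B`. -/
theorem SeparatesFaces.inter_subset {n a b : ℕ} {pos : Fin n → Z3} {l : Z3} {A : Fin a → Fin n}
    {B : Fin b → Fin n} (h : SeparatesFaces pos l A B) :
    convexHull ℝ ((toE3 ∘ pos) '' range A) ∩ convexHull ℝ ((toE3 ∘ pos) '' range B) ⊆
      convexHull ℝ ((toE3 ∘ pos) '' (range A ∩ range B)) := by
  rintro x ⟨hxA, hxB⟩
  have h1 : ∀ i, (intDot l (pos (A i)) : ℝ) ≤ dotForm l x := by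
    intro i
    refine dotForm_le_of_mem_convexHull ?_ hxB
    rintro _ ⟨_, ⟨j, rfl⟩, rfl⟩
    rw [Function.comp_apply, dotForm_toE3]
    exact_mod_cast (h i j).1
  refine mem_convexHull_of_le (dotForm l) ?_ ?_ hxA le_rfl
  · rintro _ ⟨_, ⟨i, rfl⟩, rfl⟩
    by_cases hi : ∃ j', B j' = A i
    · exact Or.inl ⟨A i, ⟨⟨i, rfl⟩, hi⟩, rfl⟩
    · right
      push Not at hi
      rw [Function.comp_apply, dotForm_toE3]
      refine convexHull_min (t := {y | (intDot l (pos (A i)) : ℝ) < dotForm l y}) ?_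
        (convex_halfSpace_gt (dotForm l).isLinear _) hxB
      rintro _ ⟨_, ⟨j, rfl⟩, rfl⟩
      rw [mem_ofPred_eq, Function.comp_apply, dotForm_toE3]
      exact_mod_cast (h i j).2 hi
  · rintro _ ⟨_, ⟨⟨i, rfl⟩, -⟩, rfl⟩
    rw [Function.comp_apply, dotForm_toE3]
    exact h1 i

/-- Decidable data of a link with integral vertices. -/
structure IntegralLink (m : ℕ) where
  n : ℕ
  next : Equiv.Perm (Fin n)
  comp : Fin n → Fin m
  pos : Fin n → Z3
  comp_surjective : ∀ i, ∃ v, comp v = i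
  comp_next : ∀ v, comp (next v) = comp v
  exists_iterate : ∀ v w, comp v = comp w → ∃ k : Fin n, next^[k] v = w
  pos_ne : ∀ v, pos v ≠ pos (next v)
  next_next_ne : ∀ v, next (next v) ≠ v
  separators : List Z3
  separated : ∀ v w, v < w → ∃ l ∈ separators,
    SeparatesFaces pos l ![v, next v] ![w, next w] ∨ SeparatesFaces pos l ![w, next w] ![v, next v]

namespace IntegralLink

variable {m : ℕ} (K : IntegralLink m)

theorem inter_subset {v w : Fin K.n} (h : v ≠ w) :
    convexHull ℝ ((toE3 ∘ K.pos) '' {v, K.next v}) ∩ convexHull ℝ ((toE3 ∘ K.pos) '' {w, K.next w}) ⊆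
      convexHull ℝ ((toE3 ∘ K.pos) '' ({v, K.next v} ∩ {w, K.next w})) := by
  wlog hvw : v < w generalizing v w
  · rw [inter_comm, inter_comm {v, K.next v}]
    exact this h.symm (lt_of_le_of_ne (not_lt.1 hvw) h.symm)
  obtain ⟨l, -, hl | hl⟩ := K.separated v w hvw
  · simpa only [Matrix.range_cons_cons_empty] using hl.inter_subset
  · rw [inter_comm, inter_comm {v, K.next v}]
    simpa only [Matrix.range_cons_cons_empty] using hl.inter_subset

theorem eq_of_lineMap_eq_left {v : Fin K.n} {s : ℝ}
    (h : AffineMap.lineMap (toE3 (K.pos v)) (toE3 (K.pos (K.next v))) s = toE3 (K.pos v)) :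
    s = 0 := by
  have hne : toE3 (K.pos v) ≠ toE3 (K.pos (K.next v)) := fun h => K.pos_ne v (toE3_injective h)
  apply AffineMap.lineMap_injective ℝ hne
  rw [h, AffineMap.lineMap_apply_zero]

theorem eq_of_lineMap_eq_right {v : Fin K.n} {s : ℝ}
    (h : AffineMap.lineMap (toE3 (K.pos v)) (toE3 (K.pos (K.next v))) s =
      toE3 (K.pos (K.next v))) : s = 1 := by
  have hne : toE3 (K.pos v) ≠ toE3 (K.pos (K.next v)) := fun h => K.pos_ne v (toE3_injective h)
  apply AffineMap.lineMap_injective ℝ hne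
  rw [h, AffineMap.lineMap_apply_one]

/-- The link. -/
def toPLLink : PLLink m where
  n := K.n
  next := K.next
  comp := K.comp
  comp_surjective := K.comp_surjective
  comp_eq_iff v w := by
    constructor
    · intro h
      obtain ⟨k, hk⟩ := K.exists_iterate v w h
      exact ⟨k, by rw [zpow_natCast, Equiv.Perm.coe_pow, hk]⟩
    · have h0 : ∀ (k : ℕ) v, K.comp ((K.next ^ k) v) = K.comp v := by
        intro k
        induction k with
        | zero => intro v; rfl
        | succ k ih => intro v; rw [pow_succ, Equiv.Perm.mul_apply, ih, K.comp_next]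
      rintro ⟨k, rfl⟩
      obtain ⟨k, rfl | rfl⟩ := k.eq_nat_or_neg
      · rw [zpow_natCast, h0]
      · rw [← h0 k ((K.next ^ (-(k : ℤ))) v), ← Equiv.Perm.mul_apply, zpow_neg, zpow_natCast,
          mul_inv_cancel, Equiv.Perm.one_apply]
  pos := toE3 ∘ K.pos
  embedded v w s hs t ht h := by
    simp only [Function.comp_apply] at h
    by_cases hvw : v = w
    · subst hvw
      have hne : toE3 (K.pos v) ≠ toE3 (K.pos (K.next v)) := fun h => K.pos_ne v (toE3_injective h)
      exact ⟨rfl, AffineMap.lineMap_injective ℝ hne h⟩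
    exfalso
    have hmem : ∀ v, ∀ s ∈ Ico (0 : ℝ) 1,
        AffineMap.lineMap (toE3 (K.pos v)) (toE3 (K.pos (K.next v))) s ∈
          convexHull ℝ ((toE3 ∘ K.pos) '' {v, K.next v}) := by
      intro v s hs
      rw [image_pair, convexHull_pair]
      exact lineMap_mem_segment_of_mem_Icc _ _ ⟨hs.1, hs.2.le⟩
    have hx := K.inter_subset hvw ⟨hmem v s hs, h ▸ hmem w t ht⟩
    -- Different edges meet at most in a common vertex. It is the final point of one of them, which
    -- the half-open parameter interval excludes; `next_next_ne` rules out two common vertices.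
    by_cases hv : v = K.next w
    · have hsub : ({v, K.next v} ∩ {w, K.next w} : Set (Fin K.n)) ⊆ {v} := by
        rintro y ⟨rfl | rfl, h1 | h1⟩
        · exact absurd h1 hvw
        · rfl
        · rw [hv] at h1
          exact absurd h1 (K.next_next_ne w)
        · exact absurd (K.next.injective h1) hvw
      have hx' := convexHull_mono (𝕜 := ℝ) (image_mono hsub) hx
      rw [image_singleton, convexHull_singleton, mem_singleton_iff, Function.comp_apply, h, hv] at hx'
      exact ht.2.ne (K.eq_of_lineMap_eq_right hx')
    · have hsub : ({v, K.next v} ∩ {w, K.next w} : Set (Fin K.n)) ⊆ {K.next v} := by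
        rintro y ⟨rfl | rfl, h1 | h1⟩
        · exact absurd h1 hvw
        · exact absurd h1 hv
        · rfl
        · rfl
      have hx' := convexHull_mono (𝕜 := ℝ) (image_mono hsub) hx
      rw [image_singleton, convexHull_singleton, mem_singleton_iff, Function.comp_apply] at hx'
      exact hs.2.ne (K.eq_of_lineMap_eq_right hx')

theorem component_toPLLink (i : Fin m) : K.toPLLink.component i =
    intChain (Finset.univ.filter fun v => K.comp v = i) (fun v => (K.pos v, K.pos (K.next v))) 1 :=
  rfl

theorem lk_toPLLink {v : Z3} (hv : v ≠ 0) {i j : Fin m}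
    (h : ∀ x, K.comp x = i → ∀ y, K.comp y = j →
      GeneralPosition v (K.pos x, K.pos (K.next x)) (K.pos y, K.pos (K.next y))) :
    K.toPLLink.lk i j = ∑ x with K.comp x = i, ∑ y with K.comp y = j,
      crossSign v (K.pos x, K.pos (K.next x)) (K.pos y, K.pos (K.next y)) := by
  have hi := K.toPLLink.isCycle_component i
  have hj := K.toPLLink.isCycle_component j
  rw [component_toPLLink] at hi hj
  rw [PLLink.lk, component_toPLLink, component_toPLLink, linkingNumber_intChain v hv hi hj]
  · simp only [Pi.one_apply, one_mul]
  · intro x hx _ y hy _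
    exact h x (Finset.mem_filter.1 hx).2 y (Finset.mem_filter.1 hy).2

end IntegralLink

/-- The vertex that follows `y` in the link of the vertex `x`, or `y` at the end of the link. -/
def linkNext {n N : ℕ} (tri : Fin N → Fin 3 → Fin n) (x y : Fin n) : Fin n :=
  (((List.finRange N).product (List.finRange 3)).find?
    fun p => tri p.1 p.2 = x ∧ tri p.1 (p.2 + 1) = y).elim y fun p => tri p.1 (p.2 + 2)

theorem linkNext_eq_or {n N : ℕ} (tri : Fin N → Fin 3 → Fin n) (x y : Fin n) :
    linkNext tri x y = y ∨ ∃ σ l, tri σ l = x ∧ tri σ (l + 1) = y ∧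
      tri σ (l + 2) = linkNext tri x y := by
  rw [linkNext]
  cases h : ((List.finRange N).product (List.finRange 3)).find?
    fun p => tri p.1 p.2 = x ∧ tri p.1 (p.2 + 1) = y with
  | none => exact Or.inl rfl
  | some p =>
    have := List.find?_some h
    rw [decide_eq_true_eq] at this
    exact Or.inr ⟨p.1, p.2, this.1, this.2, rfl⟩

theorem eqvGen_iterate {α : Type*} {r : α → α → Prop} {f : α → α}
    (h : ∀ x, Relation.EqvGen r x (f x)) (k : ℕ) (x : α) : Relation.EqvGen r x (f^[k] x) := by
  induction k with
  | zero => exact .refl x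
  | succ k ih =>
    rw [Function.iterate_succ_apply']
    exact .trans _ _ _ ih (h _)

theorem affineIndependent_of_det3_ne_zero {p : Fin 3 → E3} {w : E3}
    (h : det3 (p 1 - p 0) (p 2 - p 0) w ≠ 0) : AffineIndependent ℝ p := by
  rw [affineIndependent_iff_linearIndependent_vsub ℝ p 0]
  have h1 : LinearIndependent ℝ ![p 1 - p 0, p 2 - p 0, w] :=
    Matrix.linearIndependent_rows_of_det_ne_zero h
  have h2 := h1.comp (fun i : {i : Fin 3 // i ≠ 0} => if i.1 = 1 then 0 else 1) (by decide)
  have h3 : (fun i : {i : Fin 3 // i ≠ 0} => p i -ᵥ p 0) =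
      ![p 1 - p 0, p 2 - p 0, w] ∘ fun i => if i.1 = 1 then 0 else 1 := by
    funext ⟨i, hi⟩
    fin_cases i
    · exact absurd rfl hi
    · rfl
    · rfl
  rw [h3]
  exact h2

/-! ### First homology of a triangulated surface -/

/-- The 1-chain that runs around a triangle. -/
def triangleChain {n : ℕ} (v : Fin 3 → Fin n) (x y : Fin n) : ℤ :=
  ∑ k, ((if v k = x ∧ v (k + 1) = y then 1 else 0) - (if v k = y ∧ v (k + 1) = x then 1 else 0))

theorem triangleChain_antisymm {n : ℕ} (v : Fin 3 → Fin n) (x y : Fin n) :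
    triangleChain v y x = -triangleChain v x y := by
  rw [triangleChain, triangleChain, ← Finset.sum_neg_distrib]
  exact Finset.sum_congr rfl fun k _ => (neg_sub _ _).symm

theorem sum_triangleChain {n : ℕ} (v : Fin 3 → Fin n) (y : Fin n) :
    ∑ x, triangleChain v x y = 0 := by
  simp only [triangleChain]
  rw [Finset.sum_comm]
  have h : ∀ k : Fin 3, ∑ x, ((if v k = x ∧ v (k + 1) = y then (1 : ℤ) else 0) -
      (if v k = y ∧ v (k + 1) = x then 1 else 0)) =
      (if v (k + 1) = y then 1 else 0) - (if v k = y then 1 else 0) := by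
    intro k
    rw [Finset.sum_sub_distrib]
    simp only [ite_and]
    simp [Finset.sum_ite_eq]
  simp only [h, Fin.sum_univ_three]
  simp

namespace PLSurface

theorem triangleChain_mem_cycles (F : PLSurface) {v : Fin 3 → Fin F.n}
    (h : ∀ k, F.DirEdge (v k) (v (k + 1))) : triangleChain v ∈ F.cycles := by
  refine ⟨triangleChain_antisymm v, fun x y hxy => ?_, sum_triangleChain v⟩
  obtain ⟨k, -, hk⟩ := Finset.exists_ne_zero_of_sum_ne_zero hxy
  by_cases h1 : v k = x ∧ v (k + 1) = y
  · exact Or.inl (h1.1 ▸ h1.2 ▸ h k)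
  · by_cases h2 : v k = y ∧ v (k + 1) = x
    · exact Or.inr (h2.1 ▸ h2.2 ▸ h k)
    · simp [h1, h2] at hk

theorem triBoundary_mem_cycles (F : PLSurface) (τ : Fin F.numTri) : F.triBoundary τ ∈ F.cycles :=
  F.triangleChain_mem_cycles (v := F.tri τ) fun k => ⟨τ, k, rfl, rfl⟩

theorem boundaries_le_cycles (F : PLSurface) : F.boundaries ≤ F.cycles := by
  rw [boundaries, Submodule.span_le]
  rintro _ ⟨τ, rfl⟩
  exact F.triBoundary_mem_cycles τ

end PLSurface

/-- A cycle in a forest vanishes. -/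
theorem eq_zero_of_supported_on_forest {n : ℕ} {parent : Fin n → Fin n} (hp : ∀ x, parent x ≤ x)
    {c : Fin n → Fin n → ℤ} (hanti : ∀ x y, c y x = -c x y)
    (hsupp : ∀ x y, c x y ≠ 0 → x = parent y ∨ y = parent x) (hcyc : ∀ y, ∑ x, c x y = 0) :
    c = 0 := by
  have hdiag : ∀ x, c x x = 0 := fun x => by linarith [hanti x x]
  -- Descending induction: children are larger than their parent, so at `x` all edges to children
  -- already vanish and the cycle condition kills the edge to the parent.
  have key : ∀ x, c (parent x) x = 0 := by
    intro x
    induction x using (wellFounded_gt (α := Fin n)).induction with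
    | _ x ih =>
      rw [← hcyc x]
      symm
      refine Finset.sum_eq_single _ (fun y _ hy => ?_) (by simp)
      by_contra h
      rcases hsupp y x h with h1 | h1
      · exact hy h1
      · rcases (hp y).eq_or_lt with h2 | h2
        · rw [h1, h2, hdiag] at h
          exact h rfl
        · apply h
          rw [hanti, h1, ih y (h1 ▸ h2), neg_zero]
  funext x y
  by_contra h
  rcases hsupp x y h with h1 | h1
  · exact h (h1 ▸ key y)
  · exact h (by rw [hanti, h1, key x, neg_zero]; rfl)

/-- Gaussian elimination with a unitriangular system of vectors. -/
theorem exists_eq_of_triangular {ι : Type*} (l : List ((ι → ι → ℤ) × ι × ι))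
    (hl : l.Pairwise fun a b => b.1 a.2.1 a.2.2 = 0)
    (h1 : ∀ a ∈ l, a.1 a.2.1 a.2.2 = 1 ∨ a.1 a.2.1 a.2.2 = -1) (c : ι → ι → ℤ) :
    ∃ d ∈ Submodule.span ℤ {p | ∃ a ∈ l, a.1 = p}, ∀ a ∈ l, c a.2.1 a.2.2 = d a.2.1 a.2.2 := by
  induction l generalizing c with
  | nil => exact ⟨0, zero_mem _, by simp⟩
  | cons a l ih =>
    rw [List.pairwise_cons] at hl
    -- The pivot is its own inverse, being `1` or `-1`. The value at the edge of `a` is corrected by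
    -- `a.1`, and the later vectors vanish there.
    obtain ⟨d, hd, hcd⟩ := ih hl.2 (fun b hb => h1 b (List.mem_cons_of_mem a hb))
      (c - (c a.2.1 a.2.2 * a.1 a.2.1 a.2.2) • a.1)
    have hda : d a.2.1 a.2.2 = 0 := by
      have : Submodule.span ℤ {p | ∃ b ∈ l, b.1 = p} ≤
          LinearMap.ker ((LinearMap.proj a.2.2 : (ι → ℤ) →ₗ[ℤ] ℤ) ∘ₗ
            (LinearMap.proj a.2.1 : (ι → ι → ℤ) →ₗ[ℤ] ι → ℤ)) := by
        rw [Submodule.span_le]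
        rintro _ ⟨b, hb, rfl⟩
        exact hl.1 b hb
      exact this hd
    refine ⟨d + (c a.2.1 a.2.2 * a.1 a.2.1 a.2.2) • a.1, add_mem (Submodule.span_mono ?_ hd)
      (Submodule.smul_mem _ _ (Submodule.subset_span ⟨a, by simp, rfl⟩)), fun b hb => ?_⟩
    · rintro _ ⟨b, hb, rfl⟩
      exact ⟨b, List.mem_cons_of_mem a hb, rfl⟩
    · rcases List.mem_cons.1 hb with rfl | hb
      · rcases h1 b (by simp) with h | h <;> simp [hda, h]
      · have := hcd b hb
        simp only [Pi.sub_apply, Pi.smul_apply, smul_eq_mul] at this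
        simp only [Pi.add_apply, Pi.smul_apply, smul_eq_mul]
        linarith

namespace PLSurface

/-- A criterion for cycles to represent a basis of the first homology group: triangles and cycles
in unitriangular position with respect to edges whose complement is a forest, and cocycles dual to
the cycles. -/
theorem exists_basis_H1 (F : PLSurface) {r : ℕ} (z : Fin r → F.cycles)
    (l : List (Fin F.numTri × Fin F.n × Fin F.n)) (f : Fin r → Fin F.n × Fin F.n)
    (parent : Fin F.n → Fin F.n) (α : Fin r → List (Fin F.n × Fin F.n))
    (hl : (l.map (fun a => (F.triBoundary a.1, a.2)) ++
      (List.finRange r).map (fun i => ((z i).1, f i))).Pairwise fun a b => b.1 a.2.1 a.2.2 = 0)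
    (h1 : ∀ a ∈ l.map (fun a => (F.triBoundary a.1, a.2)) ++
      (List.finRange r).map (fun i => ((z i).1, f i)),
      a.1 a.2.1 a.2.2 = 1 ∨ a.1 a.2.1 a.2.2 = -1)
    (hparent : ∀ x, parent x ≤ x)
    (hforest : ∀ τ k, F.tri τ k = parent (F.tri τ (k + 1)) ∨ F.tri τ (k + 1) = parent (F.tri τ k) ∨
      (∃ a ∈ l.map (fun a => a.2) ++ (List.finRange r).map f,
        a = (F.tri τ k, F.tri τ (k + 1)) ∨ a = (F.tri τ (k + 1), F.tri τ k)))
    (hα : ∀ i τ, ((α i).map fun a => F.triBoundary τ a.1 a.2).sum = 0)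
    (hαz : ∀ i j, ((α i).map fun a => (z j).1 a.1 a.2).sum = if i = j then 1 else 0) :
    ∃ b : Module.Basis (Fin r) ℤ F.H1, ∀ i, Submodule.Quotient.mk (z i) = b i := by
  have hmk : ∀ g : Fin r → ℤ, (Submodule.Quotient.mk (∑ i, g i • z i) : F.H1) =
      ∑ i, g i • (Submodule.Quotient.mk (z i) : F.H1) := fun g =>
    (map_sum (Submodule.mkQ _) _ _).trans
      (Finset.sum_congr rfl fun i _ => map_smul (Submodule.mkQ _) _ _)
  -- The functional given by `α i` vanishes on boundaries and reads off the coefficient of `z i`.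
  have hli : LinearIndependent ℤ fun i => (Submodule.Quotient.mk (z i) : F.H1) := by
    rw [Fintype.linearIndependent_iff]
    intro g hg i
    let A : (Fin F.n → Fin F.n → ℤ) →ₗ[ℤ] ℤ :=
      { toFun := fun c => ((α i).map fun a => c a.1 a.2).sum
        map_add' := fun c d => by simp only [Pi.add_apply, List.sum_map_add]
        map_smul' := fun t c => by
          simp only [Pi.smul_apply, smul_eq_mul, List.sum_map_mul_left, RingHom.id_apply] }
    have hA : F.boundaries ≤ LinearMap.ker A := by
      rw [boundaries, Submodule.span_le]
      rintro _ ⟨τ, rfl⟩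
      exact hα i τ
    have h2 : ∑ j, g j • z j ∈ F.boundaries.submoduleOf F.cycles := by
      rw [← Submodule.Quotient.mk_eq_zero, ← hg]
      exact hmk g
    have h3 : A (∑ j, g j • (z j).1) = 0 := by
      refine hA ?_
      simpa [Submodule.submoduleOf] using h2
    rw [map_sum] at h3
    have h4 : ∀ j, A (z j).1 = if i = j then 1 else 0 := hαz i
    simp only [map_smul, h4, smul_eq_mul, mul_ite, mul_one, mul_zero] at h3
    simpa using h3
  -- Elimination yields a combination of triangles and of the `z i` that agrees with a given cycle
  -- on the pivot edges. The difference is a cycle supported on the forest, hence zero.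
  have hspan : ⊤ ≤ Submodule.span ℤ (range fun i => (Submodule.Quotient.mk (z i) : F.H1)) := by
    rintro q -
    obtain ⟨c, rfl⟩ := Submodule.Quotient.mk_surjective _ q
    obtain ⟨d, hd, hcd⟩ := exists_eq_of_triangular _ hl h1 c.1
    have hd' : d ∈ F.boundaries ⊔ Submodule.span ℤ (range fun i => (z i).1) := by
      refine Submodule.span_le.2 ?_ hd
      rintro _ ⟨a, ha, rfl⟩
      rcases List.mem_append.1 ha with ha | ha
      · obtain ⟨x, -, rfl⟩ := List.mem_map.1 ha
        exact Submodule.mem_sup_left (Submodule.subset_span ⟨x.1, rfl⟩)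
      · obtain ⟨i, -, rfl⟩ := List.mem_map.1 ha
        exact Submodule.mem_sup_right (Submodule.subset_span ⟨i, rfl⟩)
    have hz : Submodule.span ℤ (range fun i => (z i).1) ≤ F.cycles := by
      rw [Submodule.span_le]
      rintro _ ⟨i, rfl⟩
      exact (z i).2
    have hdc : c.1 - d ∈ F.cycles :=
      sub_mem c.2 (sup_le F.boundaries_le_cycles hz hd')
    have h0 : c.1 - d = 0 := by
      obtain ⟨e1, e2, e3⟩ := hdc
      refine eq_zero_of_supported_on_forest hparent e1 (fun x y hxy => ?_) e3
      have hzero : ∀ a ∈ l.map (fun a => a.2) ++ (List.finRange r).map f,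
          (c.1 - d) a.1 a.2 = 0 := by
        intro a ha
        simp only [Pi.sub_apply, sub_eq_zero]
        rcases List.mem_append.1 ha with ha | ha
        · obtain ⟨x, hx, rfl⟩ := List.mem_map.1 ha
          exact hcd (F.triBoundary x.1, x.2) (List.mem_append_left _ (List.mem_map_of_mem hx))
        · obtain ⟨i, hi, rfl⟩ := List.mem_map.1 ha
          exact hcd ((z i).1, f i) (List.mem_append_right _ (List.mem_map_of_mem hi))
      have hedge : ∀ x y, (c.1 - d) x y ≠ 0 → F.DirEdge x y → x = parent y ∨ y = parent x := by
        rintro _ _ hxy ⟨τ, k, rfl, rfl⟩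
        rcases hforest τ k with h | h | ⟨a, ha, rfl | rfl⟩
        · exact Or.inl h
        · exact Or.inr h
        · exact absurd (hzero _ ha) hxy
        · rw [e1] at hxy
          exact absurd (hzero _ ha) (neg_ne_zero.1 hxy)
      rcases e2 x y hxy with h | h
      · exact hedge x y hxy h
      · refine (hedge y x ?_ h).symm
        rw [e1]
        exact neg_ne_zero.2 hxy
    rw [sub_eq_zero] at h0
    obtain ⟨b, hb, z', hz', hsum⟩ := Submodule.mem_sup.1 hd'
    rw [← h0] at hsum
    obtain ⟨g, hg⟩ := (Submodule.mem_span_range_iff_exists_fun ℤ).1 hz'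
    have h5 : (Submodule.Quotient.mk c : F.H1) =
        ∑ i, g i • (Submodule.Quotient.mk (z i) : F.H1) := by
      rw [← hmk, Submodule.Quotient.eq, Submodule.submoduleOf, Submodule.mem_comap]
      have h7 : F.cycles.subtype (c - ∑ i, g i • z i) = b := by
        rw [map_sub, map_sum]
        simp only [map_smul, Submodule.subtype_apply]
        rw [hg, ← hsum, add_sub_cancel_right]
      rw [h7]
      exact hb
    rw [h5]
    exact Submodule.sum_mem _ fun i _ => Submodule.smul_mem _ _ (Submodule.subset_span ⟨i, rfl⟩)
  exact ⟨Module.Basis.mk hli hspan, fun i => (Module.Basis.mk_apply hli hspan i).symm⟩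

end PLSurface

/-! ## Polygonal cycles on integral surfaces -/

/-- Decidable data of a surface with integral vertices, all of them on the boundary, and a vector
field that pushes the surface off itself. -/
structure IntegralSurface where
  n : ℕ
  numTri : ℕ
  pos : Fin n → Z3
  normal : Fin n → Z3
  tri : Fin numTri → Fin 3 → Fin n
  /-- The successor of a vertex on the boundary. -/
  next : Equiv.Perm (Fin n)
  /-- The parent of a vertex in a spanning tree. -/
  parent : Fin n → Fin n
  root : Fin n
  separators : List Z3
  det_pos : ∀ τ k, 0 < intDet (pos (tri τ 1) - pos (tri τ 0)) (pos (tri τ 2) - pos (tri τ 0))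
    (normal (tri τ k))
  exists_ne : ∀ τ τ', τ ≠ τ' → ∃ k, ∀ k', tri τ' k' ≠ tri τ k
  separated : ∀ τ τ', τ < τ' → ∃ l ∈ separators,
    SeparatesFaces pos l (tri τ) (tri τ') ∨ SeparatesFaces pos l (tri τ') (tri τ)
  -- The inequality is weak at time `0` and strict at time `1`. Interpolation makes it strict at all
  -- times in between, so one form serves the whole push.
  separated_pushoff : ∀ τ τ', ∃ l ∈ separators, ∀ k k',
    intDot l (pos (tri τ k)) ≤ intDot l (pos (tri τ' k')) ∧
      intDot l (pos (tri τ k)) < intDot l (pos (tri τ' k') + normal (tri τ' k'))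
  vertex_mem : ∀ x, ∃ τ k, tri τ k = x
  edge_inj : ∀ τ τ' k k', tri τ k = tri τ' k' → tri τ (k + 1) = tri τ' (k' + 1) → τ = τ' ∧ k = k'
  -- All vertices are on the boundary, so links are arcs. From every start, the walk along the link
  -- of a vertex ends at its predecessor on the boundary, which makes the link connected.
  link_end : ∀ τ k, next ((linkNext tri (tri τ k))^[numTri] (tri τ (k + 1))) = tri τ k
  parent_adj : ∀ x, parent x = x ∨
    ∃ τ k, (tri τ k = x ∧ tri τ (k + 1) = parent x) ∨ (tri τ k = parent x ∧ tri τ (k + 1) = x)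
  parent_iterate : ∀ x, parent^[n] x = root
  boundary_iff : ∀ x y, ((∃ τ k, tri τ k = x ∧ tri τ (k + 1) = y) ∧
    ¬ ∃ τ k, tri τ k = y ∧ tri τ (k + 1) = x) ↔ y = next x

namespace IntegralSurface

variable (S : IntegralSurface)

theorem inter_subset {τ τ' : Fin S.numTri} (h : τ ≠ τ') :
    convexHull ℝ ((toE3 ∘ S.pos) '' range (S.tri τ)) ∩
      convexHull ℝ ((toE3 ∘ S.pos) '' range (S.tri τ')) ⊆
      convexHull ℝ ((toE3 ∘ S.pos) '' (range (S.tri τ) ∩ range (S.tri τ'))) := by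
  wlog hlt : τ < τ' generalizing τ τ'
  · rw [inter_comm, inter_comm (range (S.tri τ))]
    exact this h.symm (lt_of_le_of_ne (not_lt.1 hlt) h.symm)
  obtain ⟨l, -, hl | hl⟩ := S.separated τ τ' hlt
  · exact hl.inter_subset
  · rw [inter_comm, inter_comm (range (S.tri τ))]
    exact hl.inter_subset

/-- The surface. -/
def toPLSurface : PLSurface where
  n := S.n
  numTri := S.numTri
  pos := toE3 ∘ S.pos
  tri := S.tri
  nondegenerate τ := by
    refine affineIndependent_of_det3_ne_zero (w := toE3 (S.normal (S.tri τ 0))) ?_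
    simp only [Function.comp_apply]
    rw [← toE3_sub, ← toE3_sub, det3_toE3]
    exact_mod_cast (S.det_pos τ 0).ne'
  tri_inj τ τ' h := by
    by_contra hne
    obtain ⟨k, hk⟩ := S.exists_ne τ τ' hne
    obtain ⟨k', hk'⟩ := h ▸ mem_range_self (f := S.tri τ) k
    exact hk k' hk'
  inter τ τ' := by
    by_cases h : τ = τ'
    · subst h
      rw [inter_self, inter_self]
    · exact S.inter_subset h
  vertex_mem := S.vertex_mem
  edge_inj := S.edge_inj
  link_connected x τ k τ' k' h h' := by
    set r : Fin S.n → Fin S.n → Prop := fun y z => ∃ σ l, S.tri σ l = x ∧ S.tri σ (l + 1) = y ∧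
      S.tri σ (l + 2) = z
    have hr : ∀ y, Relation.EqvGen r y (linkNext S.tri x y) := by
      intro y
      rcases linkNext_eq_or S.tri x y with h | h
      · rw [h]
        exact .refl y
      · exact .rel _ _ h
    have h1 := S.link_end τ k
    have h2 := S.link_end τ' k'
    rw [h] at h1
    rw [h'] at h2
    have h3 := S.next.injective (h1.trans h2.symm)
    refine .trans _ _ _ (eqvGen_iterate hr S.numTri _) (.symm _ _ ?_)
    rw [h3]
    exact eqvGen_iterate hr S.numTri _
  connected x y := by
    set r : Fin S.n → Fin S.n → Prop := fun x y => ∃ τ k, S.tri τ k = x ∧ S.tri τ (k + 1) = y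
    have hr : ∀ x, Relation.EqvGen r x (S.parent x) := by
      intro x
      rcases S.parent_adj x with h | ⟨τ, k, h | h⟩
      · rw [h]
        exact .refl x
      · exact .rel _ _ ⟨τ, k, h⟩
      · exact .symm _ _ (.rel _ _ ⟨τ, k, h⟩)
    have h1 := eqvGen_iterate hr S.n x
    have h2 := eqvGen_iterate hr S.n y
    rw [S.parent_iterate] at h1 h2
    exact .trans _ _ _ h1 (.symm _ _ h2)

theorem boundary_toPLSurface : S.toPLSurface.boundary =
    range fun v => ((toE3 ∘ S.pos) v, (toE3 ∘ S.pos) (S.next v)) := by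
  ext p
  constructor
  · rintro ⟨x, y, h1, h2, rfl⟩
    have := (S.boundary_iff x y).1 ⟨h1, h2⟩
    exact ⟨x, this ▸ rfl⟩
  · rintro ⟨x, rfl⟩
    obtain ⟨h1, h2⟩ := (S.boundary_iff x (S.next x)).2 rfl
    exact ⟨x, S.next x, h1, h2, rfl⟩

/-- The vector field that pushes the surface off itself. -/
def normalField : Fin S.toPLSurface.n → E3 := toE3 ∘ S.normal

theorem isPositivePushoff_normalField : S.toPLSurface.IsPositivePushoff S.normalField := by
  constructor
  · intro τ k
    simp only [toPLSurface, normalField, Function.comp_apply]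
    rw [← toE3_sub, ← toE3_sub, det3_toE3]
    exact_mod_cast S.det_pos τ k
  · rintro t ⟨ht0, ht1⟩
    refine disjoint_left.2 fun x hx hx' => ?_
    obtain ⟨τ, hx⟩ := mem_iUnion.1 hx
    obtain ⟨τ', hx'⟩ := mem_iUnion.1 hx'
    obtain ⟨l, -, hl⟩ := S.separated_pushoff τ τ'
    have h1 : ∀ k k', (intDot l (S.pos (S.tri τ k)) : ℝ) <
        dotForm l ((S.toPLSurface.pos + t • S.normalField) (S.tri τ' k')) := by
      intro k k'
      obtain ⟨h2, h3⟩ := hl k k'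
      have h4 : dotForm l (toE3 (S.pos (S.tri τ' k') + S.normal (S.tri τ' k'))) =
          dotForm l (toE3 (S.pos (S.tri τ' k'))) + dotForm l (toE3 (S.normal (S.tri τ' k'))) := by
        rw [toE3_add, map_add]
      have h2' : (intDot l (S.pos (S.tri τ k)) : ℝ) ≤ dotForm l (toE3 (S.pos (S.tri τ' k'))) := by
        rw [dotForm_toE3]
        exact_mod_cast h2
      have h3' : (intDot l (S.pos (S.tri τ k)) : ℝ) <
          dotForm l (toE3 (S.pos (S.tri τ' k'))) + dotForm l (toE3 (S.normal (S.tri τ' k'))) := by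
        rw [← h4, dotForm_toE3]
        exact_mod_cast h3
      have h5 : dotForm l ((S.toPLSurface.pos + t • S.normalField) (S.tri τ' k')) =
          dotForm l (toE3 (S.pos (S.tri τ' k'))) +
            t * dotForm l (toE3 (S.normal (S.tri τ' k'))) := by
        rw [← smul_eq_mul, ← map_smul, ← map_add]
        rfl
      rw [h5]
      nlinarith
    have h2 : ∀ k, (intDot l (S.pos (S.tri τ k)) : ℝ) < dotForm l x := by
      intro k
      refine convexHull_min (t := {y | (intDot l (S.pos (S.tri τ k)) : ℝ) < dotForm l y}) ?_
        (convex_halfSpace_gt (dotForm l).isLinear _) hx'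
      rintro _ ⟨k', rfl⟩
      exact h1 k k'
    refine lt_irrefl (dotForm l x) (convexHull_min (t := {y | dotForm l y < dotForm l x}) ?_
      (convex_halfSpace_lt (dotForm l).isLinear _) hx)
    rintro _ ⟨k, rfl⟩
    rw [mem_ofPred_eq]
    refine lt_of_eq_of_lt ?_ (h2 k)
    exact dotForm_toE3 l _

end IntegralSurface

/-- Reduces the sum over all pairs of vertices to a few edges, which keeps the later decisions
small. -/
theorem toSegChain_eq_intChain (F : PLSurface) (p : Fin F.n → Z3) (c : Fin F.n → Fin F.n → ℤ)
    (s : Finset (Fin F.n × Fin F.n)) (hs : ∀ e ∈ s, e.1 < e.2)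
    (hc : ∀ x y, x < y → c x y ≠ 0 → (x, y) ∈ s) :
    F.toSegChain (toE3 ∘ p) c = intChain s (fun e => (p e.1, p e.2)) fun e => c e.1 e.2 := by
  classical
  rw [PLSurface.toSegChain, intChain, Finset.sum_sigma']
  refine (Finset.sum_of_injOn (fun e => (⟨e.1, e.2⟩ : Σ _ : Fin F.n, Fin F.n)) ?_ ?_ ?_ ?_).symm
  · rintro ⟨x, y⟩ - ⟨x', y'⟩ - h
    simp only [Sigma.mk.injEq, heq_eq_eq] at h
    rw [h.1, h.2]
  · intro e he
    simpa using hs e he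
  · rintro ⟨x, y⟩ hxy hne
    have hlt : x < y := by simpa using hxy
    have h0 : c x y = 0 := by
      by_contra h
      exact hne ⟨(x, y), hc x y hlt h, rfl⟩
    simp [h0]
  · intro e _
    rfl

/-- A 1-cycle of a surface is a polygonal cycle. -/
theorem PLSurface.isCycle_toSegChain (F : PLSurface) (p : Fin F.n → E3) {c : Fin F.n → Fin F.n → ℤ}
    (hc : c ∈ F.cycles) : IsCycle (F.toSegChain p c) := by
  obtain ⟨h1, -, h3⟩ := hc
  rw [isCycle_iff]
  intro g
  have hdiag : ∀ x, c x x = 0 := fun x => by linarith [h1 x x]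
  -- By antisymmetry the sum over `x < y` becomes the sum of `c x y * g (p y)` over all pairs, which
  -- vanishes for each `y`.
  have key : ∀ x y, (if x < y then c x y * (g (p y) - g (p x)) else 0) =
      (if x < y then c x y * g (p y) else 0) + (if x < y then c y x * g (p x) else 0) := by
    intro x y
    split_ifs
    · rw [h1 x y]
      ring
    · rfl
  have key' : ∀ x y, (if x < y then c x y * g (p y) else 0) +
      (if y < x then c x y * g (p y) else 0) = c x y * g (p y) := by
    intro x y
    rcases lt_trichotomy x y with h | rfl | h
    · rw [if_pos h, if_neg h.not_gt, add_zero]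
    · simp [hdiag]
    · rw [if_neg h.not_gt, if_pos h, zero_add]
  rw [PLSurface.toSegChain, map_sum]
  simp only [map_sum, boundaryHom_single]
  simp only [← Finset.filter_lt_eq_Ioi, Finset.sum_filter, key, Finset.sum_add_distrib]
  rw [Finset.sum_comm (f := fun x y => if x < y then c y x * g (p x) else 0),
    ← Finset.sum_add_distrib]
  simp only [← Finset.sum_add_distrib, key']
  rw [Finset.sum_comm]
  simp only [← Finset.sum_mul, h3, zero_mul, Finset.sum_const_zero]

namespace IntegralSurface

variable (S : IntegralSurface)

theorem linkingNumber_pushoff {v : Z3} (hv : v ≠ 0) (c d : S.toPLSurface.cycles)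
    (s t : Finset (Fin S.n × Fin S.n)) (hs : ∀ e ∈ s, e.1 < e.2) (ht : ∀ e ∈ t, e.1 < e.2)
    (hc : ∀ x y : Fin S.n, x < y → c.1 x y ≠ 0 → (x, y) ∈ s)
    (hd : ∀ x y : Fin S.n, x < y → d.1 x y ≠ 0 → (x, y) ∈ t)
    (h : ∀ e ∈ s, ∀ f ∈ t, GeneralPosition v (S.pos e.1, S.pos e.2)
      (S.pos f.1 + S.normal f.1, S.pos f.2 + S.normal f.2)) :
    linkingNumber (S.toPLSurface.toSegChain S.toPLSurface.pos c)
      (S.toPLSurface.toSegChain (S.toPLSurface.pos + S.normalField) d) =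
      ∑ e ∈ s, ∑ f ∈ t, c.1 e.1 e.2 * d.1 f.1 f.2 * crossSign v (S.pos e.1, S.pos e.2)
        (S.pos f.1 + S.normal f.1, S.pos f.2 + S.normal f.2) := by
  have hpos : S.toPLSurface.pos + S.normalField = toE3 ∘ fun x => S.pos x + S.normal x := by
    funext x
    exact (toE3_add _ _).symm
  have e1 : S.toPLSurface.toSegChain S.toPLSurface.pos c =
      intChain s (fun e => (S.pos e.1, S.pos e.2)) fun e => c.1 e.1 e.2 :=
    toSegChain_eq_intChain S.toPLSurface S.pos c.1 s hs hc
  have e2 : S.toPLSurface.toSegChain (S.toPLSurface.pos + S.normalField) d =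
      intChain t (fun e => (S.pos e.1 + S.normal e.1, S.pos e.2 + S.normal e.2))
        fun e => d.1 e.1 e.2 := by
    rw [hpos]
    exact toSegChain_eq_intChain S.toPLSurface (fun x => S.pos x + S.normal x) d.1 t ht hd
  have h1 := S.toPLSurface.isCycle_toSegChain S.toPLSurface.pos c.2
  have h2 := S.toPLSurface.isCycle_toSegChain (S.toPLSurface.pos + S.normalField) d.2
  rw [e1] at h1 ⊢
  rw [e2] at h2 ⊢
  exact linkingNumber_intChain v hv h1 h2 fun e he _ f hf _ => h e he f hf

/-- A boundary component with three vertices, as a cycle of the surface. -/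
def boundaryTriangle (v : Fin 3 → Fin S.n) (hv : ∀ k, v (k + 1) = S.next (v k)) :
    S.toPLSurface.cycles :=
  ⟨triangleChain v, S.toPLSurface.triangleChain_mem_cycles fun k =>
    ((S.boundary_iff (v k) (v (k + 1))).2 (hv k)).1⟩

/-- The Seifert matrix of a surface whose first homology group is generated by boundary components
with three vertices. -/
theorem isSeifertMatrix {m r : ℕ} {L : PLLink m} (hL : L.IsSeifertSurface S.toPLSurface)
    (M : Matrix (Fin r) (Fin r) ℤ) (z : Fin r → Fin 3 → Fin S.n)
    (hz : ∀ i k, z i (k + 1) = S.next (z i k))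
    (l : List (Fin S.numTri × Fin S.n × Fin S.n)) (f : Fin r → Fin S.n × Fin S.n)
    (α : Fin r → List (Fin S.n × Fin S.n)) (s : Fin r → Finset (Fin S.n × Fin S.n)) {v : Z3}
    (hl : (l.map (fun a => (triangleChain (S.tri a.1), a.2)) ++
      (List.finRange r).map (fun i => (triangleChain (z i), f i))).Pairwise
      fun a b => b.1 a.2.1 a.2.2 = 0)
    (h1 : ∀ a ∈ l.map (fun a => (triangleChain (S.tri a.1), a.2)) ++
      (List.finRange r).map (fun i => (triangleChain (z i), f i)),
      a.1 a.2.1 a.2.2 = 1 ∨ a.1 a.2.1 a.2.2 = -1)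
    (hparent : ∀ x, S.parent x ≤ x)
    (hforest : ∀ τ k, S.tri τ k = S.parent (S.tri τ (k + 1)) ∨
      S.tri τ (k + 1) = S.parent (S.tri τ k) ∨
      (∃ a ∈ l.map (fun a => a.2) ++ (List.finRange r).map f,
        a = (S.tri τ k, S.tri τ (k + 1)) ∨ a = (S.tri τ (k + 1), S.tri τ k)))
    (hα : ∀ i τ, ((α i).map fun a => triangleChain (S.tri τ) a.1 a.2).sum = 0)
    (hαz : ∀ i j, ((α i).map fun a => triangleChain (z j) a.1 a.2).sum = if i = j then 1 else 0)
    (hv : v ≠ 0) (hs : ∀ i, ∀ e ∈ s i, e.1 < e.2)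
    (hzs : ∀ i, ∀ x y : Fin S.n, x < y → triangleChain (z i) x y ≠ 0 → (x, y) ∈ s i)
    (hgp : ∀ i j, ∀ e ∈ s i, ∀ f ∈ s j, GeneralPosition v (S.pos e.1, S.pos e.2)
      (S.pos f.1 + S.normal f.1, S.pos f.2 + S.normal f.2))
    (hM : ∀ i j, M i j = ∑ e ∈ s i, ∑ f ∈ s j, triangleChain (z i) e.1 e.2 *
      triangleChain (z j) f.1 f.2 * crossSign v (S.pos e.1, S.pos e.2)
        (S.pos f.1 + S.normal f.1, S.pos f.2 + S.normal f.2)) :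
    L.IsSeifertMatrix M := by
  obtain ⟨b, hb⟩ := S.toPLSurface.exists_basis_H1 (fun i => S.boundaryTriangle (z i) (hz i)) l f
    S.parent α hl h1 hparent hforest hα hαz
  refine ⟨S.toPLSurface, S.normalField, b, fun i => S.boundaryTriangle (z i) (hz i), hL,
    S.isPositivePushoff_normalField, hb, fun i j => ?_⟩
  rw [hM, S.linkingNumber_pushoff hv _ _ (s i) (s j) (hs i) (hs j) (hzs i) (hzs j) (hgp i j)]
  rfl

end IntegralSurface

/-! ## Two links -/

/-- A sphere with three holes. -/
abbrev firstSurface : IntegralSurface where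
  n := 12
  numTri := 14
  pos := ![(8, 4, 0), (-4, -4, 4), (8, 4, 4), (-4, 0, -8), (0, 4, 0), (0, -8, 4), (-12, 4, -12), (-4, 4,
    -8), (-12, 4, -8), (0, -4, -12), (0, 0, 0), (-4, -8, -12)]
  normal := ![(-2, -1, 0), (-2, 0, 1), (-2, -1, 1), (1, -2, 1), (-1, -1, -2), (1, -2, 1), (2, -1, -1), (1,
    -1, 2), (2, -1, 0), (2, 0, -1), (-1, -2, -1), (-1, -2, -1)]
  tri := ![![0, 1, 2], ![5, 2, 1], ![1, 3, 5], ![7, 5, 3], ![3, 0, 7], ![2, 7, 0], ![8, 9, 6], ![11, 6,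
    9], ![9, 10, 11], ![4, 11, 10], ![10, 8, 4], ![6, 4, 8], ![7, 2, 4], ![7, 4, 6]]
  next := ⟨![1, 3, 4, 0, 11, 2, 7, 5, 9, 10, 8, 6], ![3, 0, 5, 1, 2, 7, 11, 6, 10, 8, 9, 4],
    by decide, by decide⟩
  parent := ![0, 0, 0, 1, 2, 3, 4, 6, 6, 8, 9, 10]
  root := 0
  separators := [(-1, 1, -6), (0, -1, 0), (1, 1, 3), (2, 5, -2), (-3, 0, 1), (-4, 3, 4), (3, 0, -1), (-1, -3,
    3), (1, -5, -6), (-2, 3, 0), (2, 3, 0), (2, 0, -3), (-2, 0, 3), (3, 2, -3), (-3, -3, -1), (3,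
    -3, 1), (-1, -3, 0), (0, 0, -1), (0, 0, 1), (1, -2, 0), (1, 4, -4), (-2, 0, 1), (-1, -1, 2),
    (-3, -1, 0), (-3, 1, 0), (0, 3, -1), (0, 3, 1), (-1, 4, 4)]
  det_pos := by decide +kernel
  exists_ne := by decide +kernel
  separated := by decide +kernel
  separated_pushoff := by decide +kernel
  vertex_mem := by decide +kernel
  edge_inj := by decide +kernel
  link_end := by decide +kernel
  parent_adj := by decide +kernel
  parent_iterate := by decide +kernel
  boundary_iff := by decide +kernel

/-- The boundary of `firstSurface`. -/
abbrev firstLink : IntegralLink 3 where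
  n := 12
  next := firstSurface.next
  comp := ![0, 0, 2, 0, 2, 2, 2, 2, 1, 1, 1, 2]
  pos := firstSurface.pos
  separators := firstSurface.separators
  comp_surjective := by decide +kernel
  comp_next := by decide +kernel
  exists_iterate := by decide +kernel
  pos_ne := by decide +kernel
  next_next_ne := by decide +kernel
  separated := by decide +kernel

theorem isSeifertSurface_firstSurface :
    firstLink.toPLLink.IsSeifertSurface firstSurface.toPLSurface :=
  firstSurface.boundary_toPLSurface

theorem isSeifertMatrix_firstLink : firstLink.toPLLink.IsSeifertMatrix !![-1, -1; -1, -1] := by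
  refine firstSurface.isSeifertMatrix isSeifertSurface_firstSurface _
    (z := (![![0, 1, 3], ![8, 9, 10]] : Fin 2 → Fin 3 → Fin 12))
    -- An order in which the surface can be collapsed: each triangle is removed through an edge that
    -- belongs to no later one.
    (l := ([(1, (5, 2)), (0, (1, 2)), (2, (5, 1)), (3, (7, 5)), (4, (7, 3)), (5, (7, 0)), (7, (11, 6)),
      (6, (9, 6)), (8, (11, 9)), (9, (4, 11)), (10, (4, 10)), (11, (4, 8)), (12, (7, 2)), (13, (7,
      4))] :
      List (Fin 14 × Fin 12 × Fin 12)))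
    (f := (![(3, 0), (10, 8)] : Fin 2 → Fin 12 × Fin 12))
    -- The edges crossed by an arc in the surface from the `i`-th basis component to the boundary
    -- component outside the basis; counting crossings with the arc is the dual cocycle.
    (α := (![[(0, 1), (2, 1), (2, 5)], [(8, 9), (6, 9), (6, 11)]] :
      Fin 2 → List (Fin 12 × Fin 12)))
    (s := (![{(0, 1), (0, 3), (1, 3)}, {(8, 9), (8, 10), (9, 10)}] :
      Fin 2 → Finset (Fin 12 × Fin 12)))
    (v := (-1, -3, -1)) ?_ ?_ ?_ ?_ ?_ ?_ ?_ ?_ ?_ ?_ ?_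
    fun i j => ?_
  on_goal 12 => fin_cases i <;> fin_cases j
  all_goals decide +kernel

theorem lk_firstLink_zero_one : firstLink.toPLLink.lk 0 1 = -1 := by
  rw [firstLink.lk_toPLLink (v := (-1, -3, -1)) (by decide) (by decide +kernel)]
  decide +kernel

theorem lk_firstLink_zero_two : firstLink.toPLLink.lk 0 2 = 2 := by
  rw [firstLink.lk_toPLLink (v := (-1, -3, -1)) (by decide) (by decide +kernel)]
  decide +kernel

theorem lk_firstLink_one_two : firstLink.toPLLink.lk 1 2 = 2 := by
  rw [firstLink.lk_toPLLink (v := (-1, -3, -1)) (by decide) (by decide +kernel)]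
  decide +kernel

/-- Another sphere with three holes. -/
abbrev secondSurface : IntegralSurface where
  n := 9
  numTri := 11
  pos := ![(0, 0, -4), (0, -8, 8), (4, 8, 4), (-2, -2, 1), (4, 0, 8), (-4, 0, 0), (-1, -2, 0), (-1, -4,
    3), (8, -8, 4)]
  normal := ![(0, 0, -1), (-2, 1, 0), (0, 0, -1), (-1, -2, -1), (0, -1, -2), (-2, 1, 0), (-1, -2, -1), (-1,
    -2, -1), (-1, 1, 0)]
  tri := ![![8, 5, 1], ![1, 4, 8], ![2, 8, 4], ![4, 0, 2], ![5, 2, 0], ![0, 1, 6], ![1, 7, 6], ![1, 5,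
    7], ![5, 3, 7], ![5, 0, 3], ![0, 6, 3]]
  next := ⟨![1, 4, 8, 7, 0, 2, 3, 6, 5], ![4, 0, 5, 6, 1, 8, 7, 3, 2],
    by decide, by decide⟩
  parent := ![0, 0, 0, 0, 1, 3, 3, 3, 4]
  root := 0
  separators := [(-2, -3, -2), (2, 5, 4), (-2, 3, -2), (4, -1, -1), (-4, -1, -2), (-2, -3, 1), (-6, -3, 2), (2,
    -1, -1), (-2, 1, -4), (2, -1, 4), (6, -1, -2), (-1, 0, 2), (-6, -1, -2), (1, 1, -1), (-3, -6,
    -4)]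
  det_pos := by decide +kernel
  exists_ne := by decide +kernel
  separated := by decide +kernel
  separated_pushoff := by decide +kernel
  vertex_mem := by decide +kernel
  edge_inj := by decide +kernel
  link_end := by decide +kernel
  parent_adj := by decide +kernel
  parent_iterate := by decide +kernel
  boundary_iff := by decide +kernel

/-- The boundary of `secondSurface`. -/
abbrev secondLink : IntegralLink 3 where
  n := 9
  next := secondSurface.next
  comp := ![0, 0, 1, 2, 0, 1, 2, 2, 1]
  pos := secondSurface.pos
  separators := secondSurface.separators
  comp_surjective := by decide +kernel
  comp_next := by decide +kernel
  exists_iterate := by decide +kernel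
  pos_ne := by decide +kernel
  next_next_ne := by decide +kernel
  separated := by decide +kernel

theorem isSeifertSurface_secondSurface :
    secondLink.toPLLink.IsSeifertSurface secondSurface.toPLSurface :=
  secondSurface.boundary_toPLSurface

/-- The basis consists of the components `0` and `2`, which do not link; with `0` and `1` the entry
off the diagonal would be their linking number `1`. -/
theorem isSeifertMatrix_secondLink : secondLink.toPLLink.IsSeifertMatrix !![-1, 0; 0, 0] := by
  refine secondSurface.isSeifertMatrix isSeifertSurface_secondSurface _
    (z := (![![0, 1, 4], ![6, 3, 7]] : Fin 2 → Fin 3 → Fin 9))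
    (l := ([(0, (8, 5)), (1, (8, 1)), (2, (2, 8)), (3, (2, 4)), (4, (5, 2)), (7, (1, 5)), (6, (1, 7)),
      (5, (1, 6)), (8, (7, 5)), (9, (5, 0)), (10, (0, 6))] :
      List (Fin 11 × Fin 9 × Fin 9)))
    (f := (![(4, 0), (7, 6)] : Fin 2 → Fin 9 × Fin 9))
    (α := (![[(1, 4), (8, 4), (8, 2)], [(3, 7), (3, 5), (0, 5), (2, 5)]] :
      Fin 2 → List (Fin 9 × Fin 9)))
    (s := (![{(0, 1), (0, 4), (1, 4)}, {(3, 6), (3, 7), (6, 7)}] :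
      Fin 2 → Finset (Fin 9 × Fin 9)))
    (v := (-1, 1, 1)) ?_ ?_ ?_ ?_ ?_ ?_ ?_ ?_ ?_ ?_ ?_
    fun i j => ?_
  on_goal 12 => fin_cases i <;> fin_cases j
  all_goals decide +kernel

theorem lk_secondLink_zero_one : secondLink.toPLLink.lk 0 1 = 1 := by
  rw [secondLink.lk_toPLLink (v := (-1, 1, 1)) (by decide) (by decide +kernel)]
  decide +kernel

theorem lk_secondLink_zero_two : secondLink.toPLLink.lk 0 2 = 0 := by
  rw [secondLink.lk_toPLLink (v := (-1, 1, 1)) (by decide) (by decide +kernel)]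
  decide +kernel

theorem lk_secondLink_one_two : secondLink.toPLLink.lk 1 2 = 0 := by
  rw [secondLink.lk_toPLLink (v := (-1, 1, 1)) (by decide) (by decide +kernel)]
  decide +kernel

end

/-! ### S-equivalence of the two links and the conclusion -/

theorem sEquivalentMatrices_first_second :
    SEquivalentMatrices !![-1, -1; -1, -1] !![-1, 0; 0, 0] := by
  have h := SStep.congruence (!![-1, 0; 0, 0] : Matrix (Fin 2) (Fin 2) ℤ) !![1, 1; 0, 1]
    (Or.inl (by decide))
  have e : (!![1, 1; 0, 1] : Matrix (Fin 2) (Fin 2) ℤ)ᵀ * !![-1, 0; 0, 0] * !![1, 1; 0, 1] =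
      !![-1, -1; -1, -1] := by decide
  rw [e] at h
  exact .rel _ _ h

theorem mainTheorem2 :
    (∀ (m : ℕ) (L L' : PLLink m), L.DoubledDeltaRelated L' →
      ∀ i j : Fin m, i ≠ j → L.lk i j = L'.lk i j) ∧
    ∃ L₀ L₁ : PLLink 3,
      L₀.IsSeifertMatrix !![-1, -1; -1, -1] ∧
      L₁.IsSeifertMatrix !![-1, 0; 0, 0] ∧
      (!![1, 1; 0, 1] : Matrix (Fin 2) (Fin 2) ℤ)ᵀ * !![-1, 0; 0, 0] * !![1, 1; 0, 1] =
        !![-1, -1; -1, -1] ∧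
      L₀.SEquivalent L₁ ∧
      (L₀.lk 0 1 = -1 ∧ L₀.lk 0 2 = 2 ∧ L₀.lk 1 2 = 2) ∧
      (L₁.lk 0 1 = 1 ∧ L₁.lk 0 2 = 0 ∧ L₁.lk 1 2 = 0) ∧
      ¬ L₀.DoubledDeltaRelated L₁ := by
  refine ⟨fun m L L' h i j hij => h.lk_eq hij, firstLink.toPLLink, secondLink.toPLLink,
    isSeifertMatrix_firstLink, isSeifertMatrix_secondLink, by decide,
    ⟨2, 2, _, _, isSeifertMatrix_firstLink, isSeifertMatrix_secondLink,
      sEquivalentMatrices_first_second⟩,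
    ⟨lk_firstLink_zero_one, lk_firstLink_zero_two, lk_firstLink_one_two⟩,
    ⟨lk_secondLink_zero_one, lk_secondLink_zero_two, lk_secondLink_one_two⟩, fun h => ?_⟩
  have := h.lk_eq (i := 0) (j := 1) (by decide)
  rw [lk_firstLink_zero_one, lk_secondLink_zero_one] at this
  exact absurd this (by decide)
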